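/- **Setting.** Let $0\le\alpha\le 4/\pi$, $\Lambda>0$, $m_0>0$, and let $B=B(0,\Lambda)\subset\mathbb R^3$. Write $\widehat g(k)=(2\pi)^{-3/2}\int_{\mathbb R^3} g(x)e^{-ik\cdot x}dx$ and let $\mathfrak H_\Lambda=\{\psi\in L^2(\mathbb R^3,\mathbb C^4):\operatorname{supp}\widehat\psi\subset B\}$, identified with $L^2(B,\mathbb C^4)$ by the Fourier transform. Let $D^0(p)=\boldsymbol\alpha\cdot p+m_0\beta$, where $\boldsymbol\alpha=(\alpha_1,\alpha_2,\alpha_3)$ and $\beta$ are the Dirac matrices. *Free vacuum.* Let $\mathcal A_\Lambda$ be the set of measurable functions $f$ on $B$ with values in the self-adjoint $4\times4$ complex matrices such that $-\frac12\le f\le\frac12$ a.e., and let $$\mathcal T(f)=\frac1{(2\pi)^3}\int_B \operatorname{tr}[D^0(p)f(p)]\,dp-\frac{\alpha}{(2\pi)^5}\iint_{B\times B}\frac{\operatorname{tr}[f(p)f(q)]}{|p-q|^2}\,dp\,dq .$$ For a minimizer $\bar f$ of $\mathcal T$ on $\mathcal A_\Lambda$ (the free vacuum) let $\gamma^0=\bar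 f(-i\nabla)$, $\mathcal P^0_-=\gamma^0+\frac12$, $\mathcal P^0_+=1-\mathcal P^0_-$, and let $\mathcal D^0$ be the operator of multiplication in Fourier space by $$\mathcal D^0(p)=D^0(p)-\frac{\alpha}{2\pi^2}\int_B\frac{\bar f(q)}{|p-q|^2}\,dq .$$ *BDF energy.* A Hilbert–Schmidt operator $Q$ on $\mathfrak H_\Lambda$ has a momentum kernel $\widehat Q(p,q)$ (extended by $0$ outside $B\times B$), a position kernel $Q(x,y)=(2\pi)^{-3}\iint\widehat Q(p,q)e^{i(p\cdot x-q\cdot y)}dp\,dq$, and a charge density $\rho_Q$ with $\widehat{\rho_Q}(k)=(2\pi)^{-3/2}\int_B\operatorname{tr}_{\mathbb C^4}\widehat Q(p+\tfrac k2,p-\tfrac k2)\,dp$. Let $$D(f,g)=4\pi\int_{\mathbb R^3}\frac{\overline{\widehat f(k)}\,\widehat g(k)}{|k|^2}\,dk,$$ and let the Coulomb space $\mathcal C$ consist of the tempered distributions $f$ whose Fourier transform is a function with $D(f,f)<\infty$. Let $\mathcal Q_\Lambda$ be the set of Hilbert–Schmidt operators $Q$ on $\mathfrak H_\Lambda$ such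 that $\mathcal P^0_+Q\mathcal P^0_+$ and $\mathcal P^0_-Q\mathcal P^0_-$ are trace class, $-\mathcal P^0_-\le Q\le\mathcal P^0_+$, and $\rho_Q\in\mathcal C$. For $n\in\mathcal C$ and $\phi=\alpha\, n*|\cdot|^{-1}$ let $$\mathcal E^\phi_{\rm BDF}(Q)=\operatorname{tr}_{\mathcal P^0_-}(\mathcal D^0Q)+\frac\alpha2D(\rho_Q,\rho_Q)-\alpha D(\rho_Q,n)-\frac\alpha2\iint_{\mathbb R^6}\frac{|Q(x,y)|^2}{|x-y|}\,dx\,dy,$$ where $\operatorname{tr}_{\mathcal P^0_-}(A)=\operatorname{tr}(\mathcal P^0_+A\mathcal P^0_++\mathcal P^0_-A\mathcal P^0_-)$, and where $D(\rho_Q,n)$, which is real for real-valued $n$, is replaced by its real part if $n$ is complex-valued. **Theorem (the BDF energy is bounded below).** $\mathcal T$ has a minimizer on $\mathcal A_\Lambda$. For every minimizer $\bar f$, with the objects above defined from it, the exchange integral $\iint|Q(x,y)|^2|x-y|^{-1}dx\,dy$ is finite for every $Q\in\mathcal Q_\Lambda$, and the following hold. 1. For every $n\in\mathcal C$, $$\mathcal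 E^\phi_{\rm BDF}(Q)+\frac\alpha2D(n,n)\ge0\qquad\text{for all }Q\in\mathcal Q_\Lambda ,$$ and therefore $\mathcal E^\phi_{\rm BDF}$ is bounded from below on $\mathcal Q_\Lambda$. 2. If $n=0$, then $\mathcal E^0_{\rm BDF}\ge0$ on $\mathcal Q_\Lambda$, and $0\in\mathcal Q_\Lambda$ is the unique minimizer of $\mathcal E^0_{\rm BDF}$ on $\mathcal Q_\Lambda$. (In this sense $\gamma^0$ is also stable under Hilbert–Schmidt perturbations.) -/

import Mathlib

open MeasureTheory Complex
open scoped SchwartzMap FourierTransform ComplexConjugate ComplexOrder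

noncomputable section

namespace BDF

/-- Physical space, or momentum space, `ℝ³`. -/
abbrev E3 : Type := EuclideanSpace ℝ (Fin 3)

/-- The spinor space `ℂ⁴`. -/
abbrev Spinor : Type := EuclideanSpace ℂ (Fin 4)

/-- Complex `4 × 4` matrices. -/
abbrev Mat4 : Type := Matrix (Fin 4) (Fin 4) ℂ

/-- Lebesgue measure on the momentum ball `B(0, Λ)`. -/
def ballMeasure (Λ : ℝ) : Measure E3 := volume.restrict (Metric.ball 0 Λ)

/-- The one-particle space with ultraviolet cut-off, in the momentum representation: a state `ψ` in
`L²(ℝ³, ℂ⁴)` whose Fourier transform is supported in `B(0, Λ)` is represented by its Fourier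
transform, an arbitrary element of `L²(B(0, Λ), ℂ⁴)`. -/
abbrev Space (Λ : ℝ) : Type := Lp Spinor 2 (ballMeasure Λ)

/-! ## Dirac matrices and the free Dirac operator -/

/-- The Dirac matrices `α₁, α₂, α₃`. -/
def diracAlpha : Fin 3 → Mat4 := ![
  !![0, 0, 0, 1; 0, 0, 1, 0; 0, 1, 0, 0; 1, 0, 0, 0],
  !![0, 0, 0, -I; 0, 0, I, 0; 0, -I, 0, 0; I, 0, 0, 0],
  !![0, 0, 1, 0; 0, 0, 0, -1; 1, 0, 0, 0; 0, -1, 0, 0]]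

/-- The Dirac matrix `β`. -/
def diracBeta : Mat4 := !![1, 0, 0, 0; 0, 1, 0, 0; 0, 0, -1, 0; 0, 0, 0, -1]

/-- The symbol `D⁰(p) = α · p + m₀ β` of the free Dirac operator. -/
def diracSymbol (m₀ : ℝ) (p : E3) : Mat4 :=
  (∑ j : Fin 3, ((p j : ℝ) : ℂ) • diracAlpha j) + (m₀ : ℂ) • diracBeta

/-! ## The free vacuum -/

/-- The set `𝒜_Λ` of (bounded, measurable) functions on `B(0, Λ)` with values in the self-adjoint
`4 × 4` matrices such that `-1/2 ≤ f ≤ 1/2`. Values outside the ball are irrelevant. -/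
def admissibleSymbols (Λ : ℝ) : Set (E3 → Mat4) :=
  {f | (∀ i j, AEStronglyMeasurable (fun p => f p i j) (ballMeasure Λ)) ∧
    ∀ᵐ p ∂(ballMeasure Λ), ((1 / 2 : ℂ) • (1 : Mat4) + f p).PosSemidef ∧
      ((1 / 2 : ℂ) • (1 : Mat4) - f p).PosSemidef}

/-- The energy per unit volume `𝒯(f)` of the translation-invariant state `f(-i∇)`. -/
def energyPerVolume (α m₀ Λ : ℝ) (f : E3 → Mat4) : ℝ :=
  1 / (2 * Real.pi) ^ 3 * ∫ p, (diracSymbol m₀ p * f p).trace.re ∂(ballMeasure Λ)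
    - α / (2 * Real.pi) ^ 5 *
      ∫ z : E3 × E3, (f z.1 * f z.2).trace.re / ‖z.1 - z.2‖ ^ 2
        ∂((ballMeasure Λ).prod (ballMeasure Λ))

/-- `f` is a minimizer of the energy per unit volume on `𝒜_Λ`: the free vacuum is
`γ⁰ = f(-i∇)`. -/
def IsFreeVacuum (α m₀ Λ : ℝ) (f : E3 → Mat4) : Prop :=
  f ∈ admissibleSymbols Λ ∧
    ∀ g ∈ admissibleSymbols Λ, energyPerVolume α m₀ Λ f ≤ energyPerVolume α m₀ Λ g

/-- The symbol of the mean-field operator `𝒟⁰ = D⁰ - α γ⁰(x,y) / |x - y|`, that is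
`𝒟⁰(p) = D⁰(p) - α / (2π²) ∫_{B(0,Λ)} f(q) / |p - q|² dq`. -/
def meanFieldSymbol (α m₀ Λ : ℝ) (f : E3 → Mat4) (p : E3) : Mat4 :=
  diracSymbol m₀ p - ((α / (2 * Real.pi ^ 2) : ℝ) : ℂ) •
    Matrix.of fun i j => ∫ q, f q i j / ((‖p - q‖ ^ 2 : ℝ) : ℂ) ∂(ballMeasure Λ)

/-- `T` acts as multiplication by the matrix-valued function `m` in momentum space. -/
def IsMultiplier {Λ : ℝ} (m : E3 → Mat4) (T : Space Λ →L[ℂ] Space Λ) : Prop :=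
  ∀ ψ : Space Λ, (T ψ : E3 → Spinor) =ᵐ[ballMeasure Λ] fun p => Matrix.toEuclideanLin (m p) (ψ p)

open Classical in
/-- The operator `m(-i∇)`: the (unique) bounded operator on the one-particle space acting as
multiplication by `m` in momentum space. It exists whenever `m` is measurable and bounded. -/
def multiplier (Λ : ℝ) (m : E3 → Mat4) : Space Λ →L[ℂ] Space Λ :=
  if h : ∃ T : Space Λ →L[ℂ] Space Λ, IsMultiplier m T then h.choose else 0

/-- The projector `𝒫⁰₋ = γ⁰ + 1/2`, where `γ⁰ = f(-i∇)`. -/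
def projMinus (Λ : ℝ) (f : E3 → Mat4) : Space Λ →L[ℂ] Space Λ :=
  multiplier Λ f + (1 / 2 : ℂ) • 1

/-- The projector `𝒫⁰₊ = 1 - 𝒫⁰₋`. -/
def projPlus (Λ : ℝ) (f : E3 → Mat4) : Space Λ →L[ℂ] Space Λ :=
  1 - projMinus Λ f

/-- The mean-field operator `𝒟⁰`. -/
def meanField (α m₀ Λ : ℝ) (f : E3 → Mat4) : Space Λ →L[ℂ] Space Λ :=
  multiplier Λ (meanFieldSymbol α m₀ Λ f)

/-! ## Hilbert-Schmidt and trace-class operators -/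

section Operators

variable {H : Type*} [NormedAddCommGroup H] [InnerProductSpace ℂ H] [CompleteSpace H]

/-- Hilbert-Schmidt operators: `∑ ‖T eᵢ‖² < ∞` for every Hilbert basis `(eᵢ)`. -/
def IsHilbertSchmidt (T : H →L[ℂ] H) : Prop :=
  ∀ (w : Set H) (b : HilbertBasis w ℂ H), Summable fun i => ‖T (b i)‖ ^ 2

/-- Trace-class operators: `∑ ⟨eᵢ, |T| eᵢ⟩ < ∞` for every Hilbert basis `(eᵢ)`, where
`|T| = (T* T)^{1/2}`. -/
def IsTraceClass (T : H →L[ℂ] H) : Prop :=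
  ∀ (w : Set H) (b : HilbertBasis w ℂ H), Summable fun i => (inner ℂ (b i) (CFC.abs T (b i))).re

/-- The trace `∑ ⟨eᵢ, T eᵢ⟩` in some Hilbert basis; for a trace-class operator it does not depend on
the basis. -/
def opTrace (T : H →L[ℂ] H) : ℂ :=
  ∑' i, inner ℂ ((exists_hilbertBasis ℂ H).choose_spec.choose i)
    (T ((exists_hilbertBasis ℂ H).choose_spec.choose i))

end Operators

/-- The generalized trace class `𝔖₁^{𝒫⁰₋}`: Hilbert-Schmidt operators `Q` such that
`Q⁺⁺ = 𝒫⁰₊ Q 𝒫⁰₊` and `Q⁻⁻ = 𝒫⁰₋ Q 𝒫⁰₋` are trace-class. -/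
def IsVacuumTraceClass (Λ : ℝ) (f : E3 → Mat4) (Q : Space Λ →L[ℂ] Space Λ) : Prop :=
  IsHilbertSchmidt Q ∧
    IsTraceClass (projPlus Λ f * Q * projPlus Λ f) ∧
    IsTraceClass (projMinus Λ f * Q * projMinus Λ f)

/-- The generalized trace `tr_{𝒫⁰₋}(Q) = tr(Q⁺⁺ + Q⁻⁻)`. -/
def vacuumTrace (Λ : ℝ) (f : E3 → Mat4) (Q : Space Λ →L[ℂ] Space Λ) : ℂ :=
  opTrace (projPlus Λ f * Q * projPlus Λ f + projMinus Λ f * Q * projMinus Λ f)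

/-! ## Integral kernels and densities -/

/-- `K` is a square-integrable momentum-space kernel of `Q`:
`(Q ψ)(p) = ∫_{B(0,Λ)} K(p,q) ψ(q) dq`. -/
def IsKernel {Λ : ℝ} (Q : Space Λ →L[ℂ] Space Λ) (K : E3 → E3 → Mat4) : Prop :=
  (∀ i j, MemLp (fun z : E3 × E3 => K z.1 z.2 i j) 2 ((ballMeasure Λ).prod (ballMeasure Λ))) ∧
    ∀ ψ : Space Λ, (Q ψ : E3 → Spinor) =ᵐ[ballMeasure Λ]
      fun p => ∫ q, Matrix.toEuclideanLin (K p q) (ψ q) ∂(ballMeasure Λ)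

open Classical in
/-- The momentum-space kernel `Q̂(p,q)` of a Hilbert-Schmidt operator `Q`, extended by zero outside
`B(0,Λ) × B(0,Λ)`. It exists and is unique up to null sets for every Hilbert-Schmidt operator. -/
def momentumKernel {Λ : ℝ} (Q : Space Λ →L[ℂ] Space Λ) (p q : E3) : Mat4 :=
  if h : (∃ K, IsKernel Q K) ∧ p ∈ Metric.ball (0 : E3) Λ ∧ q ∈ Metric.ball (0 : E3) Λ then
    h.1.choose p q
  else 0

/-- The position-space kernel `Q(x,y) = (2π)⁻³ ∬ Q̂(p,q) e^{i(p·x - q·y)} dp dq`. -/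
def positionKernel {Λ : ℝ} (Q : Space Λ →L[ℂ] Space Λ) (x y : E3) : Mat4 :=
  Matrix.of fun i j => 1 / ((2 * Real.pi : ℝ) : ℂ) ^ 3 *
    ∫ z : E3 × E3, momentumKernel Q z.1 z.2 i j *
      Complex.exp (I * ((inner ℝ z.1 x - inner ℝ z.2 y : ℝ) : ℂ))
        ∂((ballMeasure Λ).prod (ballMeasure Λ))

/-- The Fourier transform of the charge density `ρ_Q(x) = tr Q(x,x)`:
`(2π)^{-3/2} ∫_{B(0,Λ)} tr Q̂(p + k/2, p - k/2) dp`. -/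
def densityFourier {Λ : ℝ} (Q : Space Λ →L[ℂ] Space Λ) (k : E3) : ℂ :=
  (((2 * Real.pi) ^ (-(3 / 2) : ℝ) : ℝ) : ℂ) *
    ∫ p, (momentumKernel Q (p + (1 / 2 : ℝ) • k) (p - (1 / 2 : ℝ) • k)).trace ∂(ballMeasure Λ)

/-- The density `|Q(x,y)|² / |x - y|` of the exchange term, where `|·|` is the Hilbert-Schmidt norm
on `4 × 4` matrices. -/
def exchangeDensity {Λ : ℝ} (Q : Space Λ →L[ℂ] Space Λ) (z : E3 × E3) : ℝ :=
  (∑ i, ∑ j, ‖positionKernel Q z.1 z.2 i j‖ ^ 2) / ‖z.1 - z.2‖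

/-! ## The Coulomb space -/

/-- The condition `∫ |g(k)|² / |k|² dk < ∞` on a Fourier transform `g`. -/
def FiniteCoulomb (g : E3 → ℂ) : Prop :=
  AEStronglyMeasurable g volume ∧ Integrable fun k : E3 => ‖g k‖ ^ 2 / ‖k‖ ^ 2

/-- The Coulomb form `D(f,g) = 4π ∫ conj(f̂(k)) ĝ(k) / |k|² dk`, in terms of Fourier transforms. -/
def coulombForm (fhat ghat : E3 → ℂ) : ℂ :=
  4 * Real.pi * ∫ k : E3, conj (fhat k) * ghat k / ((‖k‖ ^ 2 : ℝ) : ℂ)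

/-- The tempered distribution `n` has the function `g` as its Fourier transform, with the convention
`n̂(k) = (2π)^{-3/2} ∫ n(x) e^{-ik·x} dx`; Mathlib's Fourier transform of `n` is then
`ξ ↦ (2π)^{3/2} g(2πξ)`. -/
def HasFourier (n : 𝓢'(E3, ℂ)) (g : E3 → ℂ) : Prop :=
  ∀ φ : 𝓢(E3, ℂ), (𝓕 n : 𝓢'(E3, ℂ)) φ =
    ∫ ξ : E3, (((2 * Real.pi) ^ (3 / 2 : ℝ) : ℝ) : ℂ) * g ((2 * Real.pi) • ξ) * φ ξ

/-- The Coulomb space `𝒞`: tempered distributions whose Fourier transform is a function `n̂` with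
`∫ |n̂(k)|² / |k|² dk < ∞`. -/
def coulombSpace : Set 𝓢'(E3, ℂ) :=
  {n | ∃ g : E3 → ℂ, FiniteCoulomb g ∧ HasFourier n g}

open Classical in
/-- The Fourier transform `n̂` of an element `n` of the Coulomb space; it is unique up to null
sets. -/
def chargeFourier (n : 𝓢'(E3, ℂ)) : E3 → ℂ :=
  if h : ∃ g : E3 → ℂ, FiniteCoulomb g ∧ HasFourier n g then h.choose else 0

/-! ## The Bogoliubov-Dirac-Fock energy -/

/-- The set `𝒬_Λ`: operators `Q` in `𝔖₁^{𝒫⁰₋}` with `-𝒫⁰₋ ≤ Q ≤ 𝒫⁰₊` (as quadratic forms) and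
`ρ_Q ∈ 𝒞`. -/
def bdfStates (Λ : ℝ) (f : E3 → Mat4) : Set (Space Λ →L[ℂ] Space Λ) :=
  {Q | IsVacuumTraceClass Λ f Q ∧ -projMinus Λ f ≤ Q ∧ Q ≤ projPlus Λ f ∧
    FiniteCoulomb (densityFourier Q)}

/-- The BDF energy, with external charge density `n`,
`tr_{𝒫⁰₋}(𝒟⁰Q) + α/2 D(ρ_Q,ρ_Q) - α D(ρ_Q,n) - α/2 ∬ |Q(x,y)|² / |x-y| dx dy`.
On `𝒬_Λ` the trace and `D(ρ_Q,ρ_Q)` are real, and so is `D(ρ_Q,n)` if `n` is real-valued; for a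
complex `n` the real part is taken. -/
def bdfEnergy (α m₀ Λ : ℝ) (f : E3 → Mat4) (n : 𝓢'(E3, ℂ)) (Q : Space Λ →L[ℂ] Space Λ) : ℝ :=
  (vacuumTrace Λ f (meanField α m₀ Λ f * Q)).re
    + α / 2 * (coulombForm (densityFourier Q) (densityFourier Q)).re
    - α * (coulombForm (densityFourier Q) (chargeFourier n)).re
    - α / 2 * ∫ z : E3 × E3, exchangeDensity Q z

end BDF

end

/-!
Both halves of the theorem rest on Kato's inequality `1 / |x| ≤ (π / 2) |∇|` with its sharp
constant.

**The free vacuum.** Fields with values in the span of the Dirac matrices are encoded as Clifford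
vector fields. If `v = G / |G|` with `G(p) = (p, m₀) + α / (4π²) ∫ v(q) / |p - q|² dq`, then the
state with symbol `-v / 2` has `G` as its mean-field operator and is the projector, minus `1 / 2`,
on the negative spectral subspace of the latter. Such a `v` is found by iteration
(`exists_signField_eq`). The iterates are rotation-equivariant and point outwards, whence
`|G(p)|² ≥ |p|² + m₀²`; the iteration is a contraction in `L²(|p| dp)`, by `α π / 4 ≤ 1` and Schur's
test for the kernel `1 / |p - q|²` (`lintegral_convolution_sq_le`). With `h = f + v / 2`, the
inequality `∬ h(p) h(q) / |p - q|² ≤ π³ ∫ |p| h²` (`lintegral_lintegral_mul_le`) then bounds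
`𝒯(f) - 𝒯(-v / 2)` below by a multiple of `∫ (|G(p)| - |p|) |h(p)|² dp`. As `|G(p)| > |p|`, the
state `-v / 2` is a minimizer (`IsSelfConsistent.isFreeVacuum`), and every minimizer agrees with it
almost everywhere (`IsSelfConsistent.ae_eq_of_isFreeVacuum`).

**The energy.** The constraint `-P₋ ≤ Q ≤ P₊` gives `Q² ≤ Q⁺⁺ - Q⁻⁻`, and `𝒟⁰` has the sign of
`P₊ - P₋`, so `tr(𝒟⁰ Q) = tr(|𝒟⁰| (Q⁺⁺ - Q⁻⁻)) ≥ ‖Q |𝒟⁰|^{1/2}‖²`, in Hilbert-Schmidt norm. By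
Parseval's identity the last quantity is `∬ |G(q)| |Q̂(p, q)|² dp dq`
(`IsSelfConsistent.lintegral_le_vacuumTrace`). Kato's inequality bounds the exchange integral by
`(π / 2) ∬ |q| |Q̂(p, q)|² dp dq` (`lintegral_exchangeDensity_le`). Since `α π / 4 ≤ 1` and
`|q| < |G(q)|`, the kinetic energy dominates the exchange term, strictly unless `Q = 0`
(`IsSelfConsistent.exchange_le_vacuumTrace`). The remaining Coulomb terms, together with
`α / 2 D(n, n)`, form the square `α / 2 D(ρ_Q - n, ρ_Q - n)` (`coulombForm_sub_nonneg`).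
-/

noncomputable section

namespace BDF

open Set Filter Topology TopologicalSpace

/-! ### Kato's inequality in momentum space -/

lemma lintegral_ofReal_eq_of_integral_eq {X : Type*} [MeasurableSpace X] {μ : Measure X}
    {f : X → ℝ} {c : ℝ} (hf : 0 ≤ᵐ[μ] f) (hc : c ≠ 0) (h : ∫ x, f x ∂μ = c) :
    ∫⁻ x, ENNReal.ofReal (f x) ∂μ = ENNReal.ofReal c := by
  have hi : Integrable f μ := by
    by_contra hn
    exact hc (by rw [← h, integral_undef hn])
  rw [← ofReal_integral_eq_lintegral_ofReal hi hf, h]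

lemma lintegral_gaussian (b : ℝ) (hb : 0 < b) (c : E3) :
    ∫⁻ q : E3, ENNReal.ofReal (Real.exp (-b * ‖q - c‖ ^ 2)) =
      ENNReal.ofReal ((Real.pi / b) ^ (3 / 2 : ℝ)) := by
  rw [lintegral_sub_right_eq_self (fun q : E3 => ENNReal.ofReal (Real.exp (-b * ‖q‖ ^ 2))) c]
  refine lintegral_ofReal_eq_of_integral_eq (ae_of_all _ fun _ => (Real.exp_pos _).le) ?_ ?_
  · positivity
  · rw [GaussianFourier.integral_rexp_neg_mul_sq_norm hb]
    simp

lemma lintegral_exp_neg_mul {a : ℝ} (ha : 0 < a) :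
    ∫⁻ t in Ioi (0 : ℝ), ENNReal.ofReal (Real.exp (-(a * t))) = ENNReal.ofReal (1 / a) := by
  refine lintegral_ofReal_eq_of_integral_eq (ae_of_all _ fun _ => (Real.exp_pos _).le)
    (by positivity) ?_
  have := Real.integral_rpow_mul_exp_neg_mul_Ioi (a := 1) one_pos ha
  simpa using this

lemma lintegral_rpow_neg_half_mul_exp {a : ℝ} (ha : 0 < a) :
    ∫⁻ t in Ioi (0 : ℝ), ENNReal.ofReal (t ^ (-(1 / 2) : ℝ) * Real.exp (-(a * t))) =
      ENNReal.ofReal (√Real.pi / √a) := by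
  refine lintegral_ofReal_eq_of_integral_eq ?_ (by positivity) ?_
  · filter_upwards [ae_restrict_mem measurableSet_Ioi] with t ht
    have : (0 : ℝ) < t := ht
    simp only [Pi.zero_apply]; positivity
  have := Real.integral_rpow_mul_exp_neg_mul_Ioi (a := 1 / 2) (by norm_num) ha
  rw [show (1 / 2 - 1 : ℝ) = -(1 / 2) by norm_num] at this
  rw [this, Real.Gamma_one_half_eq, ← Real.sqrt_eq_rpow, Real.sqrt_div zero_le_one, Real.sqrt_one]
  ring

lemma lintegral_inv_sqrt_mul_one_add :
    ∫⁻ y in Ioi (0 : ℝ), ENNReal.ofReal (1 / ((1 + y) * √y)) = ENNReal.ofReal Real.pi := by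
  refine lintegral_ofReal_eq_of_integral_eq ?_ Real.pi_pos.ne' ?_
  · filter_upwards [ae_restrict_mem measurableSet_Ioi] with t ht
    have : (0 : ℝ) < t := ht
    simp only [Pi.zero_apply]; positivity
  have := integral_Ioi_of_hasDerivAt_of_nonneg (g := fun y => 2 * Real.arctan (√y))
    (g' := fun y => 1 / ((1 + y) * √y)) (a := 0) (l := 2 * (Real.pi / 2)) ?_ ?_ ?_ ?_
  · rw [this]; simp; ring
  · exact (continuous_const.mul (Real.continuous_arctan.comp
      Real.continuous_sqrt)).continuousWithinAt
  · intro x hx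
    have hx : (0 : ℝ) < x := hx
    have := ((Real.hasDerivAt_sqrt hx.ne').arctan).const_mul 2
    refine this.congr_deriv ?_
    rw [Real.sq_sqrt hx.le]
    have : √x ≠ 0 := by positivity
    field_simp
  · intro x hx
    have hx : (0 : ℝ) < x := hx
    positivity
  · exact ((Real.tendsto_arctan_atTop.mono_right nhdsWithin_le_nhds).comp
      Real.tendsto_sqrt_atTop).const_mul 2

lemma norm_sq_add_mul_norm_sub_sq (p q : E3) {y : ℝ} (hy : 0 < y) :
    ‖q‖ ^ 2 + y * ‖p - q‖ ^ 2 =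
      (1 + y) * ‖q - (y / (1 + y)) • p‖ ^ 2 + y / (1 + y) * ‖p‖ ^ 2 := by
  rw [norm_sub_sq_real, norm_sub_sq_real, inner_smul_right, norm_smul, real_inner_comm q p,
    mul_pow, Real.norm_eq_abs, sq_abs]
  field_simp
  ring

/-- `∫ dq / (|q|² |p - q|²) = π³ / |p|`, of which only the upper bound is needed. Since `1 / |q|²`
is a superposition of Gaussians, so is the integrand, and the `q`-integral of a product of two
Gaussians is explicit. -/
lemma lintegral_newton (p : E3) (hp : p ≠ 0) :
    ∫⁻ q : E3, ENNReal.ofReal (1 / (‖q‖ ^ 2 * ‖p - q‖ ^ 2)) ≤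
      ENNReal.ofReal (Real.pi ^ 3 / ‖p‖) := by
  have hp' : 0 < ‖p‖ := norm_pos_iff.mpr hp
  -- with the exponents `t` and `t y` of the two Gaussians, the `t`-integral can be evaluated before
  -- the `y`-integral
  have key : ∀ q : E3, ENNReal.ofReal (1 / (‖q‖ ^ 2 * ‖p - q‖ ^ 2)) ≤
      ∫⁻ t in Ioi (0 : ℝ), ∫⁻ y in Ioi (0 : ℝ),
        ENNReal.ofReal (t * Real.exp (-t * (‖q‖ ^ 2 + y * ‖p - q‖ ^ 2))) := by
    intro q
    rcases eq_or_ne q 0 with rfl | hq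
    · simp
    rcases eq_or_ne (p - q) 0 with hq' | hq'
    · simp [hq']
    have h1 : 0 < ‖q‖ ^ 2 := by positivity
    have h2 : 0 < ‖p - q‖ ^ 2 := by positivity
    have : ∀ t ∈ Ioi (0 : ℝ), ∫⁻ y in Ioi (0 : ℝ),
        ENNReal.ofReal (t * Real.exp (-t * (‖q‖ ^ 2 + y * ‖p - q‖ ^ 2))) =
        ENNReal.ofReal (Real.exp (-(‖q‖ ^ 2 * t))) * ENNReal.ofReal (1 / ‖p - q‖ ^ 2) := by
      intro t ht
      have ht : 0 < t := ht
      have : ∀ y, ENNReal.ofReal (t * Real.exp (-t * (‖q‖ ^ 2 + y * ‖p - q‖ ^ 2))) =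
          ENNReal.ofReal (t * Real.exp (-(‖q‖ ^ 2 * t))) *
            ENNReal.ofReal (Real.exp (-((t * ‖p - q‖ ^ 2) * y))) := by
        intro y
        rw [← ENNReal.ofReal_mul (by positivity), mul_assoc, ← Real.exp_add]
        ring_nf
      simp_rw [this]
      rw [lintegral_const_mul _ (by fun_prop), lintegral_exp_neg_mul (by positivity),
        ← ENNReal.ofReal_mul (by positivity), ← ENNReal.ofReal_mul (by positivity)]
      congr 1
      field_simp
    rw [setLIntegral_congr_fun measurableSet_Ioi this, lintegral_mul_const _ (by fun_prop),
      lintegral_exp_neg_mul h1, ← ENNReal.ofReal_mul (by positivity)]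
    apply le_of_eq
    congr 1
    field_simp
  calc _ ≤ ∫⁻ q : E3, ∫⁻ t in Ioi (0 : ℝ), ∫⁻ y in Ioi (0 : ℝ),
        ENNReal.ofReal (t * Real.exp (-t * (‖q‖ ^ 2 + y * ‖p - q‖ ^ 2))) := lintegral_mono key
    _ = ∫⁻ y in Ioi (0 : ℝ), ∫⁻ t in Ioi (0 : ℝ), ∫⁻ q : E3,
        ENNReal.ofReal (t * Real.exp (-t * (‖q‖ ^ 2 + y * ‖p - q‖ ^ 2))) := by
      rw [lintegral_lintegral_swap (by fun_prop)]
      conv_lhs => enter [2, t]; rw [lintegral_lintegral_swap (by fun_prop)]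
      rw [lintegral_lintegral_swap (by fun_prop)]
    _ = ∫⁻ y in Ioi (0 : ℝ), ENNReal.ofReal (Real.pi ^ 2 / ‖p‖) *
          ENNReal.ofReal (1 / ((1 + y) * √y)) := by
      refine setLIntegral_congr_fun measurableSet_Ioi fun y hy => ?_
      have hy : 0 < y := hy
      have : ∀ t ∈ Ioi (0 : ℝ), ∫⁻ q : E3,
          ENNReal.ofReal (t * Real.exp (-t * (‖q‖ ^ 2 + y * ‖p - q‖ ^ 2))) =
          ENNReal.ofReal (Real.pi ^ (3 / 2 : ℝ) * (1 + y) ^ (-(3 / 2) : ℝ)) *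
          ENNReal.ofReal (t ^ (-(1 / 2) : ℝ) * Real.exp (-((y / (1 + y) * ‖p‖ ^ 2) * t))) := by
        intro t ht
        have ht : 0 < t := ht
        have : ∀ q, ENNReal.ofReal (t * Real.exp (-t * (‖q‖ ^ 2 + y * ‖p - q‖ ^ 2))) =
            ENNReal.ofReal (t * Real.exp (-((y / (1 + y) * ‖p‖ ^ 2) * t))) *
            ENNReal.ofReal (Real.exp (-(t * (1 + y)) * ‖q - (y / (1 + y)) • p‖ ^ 2)) := by
          intro q
          rw [norm_sq_add_mul_norm_sub_sq p q hy, ← ENNReal.ofReal_mul (by positivity), mul_assoc,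
            ← Real.exp_add]
          ring_nf
        simp_rw [this]
        rw [lintegral_const_mul _ (by fun_prop), lintegral_gaussian _ (by positivity),
          ← ENNReal.ofReal_mul (by positivity), ← ENNReal.ofReal_mul (by positivity)]
        congr 1
        rw [Real.div_rpow Real.pi_pos.le (by positivity), Real.mul_rpow ht.le (by positivity),
          Real.rpow_neg (by positivity), Real.rpow_neg ht.le,
          show (3 / 2 : ℝ) = 1 + 1 / 2 by norm_num, Real.rpow_add ht, Real.rpow_one]
        have : t ^ (1 / 2 : ℝ) ≠ 0 := by positivity
        have : (1 + y) ^ (1 + 1 / 2 : ℝ) ≠ 0 := by positivity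
        field_simp
      rw [setLIntegral_congr_fun measurableSet_Ioi this, lintegral_const_mul _ (by fun_prop),
        lintegral_rpow_neg_half_mul_exp (by positivity), ← ENNReal.ofReal_mul (by positivity),
        ← ENNReal.ofReal_mul (by positivity)]
      congr 1
      rw [Real.sqrt_mul (by positivity), Real.sqrt_sq hp'.le, Real.sqrt_div hy.le,
        Real.rpow_neg (by positivity), show (3 / 2 : ℝ) = 1 + 1 / 2 by norm_num,
        Real.rpow_add Real.pi_pos, Real.rpow_add (by positivity), Real.rpow_one, Real.rpow_one,
        ← Real.sqrt_eq_rpow, ← Real.sqrt_eq_rpow]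
      have h1 := Real.mul_self_sqrt Real.pi_pos.le
      have : √(1 + y) ≠ 0 := by positivity
      have : √y ≠ 0 := by positivity
      field_simp
      rw [sq, h1]
    _ = _ := by
      rw [lintegral_const_mul _ (by fun_prop), lintegral_inv_sqrt_mul_one_add,
        ← ENNReal.ofReal_mul (by positivity)]
      congr 1
      ring

/-- The Cauchy-Schwarz inequality. -/
lemma lintegral_mul_sq_le {X : Type*} [MeasurableSpace X] (μ : Measure X) {f g : X → ENNReal}
    (hf : AEMeasurable f μ) (hg : AEMeasurable g μ) :
    (∫⁻ x, f x * g x ∂μ) ^ 2 ≤ (∫⁻ x, f x ^ 2 ∂μ) * ∫⁻ x, g x ^ 2 ∂μ := by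
  have h := ENNReal.lintegral_mul_le_Lp_mul_Lq μ Real.HolderConjugate.two_two hf hg
  calc _ ≤ ((∫⁻ x, f x ^ (2 : ℝ) ∂μ) ^ (1 / 2 : ℝ) *
        (∫⁻ x, g x ^ (2 : ℝ) ∂μ) ^ (1 / 2 : ℝ)) ^ 2 := by
        gcongr
        exact h
    _ = _ := by
      rw [mul_pow, ← ENNReal.rpow_natCast, ← ENNReal.rpow_natCast, ← ENNReal.rpow_mul,
        ← ENNReal.rpow_mul]
      simp

lemma ae_ne_zero {μ : Measure E3} (hμ : μ ≤ volume) : ∀ᵐ p ∂μ, p ≠ 0 := by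
  have : ∀ᵐ p : E3, p ≠ 0 := Measure.ae_ne volume 0
  exact (Measure.absolutelyContinuous_of_le hμ).ae_le this

/-- Schur's test with the weight `1 / |q|²`. With the factor `1 / |p|`, it says that
the operator `|p|^{-1/2} (1 / |·|² * ) |p|^{-1/2}` is bounded by `π³`. -/
lemma lintegral_convolution_sq_le {μ : Measure E3} [SFinite μ] (hμ : μ ≤ volume) {h : E3 → ENNReal}
    (hh : AEMeasurable h μ) :
    ∫⁻ p, (∫⁻ q, h q * ENNReal.ofReal (1 / ‖p - q‖ ^ 2) ∂μ) ^ 2 * ENNReal.ofReal (1 / ‖p‖) ∂μ ≤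
      ENNReal.ofReal (Real.pi ^ 6) * ∫⁻ q, ENNReal.ofReal ‖q‖ * h q ^ 2 ∂μ := by
  have step : ∀ᵐ p ∂μ,
      (∫⁻ q, h q * ENNReal.ofReal (1 / ‖p - q‖ ^ 2) ∂μ) ^ 2 * ENNReal.ofReal (1 / ‖p‖) ≤
      ∫⁻ q, ENNReal.ofReal (Real.pi ^ 3) *
        (h q ^ 2 * ENNReal.ofReal (‖q‖ ^ 2 * (1 / (‖p‖ ^ 2 * ‖q - p‖ ^ 2)))) ∂μ := by
    filter_upwards [ae_ne_zero hμ] with p hp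
    have hp' : 0 < ‖p‖ := norm_pos_iff.mpr hp
    have e1 : ∫⁻ q, h q * ENNReal.ofReal (1 / ‖p - q‖ ^ 2) ∂μ =
        ∫⁻ q, (h q * ENNReal.ofReal (‖q‖ / ‖p - q‖)) *
          ENNReal.ofReal (1 / (‖q‖ * ‖p - q‖)) ∂μ := by
      refine lintegral_congr_ae ?_
      filter_upwards [ae_ne_zero hμ] with q hq
      have hq' : 0 < ‖q‖ := norm_pos_iff.mpr hq
      rw [mul_assoc, ← ENNReal.ofReal_mul (by positivity)]
      congr 2
      rcases eq_or_ne ‖p - q‖ 0 with h0 | h0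
      · simp [h0]
      · field_simp
    have e2 : ∫⁻ q, ENNReal.ofReal (1 / (‖q‖ * ‖p - q‖)) ^ 2 ∂μ ≤
        ENNReal.ofReal (Real.pi ^ 3 / ‖p‖) := by
      refine (lintegral_mono' hμ le_rfl).trans ?_
      refine le_trans (le_of_eq ?_) (lintegral_newton p hp)
      refine lintegral_congr fun q => ?_
      rw [← ENNReal.ofReal_pow (by positivity)]
      congr 1
      rw [div_pow, mul_pow, one_pow]
    rw [e1]
    calc _ ≤ ((∫⁻ q, (h q * ENNReal.ofReal (‖q‖ / ‖p - q‖)) ^ 2 ∂μ) *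
          ENNReal.ofReal (Real.pi ^ 3 / ‖p‖)) * ENNReal.ofReal (1 / ‖p‖) := by
          gcongr
          refine (lintegral_mul_sq_le μ (by fun_prop) (by fun_prop)).trans ?_
          gcongr
      _ = ∫⁻ q, (h q * ENNReal.ofReal (‖q‖ / ‖p - q‖)) ^ 2 *
            (ENNReal.ofReal (Real.pi ^ 3 / ‖p‖) * ENNReal.ofReal (1 / ‖p‖)) ∂μ := by
          rw [lintegral_mul_const'' _ (by fun_prop), mul_assoc]
      _ ≤ _ := by
          refine lintegral_mono fun q => le_of_eq ?_
          rw [mul_pow, ← ENNReal.ofReal_pow (by positivity), mul_left_comm (ENNReal.ofReal (_ ^ 3)),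
            mul_assoc, ← ENNReal.ofReal_mul (by positivity), ← ENNReal.ofReal_mul (by positivity),
            ← ENNReal.ofReal_mul (by positivity)]
          congr 2
          rw [norm_sub_rev q p]
          rcases eq_or_ne ‖p - q‖ 0 with h0 | h0
          · simp [h0]
          · field_simp
  calc _ ≤ ∫⁻ p, ∫⁻ q, ENNReal.ofReal (Real.pi ^ 3) *
        (h q ^ 2 * ENNReal.ofReal (‖q‖ ^ 2 * (1 / (‖p‖ ^ 2 * ‖q - p‖ ^ 2)))) ∂μ ∂μ :=
        lintegral_mono_ae step
    _ = ∫⁻ q, ∫⁻ p, ENNReal.ofReal (Real.pi ^ 3) *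
        (h q ^ 2 * ENNReal.ofReal (‖q‖ ^ 2 * (1 / (‖p‖ ^ 2 * ‖q - p‖ ^ 2)))) ∂μ ∂μ := by
        refine lintegral_lintegral_swap ?_
        have : AEMeasurable (fun z : E3 × E3 => h z.2) (μ.prod μ) := hh.comp_snd
        fun_prop
    _ ≤ ∫⁻ q, ENNReal.ofReal (Real.pi ^ 6) * (ENNReal.ofReal ‖q‖ * h q ^ 2) ∂μ := by
        refine lintegral_mono_ae ?_
        filter_upwards [ae_ne_zero hμ] with q hq
        have hq' : 0 < ‖q‖ := norm_pos_iff.mpr hq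
        rw [lintegral_const_mul _ (by fun_prop), lintegral_const_mul _ (by fun_prop)]
        simp_rw [ENNReal.ofReal_mul (sq_nonneg ‖q‖)]
        rw [lintegral_const_mul _ (by fun_prop)]
        calc _ ≤ ENNReal.ofReal (Real.pi ^ 3) * (h q ^ 2 * (ENNReal.ofReal (‖q‖ ^ 2) *
              ENNReal.ofReal (Real.pi ^ 3 / ‖q‖))) := by
              gcongr
              exact (lintegral_mono' hμ le_rfl).trans (lintegral_newton q hq)
          _ = _ := by
              rw [← ENNReal.ofReal_mul (by positivity), mul_comm (h q ^ 2), ← mul_assoc,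
                ← mul_assoc, ← ENNReal.ofReal_mul (by positivity),
                ← ENNReal.ofReal_mul (by positivity)]
              congr 2
              field_simp
    _ = _ := by rw [lintegral_const_mul'' _ (by fun_prop)]

/-- The quadratic form inequality `∬ h(p) h(q) / |p - q|² ≤ π³ ∫ |p| h(p)²`: Kato's inequality
`1 / |x| ≤ (π / 2) |∇|` in momentum space. -/
lemma lintegral_lintegral_mul_le {μ : Measure E3} [SFinite μ] (hμ : μ ≤ volume) {h : E3 → ENNReal}
    (hh : AEMeasurable h μ) :
    ∫⁻ p, ∫⁻ q, h p * h q * ENNReal.ofReal (1 / ‖p - q‖ ^ 2) ∂μ ∂μ ≤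
      ENNReal.ofReal (Real.pi ^ 3) * ∫⁻ q, ENNReal.ofReal ‖q‖ * h q ^ 2 ∂μ := by
  set k : E3 → ENNReal := fun p => ∫⁻ q, h q * ENNReal.ofReal (1 / ‖p - q‖ ^ 2) ∂μ with hk
  have hkm : AEMeasurable k μ := by
    have : AEMeasurable (fun z : E3 × E3 => h z.2 * ENNReal.ofReal (1 / ‖z.1 - z.2‖ ^ 2))
        (μ.prod μ) := hh.comp_snd.mul (by fun_prop)
    exact this.lintegral_prod_right'
  set c := ∫⁻ q, ENNReal.ofReal ‖q‖ * h q ^ 2 ∂μ with hc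
  have e0 : ∫⁻ p, ∫⁻ q, h p * h q * ENNReal.ofReal (1 / ‖p - q‖ ^ 2) ∂μ ∂μ =
      ∫⁻ p, (ENNReal.ofReal (√‖p‖) * h p) * (k p * ENNReal.ofReal (1 / √‖p‖)) ∂μ := by
    refine lintegral_congr_ae ?_
    filter_upwards [ae_ne_zero hμ] with p hp
    have hp' : 0 < ‖p‖ := norm_pos_iff.mpr hp
    simp_rw [mul_assoc]
    rw [lintegral_const_mul'' _ (by fun_prop)]
    change h p * k p = _
    have h1 : ENNReal.ofReal (√‖p‖) * ENNReal.ofReal (1 / √‖p‖) = 1 := by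
      have : √‖p‖ ≠ 0 := by positivity
      rw [← ENNReal.ofReal_mul (by positivity), mul_one_div_cancel this, ENNReal.ofReal_one]
    calc h p * k p = h p * k p * (ENNReal.ofReal (√‖p‖) * ENNReal.ofReal (1 / √‖p‖)) := by
          rw [h1, mul_one]
      _ = _ := by ring
  have e1 : ∫⁻ p, (k p * ENNReal.ofReal (1 / √‖p‖)) ^ 2 ∂μ ≤ ENNReal.ofReal (Real.pi ^ 6) * c := by
    refine le_trans (le_of_eq ?_) (lintegral_convolution_sq_le hμ hh)
    refine lintegral_congr fun p => ?_
    rw [mul_pow, ← ENNReal.ofReal_pow (by positivity), div_pow, Real.sq_sqrt (norm_nonneg _),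
      one_pow]
  have e2 : ∫⁻ p, (ENNReal.ofReal (√‖p‖) * h p) ^ 2 ∂μ = c := by
    refine lintegral_congr fun p => ?_
    rw [mul_pow, ← ENNReal.ofReal_pow (by positivity), Real.sq_sqrt (norm_nonneg _)]
  rw [e0, ← ENNReal.pow_le_pow_left_iff two_ne_zero]
  calc _ ≤ _ := lintegral_mul_sq_le μ (by fun_prop) (by fun_prop)
    _ ≤ c * (ENNReal.ofReal (Real.pi ^ 6) * c) := by rw [e2]; gcongr
    _ = _ := by
      rw [mul_pow, ← ENNReal.ofReal_pow (by positivity)]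
      ring_nf

/-! ### The mean-field symbol as a Clifford vector field -/

/-- The real span of the four Dirac matrices: `(a, b)` stands for `a · α + b β`. -/
abbrev CliffordVector : Type := WithLp 2 (E3 × ℝ)

lemma ballMeasure_le (Λ : ℝ) : ballMeasure Λ ≤ volume := Measure.restrict_le_self

instance (Λ : ℝ) : IsFiniteMeasure (ballMeasure Λ) := by
  exact ⟨by simpa [ballMeasure] using measure_ball_lt_top (μ := volume) (x := (0 : E3)) (r := Λ)⟩

lemma ae_ballMeasure_mem (Λ : ℝ) : ∀ᵐ q ∂ballMeasure Λ, ‖q‖ < Λ := by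
  filter_upwards [ae_restrict_mem Metric.isOpen_ball.measurableSet] with q hq
  simpa using hq

lemma ae_ballMeasure_ne (Λ : ℝ) (p : E3) : ∀ᵐ q ∂ballMeasure Λ, q ≠ p := by
  have : ∀ᵐ q : E3, q ≠ p := Measure.ae_ne volume p
  exact (Measure.absolutelyContinuous_of_le (ballMeasure_le Λ)).ae_le this

lemma lintegral_kernel_le {Λ : ℝ} (hΛ : 0 < Λ) (p : E3) :
    ∫⁻ q, ENNReal.ofReal (1 / ‖p - q‖ ^ 2) ∂ballMeasure Λ ≤
      ENNReal.ofReal ((Λ + ‖p‖ + 1) ^ 2) * ENNReal.ofReal (Real.pi ^ 3) := by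
  obtain ⟨e, he⟩ : ∃ e : E3, ‖e‖ = 1 := ⟨EuclideanSpace.single 0 1, by simp⟩
  have he0 : e ≠ 0 := by
    rintro rfl
    simp at he
  have h1 := lintegral_newton e he0
  rw [he, div_one, ← lintegral_sub_left_eq_self _ p] at h1
  calc _ ≤ ∫⁻ q, ENNReal.ofReal ((Λ + ‖p‖ + 1) ^ 2) *
        ENNReal.ofReal (1 / (‖p - q‖ ^ 2 * ‖e - (p - q)‖ ^ 2)) ∂ballMeasure Λ := by
        refine lintegral_mono_ae ?_
        filter_upwards [ae_ballMeasure_mem Λ, ae_ballMeasure_ne Λ (p - e)] with q hq hq'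
        rw [← ENNReal.ofReal_mul (by positivity)]
        refine ENNReal.ofReal_le_ofReal ?_
        have h3 : 0 < ‖e - (p - q)‖ := by
          rw [norm_pos_iff]
          intro h
          apply hq'
          rw [sub_eq_zero] at h
          rw [h]; abel
        have h2 : ‖e - (p - q)‖ ≤ Λ + ‖p‖ + 1 := by
          have := norm_sub_le e (p - q)
          have := norm_sub_le p q
          linarith
        have h4 : ‖e - (p - q)‖ ^ 2 ≤ (Λ + ‖p‖ + 1) ^ 2 := by gcongr
        have : (Λ + ‖p‖ + 1) ^ 2 * (1 / (‖p - q‖ ^ 2 * ‖e - (p - q)‖ ^ 2)) =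
          1 / ‖p - q‖ ^ 2 * ((Λ + ‖p‖ + 1) ^ 2 / ‖e - (p - q)‖ ^ 2) := by
            rw [mul_one_div, one_div, div_mul_eq_div_div, div_right_comm,
              div_eq_mul_inv _ (‖p - q‖ ^ 2)]
            ring
        rw [this]
        refine le_mul_of_one_le_right (by positivity) ?_
        rw [one_le_div (by positivity)]
        exact h4
    _ ≤ _ := by
        rw [lintegral_const_mul _ (by fun_prop)]
        gcongr
        exact (lintegral_mono' (ballMeasure_le Λ) le_rfl).trans h1

lemma integrable_kernel {Λ : ℝ} (hΛ : 0 < Λ) (p : E3) :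
    Integrable (fun q => 1 / ‖p - q‖ ^ 2) (ballMeasure Λ) := by
  refine ⟨Measurable.aestronglyMeasurable (by fun_prop), ?_⟩
  rw [hasFiniteIntegral_iff_ofReal (ae_of_all _ fun _ => by positivity)]
  exact (lintegral_kernel_le hΛ p).trans_lt
    (ENNReal.mul_lt_top ENNReal.ofReal_lt_top ENNReal.ofReal_lt_top)

lemma integrable_kernel_smul {Λ : ℝ} (hΛ : 0 < Λ) {E : Type*} [NormedAddCommGroup E]
    [NormedSpace ℝ E] {v : E3 → E} (hv : AEStronglyMeasurable v (ballMeasure Λ)) {C : ℝ}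
    (hC : ∀ᵐ q ∂ballMeasure Λ, ‖v q‖ ≤ C) (p : E3) :
    Integrable (fun q => (1 / ‖p - q‖ ^ 2) • v q) (ballMeasure Λ) :=
  (integrable_kernel hΛ p).smul_bdd C hv hC

/-- The exchange potential `∫_{B(0,Λ)} v(q) / |p - q|² dq`. -/
def exchangePotential (Λ : ℝ) (v : E3 → CliffordVector) (p : E3) : CliffordVector :=
  ∫ q, (1 / ‖p - q‖ ^ 2) • v q ∂ballMeasure Λ

/-- The Clifford vector of the mean-field operator of the state with symbol `-v / 2`. -/
def meanFieldVector (α m₀ Λ : ℝ) (v : E3 → CliffordVector) (p : E3) : CliffordVector :=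
  WithLp.toLp 2 (p, m₀) + (α / (4 * Real.pi ^ 2)) • exchangePotential Λ v p

/-- Fields of Clifford vectors in the unit ball which are equivariant under the orthogonal group and
have a nonnegative component along `p · α` and `β`. -/
structure IsVacuumField (v : E3 → CliffordVector) : Prop where
  measurable : StronglyMeasurable v
  norm_le : ∀ p, ‖v p‖ ≤ 1
  fst_map : ∀ (R : E3 ≃ₗᵢ[ℝ] E3) p, (v (R p)).fst = R (v p).fst
  snd_map : ∀ (R : E3 ≃ₗᵢ[ℝ] E3) p, (v (R p)).snd = (v p).snd
  inner_nonneg : ∀ p, 0 ≤ inner ℝ (v p).fst p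
  snd_nonneg : ∀ p, 0 ≤ (v p).snd

lemma stronglyMeasurable_exchangePotential {Λ : ℝ} {v : E3 → CliffordVector}
    (hv : StronglyMeasurable v) : StronglyMeasurable (exchangePotential Λ v) := by
  have : StronglyMeasurable (fun z : E3 × E3 => (1 / ‖z.1 - z.2‖ ^ 2) • v z.2) := by
    have h : Measurable fun z : E3 × E3 => 1 / ‖z.1 - z.2‖ ^ 2 := by fun_prop
    exact h.stronglyMeasurable.smul (hv.comp_measurable measurable_snd)
  exact this.integral_prod_right

lemma fst_exchangePotential {Λ : ℝ} (hΛ : 0 < Λ) {v : E3 → CliffordVector}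
    (hv : IsVacuumField v) (p : E3) :
    (exchangePotential Λ v p).fst = ∫ q, (1 / ‖p - q‖ ^ 2) • (v q).fst ∂ballMeasure Λ :=
  ((WithLp.fstL 2 ℝ E3 ℝ).integral_comp_comm (integrable_kernel_smul hΛ
    hv.measurable.aestronglyMeasurable (ae_of_all _ hv.norm_le) p)).symm

lemma snd_exchangePotential {Λ : ℝ} (hΛ : 0 < Λ) {v : E3 → CliffordVector}
    (hv : IsVacuumField v) (p : E3) :
    (exchangePotential Λ v p).snd = ∫ q, (1 / ‖p - q‖ ^ 2) • (v q).snd ∂ballMeasure Λ :=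
  ((WithLp.sndL 2 ℝ E3 ℝ).integral_comp_comm (integrable_kernel_smul hΛ
    hv.measurable.aestronglyMeasurable (ae_of_all _ hv.norm_le) p)).symm

lemma measurePreserving_ballMeasure (Λ : ℝ) (R : E3 ≃ₗᵢ[ℝ] E3) :
    MeasurePreserving R (ballMeasure Λ) (ballMeasure Λ) := by
  have h := R.measurePreserving.restrict_preimage (s := Metric.ball 0 Λ)
    Metric.isOpen_ball.measurableSet
  simpa [ballMeasure] using h

lemma integral_comp_isometry {E : Type*} [NormedAddCommGroup E] [NormedSpace ℝ E] (Λ : ℝ)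
    (R : E3 ≃ₗᵢ[ℝ] E3) (g : E3 → E) :
    ∫ q, g (R q) ∂ballMeasure Λ = ∫ q, g q ∂ballMeasure Λ :=
  (measurePreserving_ballMeasure Λ R).integral_comp R.toMeasurableEquiv.measurableEmbedding g

/-- An equivariant field is radial: `v(q)` is fixed by the reflection in the line through `q`. -/
lemma IsVacuumField.exists_smul {v : E3 → CliffordVector} (hv : IsVacuumField v) {q : E3}
    (hq : q ≠ 0) : ∃ u : ℝ, 0 ≤ u ∧ (v q).fst = u • q := by
  have h0 : (Submodule.span ℝ {q}).reflection q = q :=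
    Submodule.reflection_mem_subspace_eq_self (Submodule.mem_span_singleton_self q)
  have h1 := hv.fst_map (Submodule.span ℝ {q}).reflection q
  rw [h0] at h1
  have h2 := (Submodule.reflection_eq_self_iff (𝕜 := ℝ) (K := Submodule.span ℝ {q})
    (v q).fst).mp h1.symm
  obtain ⟨u, hu⟩ := (Submodule.mem_span_singleton (R := ℝ)).mp h2
  refine ⟨u, ?_, hu.symm⟩
  have h3 := hv.inner_nonneg q
  rw [← hu, inner_smul_left, real_inner_self_eq_norm_sq, conj_trivial] at h3
  have : 0 < ‖q‖ ^ 2 := by positivity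
  exact nonneg_of_mul_nonneg_left h3 this

/-- By equivariance `v(q)` is a nonnegative multiple of `q`. Reflecting `q` in the plane orthogonal
to `p` changes the sign of `v(q) · p`, and lowers the kernel `1 / |p - q|²` where `q · p > 0`; so in
each pair of mirror images the positive contribution outweighs the negative one. -/
lemma inner_exchangePotential_nonneg {Λ : ℝ} (hΛ : 0 < Λ) {v : E3 → CliffordVector}
    (hv : IsVacuumField v) (p : E3) : 0 ≤ inner ℝ (exchangePotential Λ v p).fst p := by
  have hint : Integrable (fun q => (1 / ‖p - q‖ ^ 2) • (v q).fst) (ballMeasure Λ) :=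
    (WithLp.fstL 2 ℝ E3 ℝ).integrable_comp (integrable_kernel_smul hΛ
      hv.measurable.aestronglyMeasurable (ae_of_all _ hv.norm_le) p)
  have hF := hint.const_inner (𝕜 := ℝ) p
  rw [fst_exchangePotential hΛ hv, real_inner_comm, ← integral_inner hint]
  set F : E3 → ℝ := fun q => inner ℝ p ((1 / ‖p - q‖ ^ 2) • (v q).fst) with hFdef
  set S : E3 ≃ₗᵢ[ℝ] E3 := (Submodule.span ℝ {p})ᗮ.reflection with hS
  have hSp : S p = -p := Submodule.reflection_orthogonalComplement_singleton_eq_neg p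
  have hFS : Integrable (fun q => F (S q)) (ballMeasure Λ) :=
    (measurePreserving_ballMeasure Λ S).integrable_comp_of_integrable hF
  have h2 : ∫ q, F q ∂ballMeasure Λ = 1 / 2 * ∫ q, (F q + F (S q)) ∂ballMeasure Λ := by
    rw [integral_add hF hFS, integral_comp_isometry]
    ring
  rw [h2]
  refine mul_nonneg (by norm_num) (integral_nonneg_of_ae ?_)
  filter_upwards [ae_ballMeasure_ne Λ p, ae_ballMeasure_ne Λ (-p), ae_ballMeasure_ne Λ 0]
    with q h1 h2 h3
  obtain ⟨u, hu, huq⟩ := hv.exists_smul h3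
  have e1 : inner ℝ p (S (v q).fst) = -inner ℝ p (v q).fst := by
    rw [← S.inner_map_map p, hS, Submodule.reflection_reflection, ← hS, hSp, inner_neg_left]
  rw [huq] at e1
  have e2 : ‖p - S q‖ = ‖p + q‖ := by
    rw [← S.norm_map, map_sub, hS, Submodule.reflection_reflection, ← hS, hSp, ← norm_neg]
    congr 1; abel
  have h4 : 0 < ‖p - q‖ := norm_pos_iff.mpr (sub_ne_zero.mpr (Ne.symm h1))
  have h5 : 0 < ‖p + q‖ := by
    rw [norm_pos_iff]
    intro h
    exact h2 (eq_neg_of_add_eq_zero_right h)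
  have e3 : F q + F (S q) = u * inner ℝ p q * (1 / ‖p - q‖ ^ 2 - 1 / ‖p + q‖ ^ 2) := by
    simp only [hFdef, hv.fst_map S q, huq, inner_smul_right, e1, e2]
    ring
  simp only [Pi.zero_apply]
  rw [e3, div_sub_div _ _ (by positivity) (by positivity), mul_assoc, ← mul_div_assoc]
  have e4 : inner ℝ p q * (1 * ‖p + q‖ ^ 2 - ‖p - q‖ ^ 2 * 1) = (2 * inner ℝ p q) ^ 2 := by
    rw [norm_add_sq_real, norm_sub_sq_real]
    ring
  rw [e4]
  positivity

lemma meanFieldVector_fst (α m₀ Λ : ℝ) (v : E3 → CliffordVector) (p : E3) :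
    (meanFieldVector α m₀ Λ v p).fst =
      p + (α / (4 * Real.pi ^ 2)) • (exchangePotential Λ v p).fst := rfl

lemma meanFieldVector_snd (α m₀ Λ : ℝ) (v : E3 → CliffordVector) (p : E3) :
    (meanFieldVector α m₀ Λ v p).snd =
      m₀ + (α / (4 * Real.pi ^ 2)) * (exchangePotential Λ v p).snd := rfl

/-- Radially outward corrections to `(p, m)` can only increase its norm. -/
lemma le_norm_sq_of_fst_snd {x : CliffordVector} {p : E3} {m : ℝ} (hm : 0 ≤ m)
    (h1 : ‖p‖ ^ 2 ≤ inner ℝ x.fst p) (h2 : m ≤ x.snd) : ‖p‖ ^ 2 + m ^ 2 ≤ ‖x‖ ^ 2 := by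
  rw [WithLp.prod_norm_sq_eq_of_L2]
  have h3 : ‖p‖ ≤ ‖x.fst‖ := by
    rcases (norm_nonneg p).eq_or_lt with h | h
    · rw [← h]; positivity
    · have := h1.trans (real_inner_le_norm _ _)
      rw [sq] at this
      exact le_of_mul_le_mul_right this h
  have h4 : ‖p‖ ^ 2 ≤ ‖x.fst‖ ^ 2 := by gcongr
  have h5 : m ^ 2 ≤ ‖x.snd‖ ^ 2 := by
    rw [Real.norm_eq_abs, sq_abs]
    gcongr
  exact add_le_add h4 h5

/-- One step of the self-consistent iteration: the sign of the mean-field operator. -/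
def signField (α m₀ Λ : ℝ) (v : E3 → CliffordVector) (p : E3) : CliffordVector :=
  (1 / ‖meanFieldVector α m₀ Λ v p‖) • meanFieldVector α m₀ Λ v p

section Iteration

variable {α m₀ Λ : ℝ} {v : E3 → CliffordVector}

lemma stronglyMeasurable_meanFieldVector (hv : StronglyMeasurable v) :
    StronglyMeasurable (meanFieldVector α m₀ Λ v) := by
  have h : Continuous fun p : E3 => (WithLp.toLp 2 (p, m₀) : CliffordVector) := by fun_prop
  exact h.stronglyMeasurable.add
    ((stronglyMeasurable_exchangePotential hv).const_smul (α / (4 * Real.pi ^ 2)))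

lemma IsVacuumField.le_norm_sq (hα : 0 ≤ α) (hm : 0 < m₀) (hΛ : 0 < Λ) (hv : IsVacuumField v)
    (p : E3) : ‖p‖ ^ 2 + m₀ ^ 2 ≤ ‖meanFieldVector α m₀ Λ v p‖ ^ 2 := by
  refine le_norm_sq_of_fst_snd hm.le ?_ ?_
  · rw [meanFieldVector_fst, inner_add_left, real_inner_self_eq_norm_sq, inner_smul_left]
    have := inner_exchangePotential_nonneg hΛ hv p
    simp only [conj_trivial]
    have : 0 ≤ α / (4 * Real.pi ^ 2) * inner ℝ (exchangePotential Λ v p).fst p := by positivity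
    linarith
  · rw [meanFieldVector_snd, snd_exchangePotential hΛ hv]
    have : 0 ≤ ∫ q, (1 / ‖p - q‖ ^ 2) • (v q).snd ∂ballMeasure Λ :=
      integral_nonneg fun q => mul_nonneg (by positivity) (hv.snd_nonneg q)
    have : 0 ≤ α / (4 * Real.pi ^ 2) * ∫ q, (1 / ‖p - q‖ ^ 2) • (v q).snd ∂ballMeasure Λ := by
      positivity
    linarith

lemma IsVacuumField.signField (hα : 0 ≤ α) (hm : 0 < m₀) (hΛ : 0 < Λ) (hv : IsVacuumField v) :
    IsVacuumField (signField α m₀ Λ v) := by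
  have hn (R : E3 ≃ₗᵢ[ℝ] E3) (p q : E3) : ‖R p - R q‖ = ‖p - q‖ := by
    rw [← map_sub, R.norm_map]
  have h1 (R : E3 ≃ₗᵢ[ℝ] E3) (p : E3) :
      (meanFieldVector α m₀ Λ v (R p)).fst = R (meanFieldVector α m₀ Λ v p).fst := by
    rw [meanFieldVector_fst, meanFieldVector_fst, map_add, map_smul, fst_exchangePotential hΛ hv,
      fst_exchangePotential hΛ hv, ← integral_comp_isometry Λ R]
    simp_rw [hn, hv.fst_map R, ← map_smul R]
    congr 1
    rw [map_smul]
    congr 1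
    have := ContinuousLinearEquiv.integral_comp_comm (μ := ballMeasure Λ) R.toContinuousLinearEquiv
      fun q => (1 / ‖p - q‖ ^ 2) • (v q).fst
    exact this
  have h2 (R : E3 ≃ₗᵢ[ℝ] E3) (p : E3) :
      (meanFieldVector α m₀ Λ v (R p)).snd = (meanFieldVector α m₀ Λ v p).snd := by
    rw [meanFieldVector_snd, meanFieldVector_snd, snd_exchangePotential hΛ hv,
      snd_exchangePotential hΛ hv, ← integral_comp_isometry Λ R]
    simp_rw [hn, hv.snd_map R]
  have h3 (R : E3 ≃ₗᵢ[ℝ] E3) (p : E3) :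
      ‖meanFieldVector α m₀ Λ v (R p)‖ = ‖meanFieldVector α m₀ Λ v p‖ := by
    rw [WithLp.prod_norm_eq_of_L2, WithLp.prod_norm_eq_of_L2, h1, h2, R.norm_map]
  have h4 (p : E3) : 0 < ‖meanFieldVector α m₀ Λ v p‖ := by
    have := hv.le_norm_sq hα hm hΛ p
    by_contra hc
    rw [le_antisymm (not_lt.mp hc) (norm_nonneg _)] at this
    nlinarith [norm_nonneg p]
  refine ⟨?_, ?_, ?_, ?_, ?_, ?_⟩
  · have := stronglyMeasurable_meanFieldVector (α := α) (m₀ := m₀) (Λ := Λ) hv.measurable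
    have h := (this.norm.measurable.const_div 1).stronglyMeasurable
    exact h.smul this
  · intro p
    rw [BDF.signField, norm_smul, Real.norm_eq_abs, abs_of_pos (one_div_pos.mpr (h4 p)),
      one_div_mul_cancel (h4 p).ne']
  · intro R p
    simp only [BDF.signField, WithLp.smul_fst, h1, h3, map_smul]
  · intro R p
    simp only [BDF.signField, WithLp.smul_snd, h2, h3]
  · intro p
    have := inner_exchangePotential_nonneg hΛ hv p
    simp only [BDF.signField, WithLp.smul_fst, meanFieldVector_fst, inner_smul_left, inner_add_left,
      real_inner_self_eq_norm_sq, conj_trivial]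
    positivity
  · intro p
    have : 0 ≤ ∫ q, (1 / ‖p - q‖ ^ 2) • (v q).snd ∂ballMeasure Λ :=
      integral_nonneg fun q => mul_nonneg (by positivity) (hv.snd_nonneg q)
    simp only [BDF.signField, WithLp.smul_snd, meanFieldVector_snd, smul_eq_mul]
    rw [snd_exchangePotential hΛ hv]
    positivity

end Iteration

/-! ### The self-consistent sign field -/

/-- Normalization of vectors is `1 / ω`-Lipschitz outside the ball of radius `ω`. -/
lemma mul_norm_unit_sub_unit_le {E : Type*} [NormedAddCommGroup E] [InnerProductSpace ℝ E]
    {x y : E} {ω : ℝ} (hω : 0 < ω) (hx : ω ≤ ‖x‖) (hy : ω ≤ ‖y‖) :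
    ω * ‖(1 / ‖x‖) • x - (1 / ‖y‖) • y‖ ≤ ‖x - y‖ := by
  have ha : 0 < ‖x‖ := hω.trans_le hx
  have hb : 0 < ‖y‖ := hω.trans_le hy
  refine le_of_sq_le_sq ?_ (norm_nonneg _)
  have h1 : ‖(1 / ‖x‖) • x - (1 / ‖y‖) • y‖ ^ 2 = 2 - 2 * (inner ℝ x y / (‖x‖ * ‖y‖)) := by
    rw [norm_sub_sq_real, inner_smul_left, inner_smul_right, norm_smul, norm_smul]
    simp only [one_div, norm_inv, norm_norm, conj_trivial]
    field_simp
    ring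
  rw [mul_pow, h1, norm_sub_sq_real]
  have h2 : inner ℝ x y ≤ ‖x‖ * ‖y‖ := real_inner_le_norm x y
  have h3 : inner ℝ x y = (inner ℝ x y / (‖x‖ * ‖y‖)) * (‖x‖ * ‖y‖) := by field_simp
  have h4 : inner ℝ x y / (‖x‖ * ‖y‖) ≤ 1 := (div_le_one (by positivity)).mpr h2
  set c := inner ℝ x y / (‖x‖ * ‖y‖)
  rw [h3]
  have h5 : ω ^ 2 ≤ ‖x‖ * ‖y‖ := by rw [sq]; gcongr
  nlinarith [sq_nonneg (‖x‖ - ‖y‖), mul_le_mul_of_nonneg_right h5 (by linarith : 0 ≤ 2 - 2 * c)]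

section FixedPoint

variable {α m₀ Λ : ℝ}

lemma enorm_exchangePotential_sub_le (hΛ : 0 < Λ) {v w : E3 → CliffordVector}
    (hv : IsVacuumField v) (hw : IsVacuumField w) (p : E3) :
    ‖exchangePotential Λ v p - exchangePotential Λ w p‖ₑ ≤
      ∫⁻ q, ‖v q - w q‖ₑ * ENNReal.ofReal (1 / ‖p - q‖ ^ 2) ∂ballMeasure Λ := by
  rw [exchangePotential, exchangePotential, ← integral_sub
    (integrable_kernel_smul hΛ hv.measurable.aestronglyMeasurable (ae_of_all _ hv.norm_le) p)
    (integrable_kernel_smul hΛ hw.measurable.aestronglyMeasurable (ae_of_all _ hw.norm_le) p)]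
  refine (enorm_integral_le_lintegral_enorm _).trans (le_of_eq (lintegral_congr fun q => ?_))
  rw [← smul_sub, enorm_smul, mul_comm, Real.enorm_of_nonneg (by positivity)]

/-- Normalization divides differences by at least `√(|p|² + m₀²)`, so the self-consistent iteration
is a contraction in `L²(|p| dp)`: its ratio is `(α π / 4)² ≤ 1` times the largest value of
`|p|² / (|p|² + m₀²)` on the ball. -/
lemma lintegral_signField_sub_le (hα₀ : 0 ≤ α) (hα : α ≤ 4 / Real.pi) (hΛ : 0 < Λ) (hm : 0 < m₀)
    {v w : E3 → CliffordVector} (hv : IsVacuumField v) (hw : IsVacuumField w) :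
    ∫⁻ p, ENNReal.ofReal ‖p‖ * ‖signField α m₀ Λ v p - signField α m₀ Λ w p‖ₑ ^ 2
        ∂ballMeasure Λ ≤
      ENNReal.ofReal (Λ ^ 2 / (Λ ^ 2 + m₀ ^ 2)) *
        ∫⁻ p, ENNReal.ofReal ‖p‖ * ‖v p - w p‖ₑ ^ 2 ∂ballMeasure Λ := by
  set k : E3 → ENNReal := fun p =>
    ∫⁻ q, ‖v q - w q‖ₑ * ENNReal.ofReal (1 / ‖p - q‖ ^ 2) ∂ballMeasure Λ with hk
  set c : ℝ := α / (4 * Real.pi ^ 2) with hc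
  set L : ℝ := Λ ^ 2 / (Λ ^ 2 + m₀ ^ 2) with hL
  have hc0 : 0 ≤ c := by positivity
  have hvm := hv.measurable
  have hwm := hw.measurable
  have step : ∀ᵐ p ∂ballMeasure Λ,
      ENNReal.ofReal ‖p‖ * ‖signField α m₀ Λ v p - signField α m₀ Λ w p‖ₑ ^ 2 ≤
        ENNReal.ofReal (L * c ^ 2) * (k p ^ 2 * ENNReal.ofReal (1 / ‖p‖)) := by
    filter_upwards [ae_ballMeasure_mem Λ, ae_ballMeasure_ne Λ 0] with p hpΛ hp
    have hp' : 0 < ‖p‖ := norm_pos_iff.mpr hp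
    set ω := √(‖p‖ ^ 2 + m₀ ^ 2) with hω
    have hω0 : 0 < ω := by positivity
    have hω2 : ω ^ 2 = ‖p‖ ^ 2 + m₀ ^ 2 := Real.sq_sqrt (by positivity)
    have h1 := mul_norm_unit_sub_unit_le hω0
      (Real.sqrt_le_left (norm_nonneg _) |>.mpr (hv.le_norm_sq hα₀ hm hΛ p))
      (Real.sqrt_le_left (norm_nonneg _) |>.mpr (hw.le_norm_sq hα₀ hm hΛ p))
    change ω * ‖signField α m₀ Λ v p - signField α m₀ Λ w p‖ ≤ _ at h1
    have h2 : meanFieldVector α m₀ Λ v p - meanFieldVector α m₀ Λ w p =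
        c • (exchangePotential Λ v p - exchangePotential Λ w p) := by
      simp only [meanFieldVector, smul_sub, hc]
      abel
    rw [h2, norm_smul, Real.norm_of_nonneg hc0] at h1
    have h3 : ‖signField α m₀ Λ v p - signField α m₀ Λ w p‖ₑ ≤ ENNReal.ofReal (c / ω) * k p := by
      refine le_trans ?_ (mul_le_mul_right (enorm_exchangePotential_sub_le hΛ hv hw p) _)
      rw [← ofReal_norm, ← ofReal_norm, ← ENNReal.ofReal_mul (by positivity)]
      refine ENNReal.ofReal_le_ofReal ?_
      rw [div_mul_eq_mul_div, le_div_iff₀ hω0, mul_comm]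
      exact h1
    calc _ ≤ ENNReal.ofReal ‖p‖ * (ENNReal.ofReal (c / ω) * k p) ^ 2 := by gcongr
      _ = ENNReal.ofReal (‖p‖ * (c / ω) ^ 2) * k p ^ 2 := by
        rw [mul_pow, ← mul_assoc, ← ENNReal.ofReal_pow (by positivity),
          ← ENNReal.ofReal_mul (by positivity)]
      _ ≤ ENNReal.ofReal (L * c ^ 2 * (1 / ‖p‖)) * k p ^ 2 := by
        gcongr ENNReal.ofReal ?_ * _
        rw [div_pow, hω2, hL]
        have h4 : ‖p‖ * (c ^ 2 / (‖p‖ ^ 2 + m₀ ^ 2)) =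
          (‖p‖ ^ 2 / (‖p‖ ^ 2 + m₀ ^ 2)) * c ^ 2 * (1 / ‖p‖) := by field_simp
        rw [h4]
        gcongr ?_ * _ * _
        rw [div_le_div_iff₀ (by positivity) (by positivity)]
        have : ‖p‖ ^ 2 ≤ Λ ^ 2 := by gcongr
        nlinarith [sq_nonneg m₀]
      _ = _ := by
        rw [ENNReal.ofReal_mul (by positivity)]
        ring
  calc _ ≤ ∫⁻ p, ENNReal.ofReal (L * c ^ 2) * (k p ^ 2 * ENNReal.ofReal (1 / ‖p‖))
        ∂ballMeasure Λ := lintegral_mono_ae step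
    _ = ENNReal.ofReal (L * c ^ 2) * ∫⁻ p, k p ^ 2 * ENNReal.ofReal (1 / ‖p‖) ∂ballMeasure Λ :=
        lintegral_const_mul' _ _ ENNReal.ofReal_ne_top
    _ ≤ ENNReal.ofReal (L * c ^ 2) * (ENNReal.ofReal (Real.pi ^ 6) *
          ∫⁻ q, ENNReal.ofReal ‖q‖ * ‖v q - w q‖ₑ ^ 2 ∂ballMeasure Λ) := by
        gcongr
        exact lintegral_convolution_sq_le (ballMeasure_le Λ) (hvm.sub hwm).enorm.aemeasurable
    _ ≤ _ := by
        rw [← mul_assoc, ← ENNReal.ofReal_mul (by positivity)]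
        gcongr
        have h5 : α * Real.pi ≤ 4 := by rwa [le_div_iff₀ Real.pi_pos] at hα
        have h6 : c ^ 2 * Real.pi ^ 6 = (α * Real.pi / 4) ^ 2 := by
          rw [hc]; field_simp
        have h7 : (α * Real.pi / 4) ^ 2 ≤ 1 := by
          rw [sq_le_one_iff₀ (by positivity)]; linarith
        have h8 : 0 ≤ L := by positivity
        calc L * c ^ 2 * Real.pi ^ 6 = L * (α * Real.pi / 4) ^ 2 := by rw [mul_assoc, h6]
          _ ≤ L * 1 := by gcongr
          _ = L := mul_one L

/-- If `∑ n, r⁻ⁿ ‖vₙ₊₁ - vₙ‖²` is finite for some `r < 1` then `vₙ` converges. -/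
lemma cauchySeq_of_tsum_ne_top {E : Type*} [NormedAddCommGroup E] {u : ℕ → E} {r : ℝ}
    (hr0 : 0 < r) (hr : r < 1)
    (h : ∑' n, ENNReal.ofReal (r⁻¹ ^ n) * ‖u (n + 1) - u n‖ₑ ^ 2 ≠ ⊤) : CauchySeq u := by
  set S := (∑' n, ENNReal.ofReal (r⁻¹ ^ n) * ‖u (n + 1) - u n‖ₑ ^ 2).toReal with hS
  refine cauchySeq_of_le_geometric (√r) (√S) ?_ fun n => ?_
  · rw [Real.sqrt_lt' one_pos]; simpa using hr
  have h1 := ENNReal.toReal_mono h (ENNReal.le_tsum (f := fun n =>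
    ENNReal.ofReal (r⁻¹ ^ n) * ‖u (n + 1) - u n‖ₑ ^ 2) n)
  rw [ENNReal.toReal_mul, ENNReal.toReal_ofReal (by positivity), ENNReal.toReal_pow,
    toReal_enorm, ← hS] at h1
  rw [dist_comm, dist_eq_norm]
  refine le_of_sq_le_sq ?_ (by positivity)
  rw [mul_pow, Real.sq_sqrt ENNReal.toReal_nonneg, ← pow_mul, mul_comm n 2, pow_mul,
    Real.sq_sqrt hr0.le]
  rw [inv_pow, inv_mul_le_iff₀ (by positivity)] at h1
  linarith

lemma isVacuumField_zero : IsVacuumField (fun _ => 0) :=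
  ⟨stronglyMeasurable_const, by simp, by simp, by simp, by simp, by simp⟩

/-- The self-consistent iteration converges, because it is a contraction in `L²(|p| dp)`. The
bound `|p|² + m₀² ≤ |𝒟⁰(p)|²` passes to the limit. -/
theorem exists_signField_eq (hα₀ : 0 ≤ α) (hα : α ≤ 4 / Real.pi) (hΛ : 0 < Λ) (hm : 0 < m₀) :
    ∃ v : E3 → CliffordVector, StronglyMeasurable v ∧
      (∀ p, v p = signField α m₀ Λ v p) ∧
      ∀ p, ‖p‖ ^ 2 + m₀ ^ 2 ≤ ‖meanFieldVector α m₀ Λ v p‖ ^ 2 := by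
  set u : ℕ → E3 → CliffordVector := fun n => (signField α m₀ Λ)^[n] (fun _ => 0) with hu
  have hus (n : ℕ) : u (n + 1) = signField α m₀ Λ (u n) := Function.iterate_succ_apply' _ _ _
  have huv (n : ℕ) : IsVacuumField (u n) := by
    induction n with
    | zero => exact isVacuumField_zero
    | succ n ih => rw [hus]; exact ih.signField hα₀ hm hΛ
  set L : ℝ := Λ ^ 2 / (Λ ^ 2 + m₀ ^ 2) with hL
  have hL0 : 0 < L := by positivity
  have hL1 : L < 1 := by
    rw [hL, div_lt_one (by positivity)]
    have := pow_pos hm 2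
    linarith
  -- half of the decay `Lⁿ = r²ⁿ` is kept to absorb the weights `r⁻ⁿ` needed for convergence a.e.
  set r := √L with hr
  have hr0 : 0 < r := by positivity
  have hr1 : r < 1 := by rw [hr, Real.sqrt_lt' one_pos]; simpa using hL1
  have hr2 : r * r = L := Real.mul_self_sqrt hL0.le
  set C := ∫⁻ p, ENNReal.ofReal ‖p‖ * ‖u 1 p - u 0 p‖ₑ ^ 2 ∂ballMeasure Λ with hC
  have hCtop : C ≠ ⊤ := by
    have : C ≤ ∫⁻ _, ENNReal.ofReal Λ * ENNReal.ofReal 4 ∂ballMeasure Λ := by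
      refine lintegral_mono_ae ?_
      filter_upwards [ae_ballMeasure_mem Λ] with p hp
      have h1 : ‖u 1 p - u 0 p‖ₑ ^ 2 ≤ ENNReal.ofReal 4 := by
        rw [← ofReal_norm, ← ENNReal.ofReal_pow (norm_nonneg _)]
        refine ENNReal.ofReal_le_ofReal ?_
        have := norm_sub_le (u 1 p) (u 0 p)
        have := (huv 1).norm_le p
        have := (huv 0).norm_le p
        have h2 : ‖u 1 p - u 0 p‖ ≤ 2 := by linarith
        calc _ ≤ (2 : ℝ) ^ 2 := by gcongr
          _ = 4 := by norm_num
      gcongr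
    refine ne_top_of_le_ne_top ?_ this
    rw [lintegral_const]
    exact ENNReal.mul_ne_top (ENNReal.mul_ne_top ENNReal.ofReal_ne_top ENNReal.ofReal_ne_top)
      (measure_ne_top _ _)
  have hdec (n : ℕ) : ∫⁻ p, ENNReal.ofReal ‖p‖ * ‖u (n + 1) p - u n p‖ₑ ^ 2 ∂ballMeasure Λ ≤
      ENNReal.ofReal (L ^ n) * C := by
    induction n with
    | zero => simp [hC]
    | succ n ih =>
      have := lintegral_signField_sub_le hα₀ hα hΛ hm (huv (n + 1)) (huv n)
      rw [← hus, ← hus] at this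
      refine this.trans ?_
      rw [pow_succ' L n, ENNReal.ofReal_mul hL0.le, mul_assoc]
      gcongr
  have hmeas (n : ℕ) : Measurable fun p => ENNReal.ofReal (r⁻¹ ^ n) *
      (ENNReal.ofReal ‖p‖ * ‖u (n + 1) p - u n p‖ₑ ^ 2) := by
    have := ((huv (n + 1)).measurable.sub (huv n).measurable).enorm
    fun_prop
  have hsum : ∫⁻ p, ∑' n, ENNReal.ofReal (r⁻¹ ^ n) *
      (ENNReal.ofReal ‖p‖ * ‖u (n + 1) p - u n p‖ₑ ^ 2) ∂ballMeasure Λ ≠ ⊤ := by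
    rw [lintegral_tsum fun n => (hmeas n).aemeasurable]
    have : ∑' n, ∫⁻ p, ENNReal.ofReal (r⁻¹ ^ n) *
        (ENNReal.ofReal ‖p‖ * ‖u (n + 1) p - u n p‖ₑ ^ 2) ∂ballMeasure Λ ≤
        ∑' n, ENNReal.ofReal r ^ n * C := by
      refine ENNReal.tsum_le_tsum fun n => ?_
      rw [lintegral_const_mul' _ _ ENNReal.ofReal_ne_top]
      refine (mul_le_mul_right (hdec n) _).trans (le_of_eq ?_)
      rw [← mul_assoc, ← ENNReal.ofReal_mul (by positivity), ← ENNReal.ofReal_pow hr0.le, ← hr2,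
        mul_pow, inv_pow, inv_mul_cancel_left₀ (by positivity)]
    refine ne_top_of_le_ne_top ?_ this
    rw [ENNReal.tsum_mul_right, ENNReal.tsum_geometric]
    refine ENNReal.mul_ne_top (ENNReal.inv_ne_top.mpr ?_) hCtop
    rw [← ENNReal.ofReal_one, ← ENNReal.ofReal_sub _ hr0.le]
    simpa using hr1
  have hlim : ∀ᵐ p ∂ballMeasure Λ, ∃ l, Tendsto (fun n => u n p) atTop (𝓝 l) := by
    filter_upwards [ae_lt_top (Measurable.tsum hmeas) hsum, ae_ballMeasure_ne Λ 0]
      with p hp hp0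
    refine cauchySeq_tendsto_of_complete (cauchySeq_of_tsum_ne_top hr0 hr1 ?_)
    have h1 : ∑' n, ENNReal.ofReal (r⁻¹ ^ n) * (ENNReal.ofReal ‖p‖ * ‖u (n + 1) p - u n p‖ₑ ^ 2) =
        ENNReal.ofReal ‖p‖ * ∑' n, ENNReal.ofReal (r⁻¹ ^ n) * ‖u (n + 1) p - u n p‖ₑ ^ 2 := by
      rw [← ENNReal.tsum_mul_left]
      congr 1
      ext n
      ring
    rw [h1] at hp
    intro h
    rw [h, ENNReal.mul_top (by simpa using hp0)] at hp
    exact lt_irrefl _ hp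
  obtain ⟨w, hw, hwlim⟩ := exists_stronglyMeasurable_limit_of_tendsto_ae
    (fun n => (huv n).measurable.aestronglyMeasurable) hlim
  have hG (p : E3) : Tendsto (fun n => meanFieldVector α m₀ Λ (u n) p) atTop
      (𝓝 (meanFieldVector α m₀ Λ w p)) := by
    refine Tendsto.const_add _ (Tendsto.const_smul ?_ _)
    refine tendsto_integral_of_dominated_convergence (fun q => 1 / ‖p - q‖ ^ 2) (fun n => ?_)
      (integrable_kernel hΛ p) (fun n => ae_of_all _ fun q => ?_) ?_
    · exact (integrable_kernel_smul hΛ (huv n).measurable.aestronglyMeasurable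
        (ae_of_all _ (huv n).norm_le) p).aestronglyMeasurable
    · rw [norm_smul, Real.norm_of_nonneg (by positivity)]
      exact mul_le_of_le_one_right (by positivity) ((huv n).norm_le q)
    · filter_upwards [hwlim] with q hq
      exact hq.const_smul _
  have hbound (p : E3) : ‖p‖ ^ 2 + m₀ ^ 2 ≤ ‖meanFieldVector α m₀ Λ w p‖ ^ 2 :=
    ge_of_tendsto' ((hG p).norm.pow 2) fun n => (huv n).le_norm_sq hα₀ hm hΛ p
  have hpos (p : E3) : ‖meanFieldVector α m₀ Λ w p‖ ≠ 0 := by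
    intro h
    have := hbound p
    rw [h] at this
    nlinarith [norm_nonneg p]
  have hsign (p : E3) : Tendsto (fun n => u (n + 1) p) atTop (𝓝 (signField α m₀ Λ w p)) := by
    simp_rw [hus]
    exact (tendsto_const_nhds.div (hG p).norm (hpos p)).smul (hG p)
  have hae : w =ᵐ[ballMeasure Λ] signField α m₀ Λ w := by
    filter_upwards [hwlim] with p hp
    exact tendsto_nhds_unique (hp.comp (tendsto_add_atTop_nat 1)) (hsign p)
  -- the exchange potential ignores null sets, so one more step gives a solution everywhere
  have hGeq : meanFieldVector α m₀ Λ (signField α m₀ Λ w) = meanFieldVector α m₀ Λ w := by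
    ext1 p
    simp only [meanFieldVector, exchangePotential]
    congr 2
    refine integral_congr_ae ?_
    filter_upwards [hae] with q hq
    rw [← hq]
  refine ⟨signField α m₀ Λ w, ?_, fun p => ?_, fun p => ?_⟩
  · have := stronglyMeasurable_meanFieldVector (α := α) (m₀ := m₀) (Λ := Λ) hw
    exact (this.norm.measurable.const_div 1).stronglyMeasurable.smul this
  · rw [signField, signField, hGeq]
  · rw [hGeq]; exact hbound p

end FixedPoint

/-! ### Dirac matrices and the trace -/

/-- The Hermitian matrix `a · α + b β` of a Clifford vector `(a, b)`. -/
def slash (x : CliffordVector) : Mat4 := diracSymbol x.snd x.fst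

lemma slash_add (x y : CliffordVector) : slash (x + y) = slash x + slash y := by
  simp only [slash, diracSymbol, WithLp.add_fst, WithLp.add_snd, PiLp.add_apply, ofReal_add,
    add_smul, Finset.sum_add_distrib]
  abel

lemma slash_smul (c : ℝ) (x : CliffordVector) : slash (c • x) = (c : ℂ) • slash x := by
  simp only [slash, diracSymbol, WithLp.smul_fst, WithLp.smul_snd, PiLp.smul_apply, ofReal_mul,
    smul_eq_mul, smul_add, Finset.smul_sum, smul_smul]

lemma slash_isHermitian (x : CliffordVector) : (slash x).IsHermitian := by
  ext i j
  simp only [slash, diracSymbol, Fin.sum_univ_three, diracAlpha, diracBeta]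
  fin_cases i <;> fin_cases j <;> simp

lemma slash_mul_self (x : CliffordVector) :
    slash x * slash x = ((‖x‖ ^ 2 : ℝ) : ℂ) • (1 : Mat4) := by
  have h : ‖x‖ ^ 2 = x.fst 0 ^ 2 + x.fst 1 ^ 2 + x.fst 2 ^ 2 + x.snd ^ 2 := by
    rw [WithLp.prod_norm_sq_eq_of_L2, EuclideanSpace.norm_sq_eq, Fin.sum_univ_three]
    simp only [Real.norm_eq_abs, sq_abs]
  rw [h]
  ext i j
  simp only [slash, diracSymbol, Fin.sum_univ_three, diracAlpha, diracBeta, Matrix.mul_apply,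
    Fin.sum_univ_four]
  fin_cases i <;> fin_cases j <;>
    simp [Matrix.vecHead, Matrix.vecTail] <;> ring_nf <;> simp [I_sq]

/-- The matrix entry `(i, j)` as a continuous linear functional of the Clifford vector. -/
def slashEntry (i j : Fin 4) : CliffordVector →L[ℝ] ℂ :=
  { toFun := fun x => slash x i j
    map_add' := fun x y => by rw [slash_add]; rfl
    map_smul' := fun c x => by rw [slash_smul]; simp
    cont := by
      simp only [slash, diracSymbol, Matrix.add_apply, Matrix.sum_apply, Matrix.smul_apply,
        smul_eq_mul]
      fun_prop }

/-- The translation-invariant state with symbol `-v / 2`. -/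
def vacuumSymbol (v : E3 → CliffordVector) (p : E3) : Mat4 := (-(1 / 2) : ℂ) • slash (v p)

/-- A matrix as a vector of the Euclidean space of its entries, whose norm is the Frobenius norm. -/
def matVec (A : Mat4) : EuclideanSpace ℂ (Fin 4 × Fin 4) := WithLp.toLp 2 fun z => A z.1 z.2

lemma norm_matVec_sq (A : Mat4) : ‖matVec A‖ ^ 2 = ∑ i, ∑ j, ‖A i j‖ ^ 2 := by
  rw [EuclideanSpace.norm_sq_eq, Fintype.sum_prod_type]
  rfl

lemma norm_entry_le (A : Mat4) (i j : Fin 4) : ‖A i j‖ ≤ ‖matVec A‖ :=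
  PiLp.norm_apply_le (matVec A) (i, j)

lemma trace_mul_eq_sum (A B : Mat4) : (A * B).trace = ∑ i, ∑ j, A i j * B j i := rfl

lemma trace_mul_eq_inner (A B : Mat4) (hA : A.IsHermitian) :
    (A * B).trace = inner ℂ (matVec A) (matVec B) := by
  rw [trace_mul_eq_sum, Finset.sum_comm, PiLp.inner_apply, Fintype.sum_prod_type]
  refine Finset.sum_congr rfl fun i _ => Finset.sum_congr rfl fun j _ => ?_
  rw [RCLike.inner_apply, mul_comm, ← hA.apply j i]
  rfl

lemma trace_mul_self_re (A : Mat4) (hA : A.IsHermitian) : (A * A).trace.re = ‖matVec A‖ ^ 2 := by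
  rw [trace_mul_eq_inner A A hA, inner_self_eq_norm_sq_to_K]
  norm_cast

lemma abs_trace_mul_re_le (A B : Mat4) (hA : A.IsHermitian) :
    |(A * B).trace.re| ≤ ‖matVec A‖ * ‖matVec B‖ := by
  rw [trace_mul_eq_inner A B hA]
  exact (abs_re_le_norm _).trans (norm_inner_le_norm _ _)

lemma trace_mul_nonneg_of_posSemidef {A B : Mat4} (hA : A.PosSemidef) (hB : B.PosSemidef) :
    0 ≤ (A * B).trace.re := by
  obtain ⟨m, w, rfl⟩ := Matrix.posSemidef_iff_eq_sum_vecMulVec.mp hB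
  rw [Finset.mul_sum, Matrix.trace_sum, re_sum]
  refine Finset.sum_nonneg fun i _ => ?_
  rw [Matrix.mul_vecMulVec, Matrix.trace_vecMulVec, dotProduct_comm]
  exact (Complex.le_def.mp (hA.dotProduct_mulVec_nonneg (w i))).1

/-- The pointwise content of `-1/2 ≤ F ≤ 1/2`. -/
structure IsHalfBounded (F : Mat4) : Prop where
  isHermitian : F.IsHermitian
  norm_le : ‖matVec F‖ ^ 2 ≤ 1

lemma isHalfBounded_of_posSemidef {F : Mat4} (h1 : ((1 / 2 : ℂ) • (1 : Mat4) + F).PosSemidef)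
    (h2 : ((1 / 2 : ℂ) • (1 : Mat4) - F).PosSemidef) : IsHalfBounded F := by
  have hF : F.IsHermitian := by
    have e : F = (1 / 2 : ℝ) •
        (((1 / 2 : ℂ) • (1 : Mat4) + F) - ((1 / 2 : ℂ) • (1 : Mat4) - F)) := by
      ext i j
      simp
      ring
    rw [e]
    exact (h1.1.sub h2.1).smul (IsSelfAdjoint.all _)
  refine ⟨hF, ?_⟩
  have h3 := trace_mul_nonneg_of_posSemidef h1 h2
  have e : ((1 / 2 : ℂ) • (1 : Mat4) + F) * ((1 / 2 : ℂ) • (1 : Mat4) - F) =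
      (1 / 4 : ℂ) • (1 : Mat4) - F * F := by
    simp only [add_mul, mul_sub, smul_mul_assoc, mul_smul_comm, one_mul, mul_one]
    ext i j
    simp
    ring
  rw [e, Matrix.trace_sub, sub_re, trace_mul_self_re F hF, Matrix.trace_smul,
    Matrix.trace_one] at h3
  simp at h3
  nlinarith [norm_nonneg (matVec F)]

/-- `tr(|D| h²) ≤ tr(D h)` for `h = F - P₋ + 1/2`, the difference between a state and the projector
on the negative spectral subspace of `D = |D| U`. -/
lemma norm_matVec_sq_le_trace {F U : Mat4} (hF : IsHalfBounded F) (hU : U.IsHermitian)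
    (hU2 : U * U = 1) :
    ‖matVec (F - (-(1 / 2) : ℂ) • U)‖ ^ 2 ≤ (U * (F - (-(1 / 2) : ℂ) • U)).trace.re := by
  have hh : (F - (-(1 / 2) : ℂ) • U).IsHermitian := by
    refine hF.1.sub ?_
    have : (-(1 / 2) : ℂ) • U = (-(1 / 2) : ℝ) • U := by
      ext i j
      simp
    rw [this]
    exact hU.smul (IsSelfAdjoint.all _)
  rw [← trace_mul_self_re _ hh]
  have h4 := hF.2
  rw [← trace_mul_self_re _ hF.1] at h4
  simp only [sub_mul, mul_sub, smul_mul_assoc, mul_smul_comm, hU2, Matrix.trace_sub,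
    Matrix.trace_smul, Matrix.trace_one, Matrix.trace_mul_comm F U, sub_re]
  simp
  linarith

lemma posSemidef_of_mul_self {U : Mat4} (hU : U.IsHermitian) (hU2 : U * U = 1) :
    ((1 / 2 : ℂ) • (1 : Mat4) + (1 / 2 : ℂ) • U).PosSemidef := by
  have e : (1 / 2 : ℂ) • (1 : Mat4) + (1 / 2 : ℂ) • U =
      ((1 / 2 : ℂ) • (1 : Mat4) + (1 / 2 : ℂ) • U).conjTranspose *
        ((1 / 2 : ℂ) • (1 : Mat4) + (1 / 2 : ℂ) • U) := by
    rw [Matrix.conjTranspose_add, Matrix.conjTranspose_smul, Matrix.conjTranspose_smul,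
      Matrix.conjTranspose_one, hU.eq]
    simp only [add_mul, mul_add, smul_mul_assoc, mul_smul_comm, one_mul, mul_one, hU2]
    ext i j
    simp
    ring
  rw [e]
  exact Matrix.posSemidef_conjTranspose_mul_self _

lemma vacuumSymbol_mem {Λ : ℝ} {v : E3 → CliffordVector} (hv : StronglyMeasurable v)
    (h1 : ∀ p, ‖v p‖ = 1) : vacuumSymbol v ∈ admissibleSymbols Λ := by
  have hU2 (p : E3) : slash (v p) * slash (v p) = 1 := by
    rw [slash_mul_self, h1]; simp
  refine ⟨fun i j => ?_, ae_of_all _ fun p => ⟨?_, ?_⟩⟩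
  · have := ((slashEntry i j).continuous.comp_stronglyMeasurable hv).const_smul (-(1 / 2) : ℂ)
    exact this.aestronglyMeasurable
  · have h2 : slash (-v p) = -slash (v p) := by
      have := slash_smul (-1) (v p)
      simpa using this
    have := posSemidef_of_mul_self (slash_isHermitian (-v p)) (by rw [h2]; simpa using hU2 p)
    rw [h2] at this
    simpa [vacuumSymbol] using this
  · have := posSemidef_of_mul_self (slash_isHermitian (v p)) (hU2 p)
    simpa [vacuumSymbol] using this

lemma meanFieldSymbol_vacuumSymbol {α m₀ Λ : ℝ} (hΛ : 0 < Λ) {v : E3 → CliffordVector}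
    (hv : StronglyMeasurable v) (h1 : ∀ p, ‖v p‖ = 1) (p : E3) :
    meanFieldSymbol α m₀ Λ (vacuumSymbol v) p = slash (meanFieldVector α m₀ Λ v p) := by
  have h2 : (Matrix.of fun i j => ∫ q, vacuumSymbol v q i j / ((‖p - q‖ ^ 2 : ℝ) : ℂ)
      ∂(ballMeasure Λ)) = (-(1 / 2) : ℂ) • slash (exchangePotential Λ v p) := by
    ext i j
    have h3 := (slashEntry i j).integral_comp_comm (integrable_kernel_smul hΛ
      hv.aestronglyMeasurable (ae_of_all _ fun q => (h1 q).le) p)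
    have h4 : slash (exchangePotential Λ v p) i j =
        ∫ q, slash ((1 / ‖p - q‖ ^ 2) • v q) i j ∂ballMeasure Λ := h3.symm
    rw [Matrix.of_apply, Matrix.smul_apply, h4, smul_eq_mul, ← integral_const_mul]
    refine integral_congr_ae (ae_of_all _ fun q => ?_)
    simp only [vacuumSymbol, slash_smul, Matrix.smul_apply, smul_eq_mul]
    push_cast
    ring
  rw [meanFieldSymbol, h2, meanFieldVector, slash_add, slash_smul, smul_smul]
  rw [sub_eq_add_neg, ← neg_smul]
  congr 2
  push_cast
  ring

/-! ### Existence and uniqueness of the free vacuum -/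

/-- Bounded measurable functions on the ball with values in the Hermitian matrices. -/
structure IsBoundedSymbol (Λ : ℝ) (f : E3 → Mat4) (C : ℝ) : Prop where
  measurable : ∀ i j, AEStronglyMeasurable (fun p => f p i j) (ballMeasure Λ)
  isHermitian : ∀ᵐ p ∂ballMeasure Λ, (f p).IsHermitian
  norm_le : ∀ᵐ p ∂ballMeasure Λ, ‖matVec (f p)‖ ≤ C

lemma matVec_sub (A B : Mat4) : matVec (A - B) = matVec A - matVec B := rfl

lemma isBoundedSymbol_of_mem {Λ : ℝ} {f : E3 → Mat4} (hf : f ∈ admissibleSymbols Λ) :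
    IsBoundedSymbol Λ f 1 := by
  refine ⟨hf.1, ?_, ?_⟩
  · filter_upwards [hf.2] with p hp
    exact (isHalfBounded_of_posSemidef hp.1 hp.2).1
  · filter_upwards [hf.2] with p hp
    exact (sq_le_one_iff₀ (norm_nonneg _)).mp (isHalfBounded_of_posSemidef hp.1 hp.2).2

lemma IsBoundedSymbol.sub {Λ : ℝ} {f g : E3 → Mat4} {C D : ℝ} (hf : IsBoundedSymbol Λ f C)
    (hg : IsBoundedSymbol Λ g D) : IsBoundedSymbol Λ (fun p => f p - g p) (C + D) := by
  refine ⟨fun i j => (hf.1 i j).sub (hg.1 i j), ?_, ?_⟩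
  · filter_upwards [hf.2, hg.2] with p h1 h2 using h1.sub h2
  · filter_upwards [hf.3, hg.3] with p h1 h2
    rw [matVec_sub]
    exact (norm_sub_le _ _).trans (add_le_add h1 h2)

lemma aestronglyMeasurable_matVec {X : Type*} [MeasurableSpace X] {μ : Measure X} {f : X → Mat4}
    (hf : ∀ i j, AEStronglyMeasurable (fun p => f p i j) μ) :
    AEStronglyMeasurable (fun p => matVec (f p)) μ := by
  have h : AEStronglyMeasurable (fun p (z : Fin 4 × Fin 4) => f p z.1 z.2) μ :=
    (aemeasurable_pi_lambda _ fun z : Fin 4 × Fin 4 =>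
      (hf z.1 z.2).aemeasurable).aestronglyMeasurable
  exact (PiLp.continuous_toLp 2 _).comp_aestronglyMeasurable h

lemma aestronglyMeasurable_trace_mul {X : Type*} [MeasurableSpace X] {μ : Measure X}
    {f g : X → Mat4} (hf : ∀ i j, AEStronglyMeasurable (fun p => f p i j) μ)
    (hg : ∀ i j, AEStronglyMeasurable (fun p => g p i j) μ) :
    AEStronglyMeasurable (fun p => (f p * g p).trace.re) μ := by
  simp_rw [trace_mul_eq_sum]
  refine continuous_re.comp_aestronglyMeasurable ?_
  exact Finset.aestronglyMeasurable_fun_sum _ fun i _ =>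
    Finset.aestronglyMeasurable_fun_sum _ fun j _ => (hf i j).mul (hg j i)

lemma integrable_kernel_prod {Λ : ℝ} (hΛ : 0 < Λ) :
    Integrable (fun z : E3 × E3 => 1 / ‖z.1 - z.2‖ ^ 2)
      ((ballMeasure Λ).prod (ballMeasure Λ)) := by
  have hm : Measurable fun z : E3 × E3 => 1 / ‖z.1 - z.2‖ ^ 2 := by fun_prop
  refine ⟨hm.aestronglyMeasurable, ?_⟩
  rw [hasFiniteIntegral_iff_ofReal (ae_of_all _ fun _ => by positivity),
    lintegral_prod _ (by fun_prop)]
  have : ∫⁻ p, ∫⁻ q, ENNReal.ofReal (1 / ‖p - q‖ ^ 2) ∂ballMeasure Λ ∂ballMeasure Λ ≤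
      ∫⁻ _, ENNReal.ofReal ((Λ + Λ + 1) ^ 2) * ENNReal.ofReal (Real.pi ^ 3) ∂ballMeasure Λ := by
    refine lintegral_mono_ae ?_
    filter_upwards [ae_ballMeasure_mem Λ] with p hp
    refine (lintegral_kernel_le hΛ p).trans ?_
    gcongr
  refine this.trans_lt ?_
  rw [lintegral_const]
  exact ENNReal.mul_lt_top (ENNReal.mul_lt_top ENNReal.ofReal_lt_top ENNReal.ofReal_lt_top)
    (measure_lt_top _ _)

/-- The exchange form `∬ Re tr(f(p) g(q)) / |p - q|² dp dq`. -/
def exchangeForm (Λ : ℝ) (f g : E3 → Mat4) : ℝ :=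
  ∫ z : E3 × E3, (f z.1 * g z.2).trace.re / ‖z.1 - z.2‖ ^ 2
    ∂((ballMeasure Λ).prod (ballMeasure Λ))

section

variable {Λ : ℝ} {f g : E3 → Mat4} {C D : ℝ}

lemma ae_abs_trace_le (hf : IsBoundedSymbol Λ f C) :
    ∀ᵐ z ∂(ballMeasure Λ).prod (ballMeasure Λ),
      |(f z.1 * g z.2).trace.re| ≤ ‖matVec (f z.1)‖ * ‖matVec (g z.2)‖ := by
  filter_upwards [Measure.quasiMeasurePreserving_fst.ae hf.2] with z hz
  exact abs_trace_mul_re_le _ _ hz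

lemma integrable_exchange (hΛ : 0 < Λ) (hf : IsBoundedSymbol Λ f C) (hg : IsBoundedSymbol Λ g D) :
    Integrable (fun z : E3 × E3 => (f z.1 * g z.2).trace.re / ‖z.1 - z.2‖ ^ 2)
      ((ballMeasure Λ).prod (ballMeasure Λ)) := by
  have h := (integrable_kernel_prod hΛ).bdd_mul (c := C * D)
    (f := fun z : E3 × E3 => (f z.1 * g z.2).trace.re)
    (aestronglyMeasurable_trace_mul (fun i j => (hf.1 i j).comp_fst)
      fun i j => (hg.1 i j).comp_snd) ?_
  · simpa only [mul_one_div] using h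
  · filter_upwards [ae_abs_trace_le (g := g) hf, Measure.quasiMeasurePreserving_fst.ae hf.3,
      Measure.quasiMeasurePreserving_snd.ae hg.3] with z h1 h2 h3
    refine h1.trans ?_
    have := (norm_nonneg (matVec (f z.1))).trans h2
    gcongr

lemma exchangeForm_comm : exchangeForm Λ f g = exchangeForm Λ g f := by
  rw [exchangeForm, exchangeForm, ← integral_prod_swap]
  refine integral_congr_ae (ae_of_all _ fun z => ?_)
  simp only [Prod.fst_swap, Prod.snd_swap]
  rw [Matrix.trace_mul_comm, norm_sub_rev]

lemma exchangeForm_sub_left (hΛ : 0 < Λ) (hf : IsBoundedSymbol Λ f C)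
    (hg : IsBoundedSymbol Λ g D) {k : E3 → Mat4} {K : ℝ} (hk : IsBoundedSymbol Λ k K) :
    exchangeForm Λ (fun p => f p - g p) k = exchangeForm Λ f k - exchangeForm Λ g k := by
  rw [exchangeForm, exchangeForm, exchangeForm, ← integral_sub (integrable_exchange hΛ hf hk)
    (integrable_exchange hΛ hg hk)]
  refine integral_congr_ae (ae_of_all _ fun z => ?_)
  simp only [sub_mul, Matrix.trace_sub, sub_re, sub_div]

/-- Kato's inequality for the exchange energy per unit volume. -/
lemma exchangeForm_self_le (hΛ : 0 < Λ) (hf : IsBoundedSymbol Λ f C) :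
    exchangeForm Λ f f ≤ Real.pi ^ 3 * ∫ p, ‖p‖ * ‖matVec (f p)‖ ^ 2 ∂ballMeasure Λ := by
  have hm := aestronglyMeasurable_matVec hf.1
  have hint : Integrable (fun p => ‖p‖ * ‖matVec (f p)‖ ^ 2) (ballMeasure Λ) := by
    refine Integrable.of_bound (C := Λ * C ^ 2)
      (continuous_norm.aestronglyMeasurable.mul (hm.norm.pow 2)) ?_
    filter_upwards [ae_ballMeasure_mem Λ, hf.3] with p h1 h2
    rw [Real.norm_of_nonneg (by positivity)]
    gcongr
  have h1 : ENNReal.ofReal (∫ p, ‖p‖ * ‖matVec (f p)‖ ^ 2 ∂ballMeasure Λ) =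
      ∫⁻ p, ENNReal.ofReal ‖p‖ * ‖matVec (f p)‖ₑ ^ 2 ∂ballMeasure Λ := by
    rw [ofReal_integral_eq_lintegral_ofReal hint (ae_of_all _ fun _ => by positivity)]
    refine lintegral_congr fun p => ?_
    rw [ENNReal.ofReal_mul (norm_nonneg _), ENNReal.ofReal_pow (norm_nonneg _),
      ofReal_norm (matVec (f p))]
  have h0 : 0 ≤ ∫ p, ‖p‖ * ‖matVec (f p)‖ ^ 2 ∂ballMeasure Λ :=
    integral_nonneg fun p => by positivity
  rw [← ENNReal.ofReal_le_ofReal_iff (by positivity), ENNReal.ofReal_mul (by positivity), h1]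
  refine le_trans ?_ (lintegral_lintegral_mul_le (ballMeasure_le Λ) hm.enorm)
  rw [lintegral_lintegral]
  · have hi := integrable_exchange hΛ hf hf
    refine (ENNReal.ofReal_le_ofReal (integral_mono_ae hi hi.norm
      (ae_of_all _ fun z => Real.le_norm_self _))).trans ?_
    rw [ofReal_integral_norm_eq_lintegral_enorm hi]
    refine lintegral_mono_ae ?_
    filter_upwards [ae_abs_trace_le (g := f) hf] with z hz
    rw [← ofReal_norm, ← ofReal_norm, ← ofReal_norm, ← ENNReal.ofReal_mul (norm_nonneg _),
      ← ENNReal.ofReal_mul (by positivity), norm_div, mul_one_div]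
    refine ENNReal.ofReal_le_ofReal ?_
    rw [Real.norm_of_nonneg (sq_nonneg ‖z.1 - z.2‖)]
    gcongr
    exact hz
  · exact ((hm.enorm.comp_fst).mul (hm.enorm.comp_snd)).mul (by fun_prop)

lemma exchangeForm_eq_integral (hΛ : 0 < Λ) (hf : IsBoundedSymbol Λ f C)
    (hg : IsBoundedSymbol Λ g D) :
    exchangeForm Λ f g = ∫ p, (f p * Matrix.of fun i j =>
      ∫ q, g q i j / ((‖p - q‖ ^ 2 : ℝ) : ℂ) ∂ballMeasure Λ).trace.re ∂ballMeasure Λ := by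
  have hint (p : E3) (i j : Fin 4) :
      Integrable (fun q => g q i j / ((‖p - q‖ ^ 2 : ℝ) : ℂ)) (ballMeasure Λ) := by
    have hb : ∀ᵐ q ∂ballMeasure Λ, ‖g q i j‖ ≤ D := by
      filter_upwards [hg.3] with q hq using (norm_entry_le _ i j).trans hq
    refine (integrable_kernel_smul hΛ (hg.1 i j) hb p).congr (ae_of_all _ fun q => ?_)
    simp only [real_smul]
    push_cast
    ring
  rw [exchangeForm, integral_prod _ (integrable_exchange hΛ hf hg)]
  refine integral_congr_ae (ae_of_all _ fun p => ?_)
  simp only [trace_mul_eq_sum, Matrix.of_apply]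
  have e1 : ∀ q, (∑ i, ∑ j, f p i j * g q j i).re / ‖p - q‖ ^ 2 =
      (∑ i, ∑ j, f p i j * (g q j i / ((‖p - q‖ ^ 2 : ℝ) : ℂ))).re := by
    intro q
    simp_rw [← mul_div_assoc, ← Finset.sum_div]
    rw [div_ofReal_re]
  simp_rw [e1]
  have hi1 (i j : Fin 4) := (hint p j i).const_mul (f p i j)
  have hi2 (i : Fin 4) := integrable_finsetSum Finset.univ (fun j _ => hi1 i j)
  have hi3 := integrable_finsetSum Finset.univ (fun i _ => hi2 i)
  have h4 := reCLM.integral_comp_comm hi3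
  simp only [reCLM_apply] at h4
  rw [h4, integral_finsetSum _ fun i _ => hi2 i]
  congr 1
  refine Finset.sum_congr rfl fun i _ => ?_
  rw [integral_finsetSum _ fun j _ => hi1 i j]
  refine Finset.sum_congr rfl fun j _ => ?_
  rw [integral_const_mul]

end

lemma signField_norm {α m₀ Λ : ℝ} (hm : 0 < m₀) {v : E3 → CliffordVector} {p : E3}
    (h : ‖p‖ ^ 2 + m₀ ^ 2 ≤ ‖meanFieldVector α m₀ Λ v p‖ ^ 2) : ‖signField α m₀ Λ v p‖ = 1 := by
  have : ‖meanFieldVector α m₀ Λ v p‖ ≠ 0 := by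
    intro h0
    rw [h0] at h
    nlinarith [norm_nonneg p]
  rw [signField, norm_smul, norm_div, norm_one, norm_norm, one_div_mul_cancel this]

/-- A self-consistent field whose mean-field operator dominates `√(|p|² + m₀²)`. -/
structure IsSelfConsistent (α m₀ Λ : ℝ) (v : E3 → CliffordVector) : Prop where
  measurable : StronglyMeasurable v
  eq_signField : ∀ p, v p = signField α m₀ Λ v p
  le_norm_sq : ∀ p, ‖p‖ ^ 2 + m₀ ^ 2 ≤ ‖meanFieldVector α m₀ Λ v p‖ ^ 2

namespace IsSelfConsistent

variable {α m₀ Λ : ℝ} {v : E3 → CliffordVector}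

lemma norm_eq_one (h : IsSelfConsistent α m₀ Λ v) (hm : 0 < m₀) (p : E3) : ‖v p‖ = 1 := by
  rw [h.eq_signField p]
  exact signField_norm hm (h.le_norm_sq p)

lemma norm_lt (h : IsSelfConsistent α m₀ Λ v) (hm : 0 < m₀) (p : E3) :
    ‖p‖ < ‖meanFieldVector α m₀ Λ v p‖ := by
  refine lt_of_pow_lt_pow_left₀ 2 (norm_nonneg _) ?_
  have := h.le_norm_sq p
  have := pow_pos hm 2
  linarith

lemma meanFieldVector_eq (h : IsSelfConsistent α m₀ Λ v) (hm : 0 < m₀) (p : E3) :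
    meanFieldVector α m₀ Λ v p = ‖meanFieldVector α m₀ Λ v p‖ • v p := by
  conv_rhs => rw [h.eq_signField p, signField, smul_smul]
  have := (norm_nonneg p).trans_lt (h.norm_lt hm p)
  rw [mul_one_div_cancel this.ne', one_smul]

lemma slash_mul_self (h : IsSelfConsistent α m₀ Λ v) (hm : 0 < m₀) (p : E3) :
    slash (v p) * slash (v p) = 1 := by
  rw [BDF.slash_mul_self, h.norm_eq_one hm]
  simp

lemma norm_meanFieldVector_le (h : IsSelfConsistent α m₀ Λ v) (hm : 0 < m₀) (hΛ : 0 < Λ) :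
    ∃ C, ∀ p ∈ Metric.ball (0 : E3) Λ, ‖meanFieldVector α m₀ Λ v p‖ ≤ C := by
  refine ⟨Λ + |m₀| + |α / (4 * Real.pi ^ 2)| * ((Λ + Λ + 1) ^ 2 * Real.pi ^ 3), fun p hp => ?_⟩
  have hp : ‖p‖ < Λ := by simpa using hp
  rw [meanFieldVector]
  refine (norm_add_le _ _).trans (add_le_add ?_ ?_)
  · have h1 : (WithLp.toLp 2 (p, m₀) : CliffordVector) =
        WithLp.toLp 2 (p, 0) + WithLp.toLp 2 (0, m₀) := by
      rw [← WithLp.toLp_add]; simp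
    rw [h1]
    refine (norm_add_le _ _).trans ?_
    rw [WithLp.norm_toLp_fst, WithLp.norm_toLp_snd, Real.norm_eq_abs]
    linarith
  · rw [norm_smul, Real.norm_eq_abs]
    gcongr
    have h2 : ‖exchangePotential Λ v p‖ₑ ≤
        ENNReal.ofReal ((Λ + Λ + 1) ^ 2 * Real.pi ^ 3) := by
      refine (enorm_integral_le_lintegral_enorm _).trans ?_
      rw [ENNReal.ofReal_mul (by positivity)]
      refine le_trans ?_ ((lintegral_kernel_le hΛ p).trans (by gcongr))
      refine lintegral_mono fun q => ?_
      rw [enorm_smul, Real.enorm_of_nonneg (by positivity), ← ofReal_norm (v q),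
        h.norm_eq_one hm]
      simp
    rw [← ofReal_norm] at h2
    exact (ENNReal.ofReal_le_ofReal_iff (by positivity)).mp h2

/-- The energy gap above the free vacuum. The quadratic part of the energy is controlled by the
inequality `∬ h h / |p - q|² ≤ π³ ∫ |p| h²`, and `α π / 4 ≤ 1`. -/
lemma integral_le_energy_sub (h : IsSelfConsistent α m₀ Λ v) (hα₀ : 0 ≤ α) (hα : α ≤ 4 / Real.pi)
    (hm : 0 < m₀) (hΛ : 0 < Λ) {f : E3 → Mat4} (hf : f ∈ admissibleSymbols Λ) :
    Integrable (fun p => (‖meanFieldVector α m₀ Λ v p‖ - ‖p‖) *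
      ‖matVec (f p - vacuumSymbol v p)‖ ^ 2) (ballMeasure Λ) ∧
    1 / (2 * Real.pi) ^ 3 * ∫ p, (‖meanFieldVector α m₀ Λ v p‖ - ‖p‖) *
      ‖matVec (f p - vacuumSymbol v p)‖ ^ 2 ∂ballMeasure Λ ≤
    energyPerVolume α m₀ Λ f - energyPerVolume α m₀ Λ (vacuumSymbol v) := by
  have hf' := isBoundedSymbol_of_mem hf
  have hg' := isBoundedSymbol_of_mem (vacuumSymbol_mem (Λ := Λ) h.measurable (h.norm_eq_one hm))
  set g := vacuumSymbol v with hgdef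
  set G := meanFieldVector α m₀ Λ v with hG
  have hh := hf'.sub hg'
  set d : E3 → Mat4 := fun p => f p - g p with hd
  have hdm := aestronglyMeasurable_matVec hh.1
  obtain ⟨CG, hCG⟩ := h.norm_meanFieldVector_le hm hΛ
  have hGm : StronglyMeasurable G := stronglyMeasurable_meanFieldVector h.measurable
  have hball : ∀ᵐ p ∂ballMeasure Λ, p ∈ Metric.ball (0 : E3) Λ :=
    ae_restrict_mem Metric.isOpen_ball.measurableSet
  -- integrability of the terms that appear
  have hslash (i j : Fin 4) : StronglyMeasurable fun p => slash (G p) i j :=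
    (slashEntry i j).continuous.comp_stronglyMeasurable hGm
  have hdirac (i j : Fin 4) : AEStronglyMeasurable (fun p => diracSymbol m₀ p i j)
      (ballMeasure Λ) := by
    have : Continuous fun p : E3 => slashEntry i j (WithLp.toLp 2 (p, m₀)) := by fun_prop
    exact this.aestronglyMeasurable
  have hbd {x : E3 → CliffordVector} {B : ℝ} {k : E3 → Mat4} {K : ℝ} (hk : IsBoundedSymbol Λ k K)
      (hx : ∀ i j, AEStronglyMeasurable (fun p => slash (x p) i j) (ballMeasure Λ))
      (hxB : ∀ p ∈ Metric.ball (0 : E3) Λ, ‖x p‖ ≤ B) :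
      Integrable (fun p => (slash (x p) * k p).trace.re) (ballMeasure Λ) := by
    refine Integrable.of_bound (C := 2 * B * K) (aestronglyMeasurable_trace_mul hx hk.1) ?_
    filter_upwards [hball, hk.3] with p hp h2
    refine (abs_trace_mul_re_le _ _ (slash_isHermitian _)).trans ?_
    have h3 : ‖matVec (slash (x p))‖ = 2 * ‖x p‖ := by
      have : ‖matVec (slash (x p))‖ ^ 2 = (2 * ‖x p‖) ^ 2 := by
        rw [← trace_mul_self_re _ (slash_isHermitian _), BDF.slash_mul_self, Matrix.trace_smul,
          Matrix.trace_one, smul_eq_mul, re_ofReal_mul]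
        simp
        ring
      exact (pow_left_inj₀ (norm_nonneg _) (by positivity) two_ne_zero).mp this
    rw [h3]
    have h4 := hxB p hp
    have h5 := (norm_nonneg _).trans h4
    gcongr
  have hiD {k : E3 → Mat4} {K : ℝ} (hk : IsBoundedSymbol Λ k K) :
      Integrable (fun p => (diracSymbol m₀ p * k p).trace.re) (ballMeasure Λ) := by
    refine hbd (x := fun p => WithLp.toLp 2 (p, m₀)) (B := √(Λ ^ 2 + m₀ ^ 2)) hk hdirac ?_
    intro p hp
    have hp : ‖p‖ < Λ := by simpa using hp
    rw [WithLp.prod_norm_eq_of_L2]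
    refine Real.sqrt_le_sqrt ?_
    have h1 : ‖p‖ ^ 2 ≤ Λ ^ 2 := by gcongr
    simp only [Real.norm_eq_abs, sq_abs]
    exact add_le_add_left h1 (m₀ ^ 2)
  have hiG : Integrable (fun p => (slash (G p) * d p).trace.re) (ballMeasure Λ) :=
    hbd hh (fun i j => (hslash i j).aestronglyMeasurable) hCG
  have hi1 : Integrable (fun p => ‖G p‖ * ‖matVec (d p)‖ ^ 2) (ballMeasure Λ) := by
    refine Integrable.of_bound (C := CG * (1 + 1) ^ 2)
      (hGm.norm.aestronglyMeasurable.mul (hdm.norm.pow 2)) ?_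
    filter_upwards [hball, hh.3] with p h1 h2
    rw [Real.norm_of_nonneg (by positivity)]
    have := hCG p h1
    have := (norm_nonneg _).trans this
    gcongr
  have hi2 : Integrable (fun p => ‖p‖ * ‖matVec (d p)‖ ^ 2) (ballMeasure Λ) := by
    refine Integrable.of_bound (C := Λ * (1 + 1) ^ 2)
      (continuous_norm.aestronglyMeasurable.mul (hdm.norm.pow 2)) ?_
    filter_upwards [ae_ballMeasure_mem Λ, hh.3] with p h1 h2
    rw [Real.norm_of_nonneg (by positivity)]
    gcongr
  refine ⟨(hi1.sub hi2).congr (ae_of_all _ fun p => (sub_mul _ _ _).symm), ?_⟩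
  -- expansion of the energy around the vacuum
  have hB1 : exchangeForm Λ f f - exchangeForm Λ g g =
      2 * exchangeForm Λ d g + exchangeForm Λ d d := by
    have e1 := exchangeForm_sub_left hΛ hf' hg' hh
    have e2 := exchangeForm_sub_left hΛ hf' hg' hf'
    have e3 := exchangeForm_sub_left hΛ hf' hg' hg'
    rw [exchangeForm_comm (f := f) (g := d), exchangeForm_comm (f := g) (g := d)] at e1
    rw [exchangeForm_comm (f := g) (g := f)] at e2
    linarith
  have hT : energyPerVolume α m₀ Λ f - energyPerVolume α m₀ Λ g =
      1 / (2 * Real.pi) ^ 3 * (∫ p, (slash (G p) * d p).trace.re ∂ballMeasure Λ)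
        - α / (2 * Real.pi) ^ 5 * exchangeForm Λ d d := by
    have e1 : ∫ p, (diracSymbol m₀ p * d p).trace.re ∂ballMeasure Λ =
        ∫ p, (diracSymbol m₀ p * f p).trace.re ∂ballMeasure Λ -
        ∫ p, (diracSymbol m₀ p * g p).trace.re ∂ballMeasure Λ := by
      rw [← integral_sub (hiD hf') (hiD hg')]
      simp only [hd, mul_sub, Matrix.trace_sub, sub_re]
    set Φ : E3 → Mat4 := fun p => Matrix.of fun i j =>
      ∫ q, g q i j / ((‖p - q‖ ^ 2 : ℝ) : ℂ) ∂ballMeasure Λ with hΦ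
    have e2 : exchangeForm Λ d g = ∫ p, (d p * Φ p).trace.re ∂ballMeasure Λ :=
      exchangeForm_eq_integral hΛ hh hg'
    have e3 (p : E3) : (slash (G p) * d p).trace.re = (diracSymbol m₀ p * d p).trace.re -
        α / (2 * Real.pi ^ 2) * (d p * Φ p).trace.re := by
      rw [hG, ← meanFieldSymbol_vacuumSymbol hΛ h.measurable (h.norm_eq_one hm), meanFieldSymbol,
        sub_mul, Matrix.trace_sub, sub_re, smul_mul_assoc, Matrix.trace_smul, smul_eq_mul,
        re_ofReal_mul, Matrix.trace_mul_comm (d p)]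
    have e4 : α / (2 * Real.pi ^ 2) * exchangeForm Λ d g =
        ∫ p, (diracSymbol m₀ p * d p).trace.re ∂ballMeasure Λ -
        ∫ p, (slash (G p) * d p).trace.re ∂ballMeasure Λ := by
      rw [← integral_sub (hiD hh) hiG, e2, ← integral_const_mul]
      refine integral_congr_ae (ae_of_all _ fun p => ?_)
      simp only [e3]
      ring
    change 1 / (2 * Real.pi) ^ 3 * _ - α / (2 * Real.pi) ^ 5 * exchangeForm Λ f f -
      (1 / (2 * Real.pi) ^ 3 * _ - α / (2 * Real.pi) ^ 5 * exchangeForm Λ g g) = _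
    have e5 : α / (2 * Real.pi) ^ 5 * (2 * exchangeForm Λ d g) =
        1 / (2 * Real.pi) ^ 3 * (α / (2 * Real.pi ^ 2) * exchangeForm Λ d g) := by
      field_simp
    have e6 : exchangeForm Λ f f = exchangeForm Λ g g +
      (2 * exchangeForm Λ d g + exchangeForm Λ d d) := by linarith
    rw [e6, mul_add, mul_add, e5, e4, e1]
    ring
  rw [hT]
  -- the linear term dominates a quadratic one, since `v` is the sign of the mean-field operator
  have hlow : ∫ p, ‖G p‖ * ‖matVec (d p)‖ ^ 2 ∂ballMeasure Λ ≤
      ∫ p, (slash (G p) * d p).trace.re ∂ballMeasure Λ := by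
    refine integral_mono_ae hi1 hiG ?_
    filter_upwards [hf.2] with p hp
    have hp' := isHalfBounded_of_posSemidef hp.1 hp.2
    have := norm_matVec_sq_le_trace hp' (slash_isHermitian (v p)) (h.slash_mul_self hm p)
    rw [hG, h.meanFieldVector_eq hm p, slash_smul, smul_mul_assoc, Matrix.trace_smul, smul_eq_mul,
      re_ofReal_mul, ← h.meanFieldVector_eq hm p]
    exact mul_le_mul_of_nonneg_left this (norm_nonneg _)
  have hup := exchangeForm_self_le hΛ hh
  have hle : α / (2 * Real.pi) ^ 5 * exchangeForm Λ d d ≤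
      1 / (2 * Real.pi) ^ 3 * ∫ p, ‖p‖ * ‖matVec (d p)‖ ^ 2 ∂ballMeasure Λ := by
    have h0 : 0 ≤ ∫ p, ‖p‖ * ‖matVec (d p)‖ ^ 2 ∂ballMeasure Λ :=
      integral_nonneg fun p => by positivity
    calc _ ≤ α / (2 * Real.pi) ^ 5 *
          (Real.pi ^ 3 * ∫ p, ‖p‖ * ‖matVec (d p)‖ ^ 2 ∂ballMeasure Λ) := by
          gcongr
      _ = 1 / (2 * Real.pi) ^ 3 * ((α * Real.pi / 4) *
            ∫ p, ‖p‖ * ‖matVec (d p)‖ ^ 2 ∂ballMeasure Λ) := by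
          field_simp
          ring
      _ ≤ _ := by
          gcongr
          refine mul_le_of_le_one_left h0 ?_
          rw [le_div_iff₀ Real.pi_pos] at hα
          linarith
  have hsplit : ∫ p, (‖G p‖ - ‖p‖) * ‖matVec (d p)‖ ^ 2 ∂ballMeasure Λ =
      ∫ p, ‖G p‖ * ‖matVec (d p)‖ ^ 2 ∂ballMeasure Λ -
      ∫ p, ‖p‖ * ‖matVec (d p)‖ ^ 2 ∂ballMeasure Λ := by
    rw [← integral_sub hi1 hi2]
    simp only [sub_mul]
  change 1 / (2 * Real.pi) ^ 3 * ∫ p, (‖G p‖ - ‖p‖) * ‖matVec (d p)‖ ^ 2 ∂ballMeasure Λ ≤ _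
  rw [hsplit, mul_sub]
  have h9 : 1 / (2 * Real.pi) ^ 3 * ∫ p, ‖G p‖ * ‖matVec (d p)‖ ^ 2 ∂ballMeasure Λ ≤
      1 / (2 * Real.pi) ^ 3 * ∫ p, (slash (G p) * d p).trace.re ∂ballMeasure Λ := by gcongr
  linarith

lemma isFreeVacuum (h : IsSelfConsistent α m₀ Λ v) (hα₀ : 0 ≤ α) (hα : α ≤ 4 / Real.pi)
    (hm : 0 < m₀) (hΛ : 0 < Λ) : IsFreeVacuum α m₀ Λ (vacuumSymbol v) := by
  refine ⟨vacuumSymbol_mem h.measurable (h.norm_eq_one hm), fun g hg => ?_⟩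
  have h1 := (h.integral_le_energy_sub hα₀ hα hm hΛ hg).2
  have h2 : 0 ≤ ∫ p, (‖meanFieldVector α m₀ Λ v p‖ - ‖p‖) *
      ‖matVec (g p - vacuumSymbol v p)‖ ^ 2 ∂ballMeasure Λ :=
    integral_nonneg fun p => mul_nonneg (sub_nonneg.mpr (h.norm_lt hm p).le) (sq_nonneg _)
  have h3 : 0 ≤ 1 / (2 * Real.pi) ^ 3 * ∫ p, (‖meanFieldVector α m₀ Λ v p‖ - ‖p‖) *
      ‖matVec (g p - vacuumSymbol v p)‖ ^ 2 ∂ballMeasure Λ := by positivity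
  linarith

lemma ae_eq_of_isFreeVacuum (h : IsSelfConsistent α m₀ Λ v) (hα₀ : 0 ≤ α) (hα : α ≤ 4 / Real.pi)
    (hm : 0 < m₀) (hΛ : 0 < Λ) {f : E3 → Mat4} (hf : IsFreeVacuum α m₀ Λ f) :
    f =ᵐ[ballMeasure Λ] vacuumSymbol v := by
  obtain ⟨hi, h1⟩ := h.integral_le_energy_sub hα₀ hα hm hΛ hf.1
  have h2 := hf.2 _ (vacuumSymbol_mem h.measurable (h.norm_eq_one hm))
  have h0 : ∀ p, 0 ≤ (‖meanFieldVector α m₀ Λ v p‖ - ‖p‖) *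
      ‖matVec (f p - vacuumSymbol v p)‖ ^ 2 :=
    fun p => mul_nonneg (sub_nonneg.mpr (h.norm_lt hm p).le) (sq_nonneg _)
  have h3 : ∫ p, (‖meanFieldVector α m₀ Λ v p‖ - ‖p‖) *
      ‖matVec (f p - vacuumSymbol v p)‖ ^ 2 ∂ballMeasure Λ = 0 := by
    refine le_antisymm ?_ (integral_nonneg h0)
    by_contra hc
    have : 0 < 1 / (2 * Real.pi) ^ 3 * ∫ p, (‖meanFieldVector α m₀ Λ v p‖ - ‖p‖) *
      ‖matVec (f p - vacuumSymbol v p)‖ ^ 2 ∂ballMeasure Λ := mul_pos (by positivity) (not_le.mp hc)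
    linarith
  rw [integral_eq_zero_iff_of_nonneg h0 hi] at h3
  filter_upwards [h3] with p hp
  have h4 := h.norm_lt hm p
  rcases mul_eq_zero.mp hp with h5 | h5
  · linarith
  · have h6 : matVec (f p - vacuumSymbol v p) = 0 := by simpa using h5
    have h7 : ∀ i j, f p i j - vacuumSymbol v p i j = 0 := fun i j => by
      have := norm_entry_le (f p - vacuumSymbol v p) i j
      rw [h6, norm_zero] at this
      exact norm_le_zero_iff.mp this
    ext i j
    exact sub_eq_zero.mp (h7 i j)

end IsSelfConsistent

/-! ### Hilbert-Schmidt sums and compressions -/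

section Order

variable {A : Type*} [Ring A] [StarRing A] [PartialOrder A] [StarOrderedRing A]

lemma mul_self_le_self {X : A} (h0 : 0 ≤ X) (h1 : X ≤ 1) : X * X ≤ X := by
  have hX : IsSelfAdjoint X := IsSelfAdjoint.of_nonneg h0
  have h2 : 0 ≤ 1 - X := sub_nonneg.mpr h1
  have hY : IsSelfAdjoint (1 - X) := IsSelfAdjoint.of_nonneg h2
  have e : X - X * X = X * (1 - X) * X + (1 - X) * X * (1 - X) := by noncomm_ring
  rw [← sub_nonneg, e]
  exact add_nonneg (hX.conjugate_nonneg h2) (hY.conjugate_nonneg h0)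

/-- The compressions `Q⁺⁺ ≥ 0` and `Q⁻⁻ ≤ 0` of a difference `Q = X - P₋` with `0 ≤ X ≤ 1`. -/
lemma compression_nonneg {P Q : A} (hP : IsSelfAdjoint P) (hPP : P * P = P) (h1 : -P ≤ Q)
    (h2 : Q ≤ 1 - P) : 0 ≤ (1 - P) * Q * (1 - P) ∧ 0 ≤ -(P * Q * P) := by
  have h3 : 0 ≤ Q + P := by rwa [← sub_neg_eq_add, sub_nonneg]
  have h4 : 0 ≤ 1 - P - Q := sub_nonneg.mpr h2
  have hP1 : IsSelfAdjoint (1 - P) := (IsSelfAdjoint.one A).sub hP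
  have e1 : (1 - P) * Q * (1 - P) = (1 - P) * (Q + P) * (1 - P) := by
    simp only [mul_add, sub_mul, mul_sub, one_mul, mul_one, hPP, add_mul]
    noncomm_ring
  have e2 : -(P * Q * P) = P * (1 - P - Q) * P := by
    simp only [sub_mul, mul_sub, mul_one, hPP]
    noncomm_ring
  rw [e1, e2]
  exact ⟨hP1.conjugate_nonneg h3, hP.conjugate_nonneg h4⟩

/-- The inequality `Q² ≤ Q⁺⁺ - Q⁻⁻`, which is `X² ≤ X` for `X = Q + P₋`. -/
lemma mul_self_le_compression {P Q : A} (hPP : P * P = P) (h1 : -P ≤ Q)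
    (h2 : Q ≤ 1 - P) : Q * Q ≤ (1 - P) * Q * (1 - P) - P * Q * P := by
  have h3 : 0 ≤ Q + P := by rwa [← sub_neg_eq_add, sub_nonneg]
  have h4 : Q + P ≤ 1 := by rwa [← le_sub_iff_add_le]
  have h5 := sub_nonneg.mpr (mul_self_le_self h3 h4)
  have e : (1 - P) * Q * (1 - P) - P * Q * P - Q * Q = Q + P - (Q + P) * (Q + P) := by
    simp only [mul_add, add_mul, sub_mul, mul_sub, one_mul, mul_one, hPP]
    noncomm_ring
  rwa [← sub_nonneg, e]

end Order

section HilbertSchmidt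

variable {H : Type*} [NormedAddCommGroup H] [InnerProductSpace ℂ H] {ι κ : Type*}

lemma enorm_sq_eq_tsum (b : HilbertBasis ι ℂ H) (x : H) :
    ‖x‖ₑ ^ 2 = ∑' i, ‖inner ℂ (b i) x‖ₑ ^ 2 := by
  have h1 := b.hasSum_inner_mul_inner x x
  have h2 := Complex.hasSum_re h1
  have e1 : ∀ i, (inner ℂ x (b i) * inner ℂ (b i) x).re = ‖inner ℂ (b i) x‖ ^ 2 := fun i => by
    rw [← inner_conj_symm, ← Complex.normSq_eq_conj_mul_self, ofReal_re, Complex.normSq_eq_norm_sq]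
  have e2 : (inner ℂ x x : ℂ).re = ‖x‖ ^ 2 := inner_self_eq_norm_sq (𝕜 := ℂ) x
  simp_rw [e1] at h2
  rw [e2] at h2
  have e3 (y : ℂ) : ‖y‖ₑ ^ 2 = ENNReal.ofReal (‖y‖ ^ 2) := by
    rw [ENNReal.ofReal_pow (norm_nonneg _), ofReal_norm]
  simp_rw [e3]
  rw [← ENNReal.ofReal_tsum_of_nonneg (fun i => sq_nonneg _) h2.summable, h2.tsum_eq,
    ENNReal.ofReal_pow (norm_nonneg _), ofReal_norm]

lemma summable_norm_sq_iff {E : Type*} [NormedAddCommGroup E] (u : ι → E) :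
    Summable (fun i => ‖u i‖ ^ 2) ↔ ∑' i, ‖u i‖ₑ ^ 2 ≠ ⊤ := by
  have e (i : ι) : ‖u i‖ₑ ^ 2 = ENNReal.ofReal (‖u i‖ ^ 2) := by
    rw [ENNReal.ofReal_pow (norm_nonneg _), ofReal_norm]
  simp_rw [e]
  exact ⟨fun h => h.tsum_ofReal_ne_top, fun h => by
    have := ENNReal.summable_toReal h
    simpa [ENNReal.toReal_ofReal] using this⟩

lemma ofReal_tsum_norm_sq {E : Type*} [NormedAddCommGroup E] {u : ι → E}
    (h : Summable fun i => ‖u i‖ ^ 2) :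
    ENNReal.ofReal (∑' i, ‖u i‖ ^ 2) = ∑' i, ‖u i‖ₑ ^ 2 := by
  rw [ENNReal.ofReal_tsum_of_nonneg (fun i => sq_nonneg _) h]
  refine tsum_congr fun i => ?_
  rw [ENNReal.ofReal_pow (norm_nonneg _), ofReal_norm]

lemma summable_mul_left {b : HilbertBasis ι ℂ H} (C : H →L[ℂ] H) {T : H →L[ℂ] H}
    (h : Summable fun i => ‖T (b i)‖ ^ 2) : Summable fun i => ‖(C * T) (b i)‖ ^ 2 := by
  refine Summable.of_nonneg_of_le (fun _ => sq_nonneg _) (fun i => ?_) (h.mul_left (‖C‖ ^ 2))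
  rw [← mul_pow]
  gcongr
  exact C.le_opNorm _

lemma countable_of_hilbertBasis [SeparableSpace H] (b : HilbertBasis ι ℂ H) : Countable ι := by
  refine Pairwise.countable_of_isOpen_disjoint (s := fun i => Metric.ball (b i) (1 / 2)) ?_
    (fun _ => Metric.isOpen_ball) fun i => ⟨b i, Metric.mem_ball_self (by norm_num)⟩
  intro i j hij
  refine Metric.ball_disjoint_ball ?_
  have h1 := norm_sub_sq (𝕜 := ℂ) (b i) (b j)
  rw [b.orthonormal.2 hij, b.orthonormal.1, b.orthonormal.1] at h1
  rw [dist_eq_norm]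
  refine le_of_sq_le_sq ?_ (norm_nonneg _)
  rw [h1]
  norm_num

variable [CompleteSpace H]

lemma tsum_enorm_sq_adjoint (b : HilbertBasis ι ℂ H) (c : HilbertBasis κ ℂ H) (T : H →L[ℂ] H) :
    ∑' i, ‖T (b i)‖ₑ ^ 2 = ∑' j, ‖ContinuousLinearMap.adjoint T (c j)‖ₑ ^ 2 := by
  simp_rw [enorm_sq_eq_tsum c (T _), enorm_sq_eq_tsum b (ContinuousLinearMap.adjoint T _)]
  rw [ENNReal.tsum_comm]
  refine tsum_congr fun j => tsum_congr fun i => ?_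
  rw [ContinuousLinearMap.adjoint_inner_right, ← inner_conj_symm, ← ofReal_norm, ← ofReal_norm,
    RCLike.norm_conj]

lemma summable_adjoint {b : HilbertBasis ι ℂ H} {T : H →L[ℂ] H}
    (h : Summable fun i => ‖T (b i)‖ ^ 2) :
    Summable fun i => ‖(star T) (b i)‖ ^ 2 := by
  rw [summable_norm_sq_iff, tsum_enorm_sq_adjoint b b] at h
  rw [summable_norm_sq_iff]
  exact h

lemma tsum_norm_sq_adjoint {b : HilbertBasis ι ℂ H} {T : H →L[ℂ] H}
    (h : Summable fun i => ‖T (b i)‖ ^ 2) :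
    ∑' i, ‖(star T) (b i)‖ ^ 2 = ∑' i, ‖T (b i)‖ ^ 2 := by
  rw [← ENNReal.ofReal_eq_ofReal_iff (tsum_nonneg fun _ => sq_nonneg _)
    (tsum_nonneg fun _ => sq_nonneg _), ofReal_tsum_norm_sq h,
    ofReal_tsum_norm_sq (summable_adjoint h), tsum_enorm_sq_adjoint b b T]
  rfl

lemma summable_mul_right {b : HilbertBasis ι ℂ H} (C : H →L[ℂ] H) {T : H →L[ℂ] H}
    (h : Summable fun i => ‖T (b i)‖ ^ 2) : Summable fun i => ‖(T * C) (b i)‖ ^ 2 := by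
  have := summable_adjoint (summable_mul_left (star C) (summable_adjoint h))
  simpa only [star_mul, star_star] using this

lemma inner_apply_of_isSelfAdjoint {T : H →L[ℂ] H} (hT : IsSelfAdjoint T) (x y : H) :
    inner ℂ (T x) y = inner ℂ x (T y) := by
  have := ContinuousLinearMap.adjoint_inner_left T y x
  rwa [hT.adjoint_eq] at this

/-- Cyclicity of the trace, for the product of the two Hilbert-Schmidt operators `S R` and `R`. It
follows by polarization from the equality of the Hilbert-Schmidt norms of an operator and of its
adjoint. -/
lemma tsum_re_inner_cyclic {b : HilbertBasis ι ℂ H} {R S : H →L[ℂ] H} (hR : IsSelfAdjoint R)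
    (hS : IsSelfAdjoint S) (h : Summable fun i => ‖R (b i)‖ ^ 2) :
    Summable (fun i => (inner ℂ (R (S (b i))) (R (b i)) : ℂ).re) ∧
    ∑' i, (inner ℂ (R (S (b i))) (R (b i)) : ℂ).re =
      ∑' i, (inner ℂ (S (R (b i))) (R (b i)) : ℂ).re := by
  have pol (x y : H) : (inner ℂ x y : ℂ).re = 1 / 4 * ‖x + y‖ ^ 2 - 1 / 4 * ‖x - y‖ ^ 2 := by
    have h1 := norm_add_sq (𝕜 := ℂ) x y
    have h2 := norm_sub_sq (𝕜 := ℂ) x y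
    simp only [RCLike.re_to_complex] at h1 h2
    linarith
  have e1 (i : ι) : (inner ℂ (R (S (b i))) (R (b i)) : ℂ).re =
      1 / 4 * ‖(R * (S + 1)) (b i)‖ ^ 2 - 1 / 4 * ‖(R * (S - 1)) (b i)‖ ^ 2 := by
    rw [pol]
    simp
  have e2 (i : ι) : (inner ℂ (S (R (b i))) (R (b i)) : ℂ).re =
      1 / 4 * ‖((S + 1) * R) (b i)‖ ^ 2 - 1 / 4 * ‖((S - 1) * R) (b i)‖ ^ 2 := by
    rw [pol]
    simp
  have s1 := summable_mul_right (S + 1) h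
  have s2 := summable_mul_right (S - 1) h
  have s3 := summable_mul_left (S + 1) h
  have s4 := summable_mul_left (S - 1) h
  have a1 : star (R * (S + 1)) = (S + 1) * R := by
    rw [star_mul, hR.star_eq, star_add, hS.star_eq, star_one]
  have a2 : star (R * (S - 1)) = (S - 1) * R := by
    rw [star_mul, hR.star_eq, star_sub, hS.star_eq, star_one]
  have t1 := tsum_norm_sq_adjoint s1
  have t2 := tsum_norm_sq_adjoint s2
  rw [a1] at t1
  rw [a2] at t2
  simp_rw [e1, e2]
  refine ⟨(s1.mul_left _).sub (s2.mul_left _), ?_⟩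
  rw [(s1.mul_left _).tsum_sub (s2.mul_left _), (s3.mul_left _).tsum_sub (s4.mul_left _),
    tsum_mul_left, tsum_mul_left, tsum_mul_left, tsum_mul_left, t1, t2]

lemma abs_eq_of_nonneg {T : H →L[ℂ] H} (hT : 0 ≤ T) : CFC.abs T = T :=
  CFC.abs_of_nonneg T hT

lemma abs_eq_neg_of_nonneg_neg {T : H →L[ℂ] H} (hT : 0 ≤ -T) : CFC.abs T = -T := by
  rw [← CFC.abs_neg T, CFC.abs_of_nonneg (-T) hT]

/-- If `A ≥ Q²` is trace class, then `tr(s² A) = tr(s A s) ≥ tr(s Q² s)`. The trace of `s² A` is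
taken in a fixed basis, so the first equality is the cyclicity of the trace for `A = √A √A`. -/
lemma tsum_norm_sq_le_trace (b : HilbertBasis ι ℂ H) {A Q s : H →L[ℂ] H} (hA : 0 ≤ A)
    (hs : IsSelfAdjoint s) (hQ : IsSelfAdjoint Q) (hQA : Q * Q ≤ A)
    (h : Summable fun i => (inner ℂ (b i) (A (b i)) : ℂ).re) :
    Summable (fun i => ‖(Q * s) (b i)‖ ^ 2) ∧
    ∑' i, ‖(Q * s) (b i)‖ ^ 2 ≤ (∑' i, inner ℂ (b i) ((s * s * A) (b i))).re := by
  set R := CFC.sqrt A with hRdef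
  have hR : IsSelfAdjoint R := IsSelfAdjoint.of_nonneg (CFC.sqrt_nonneg A)
  have hRR : R * R = A := CFC.sqrt_mul_sqrt_self A hA
  have hRn (x : H) : (inner ℂ x (A x) : ℂ).re = ‖R x‖ ^ 2 := by
    rw [← hRR, mul_apply_eq_comp, ← inner_apply_of_isSelfAdjoint hR]
    exact inner_self_eq_norm_sq (𝕜 := ℂ) _
  have hS : IsSelfAdjoint (s * s) := by
    rw [IsSelfAdjoint, star_mul, hs.star_eq]
  simp_rw [hRn] at h
  obtain ⟨c1, c2⟩ := tsum_re_inner_cyclic hR hS h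
  have e1 (i : ι) : (inner ℂ (b i) ((s * s * A) (b i)) : ℂ) =
      inner ℂ (R ((s * s) (b i))) (R (b i)) := by
    rw [inner_apply_of_isSelfAdjoint hR, inner_apply_of_isSelfAdjoint hS, ← hRR]
    rfl
  have hsum : Summable fun i => (inner ℂ (b i) ((s * s * A) (b i)) : ℂ) := by
    have := (summable_mul_right (s * s) h).add h
    refine Summable.of_norm_bounded this fun i => ?_
    rw [e1]
    refine (norm_inner_le_norm _ _).trans ?_
    have h1 := two_mul_le_add_sq ‖R ((s * s) (b i))‖ ‖R (b i)‖
    have h2 : 0 ≤ ‖R ((s * s) (b i))‖ * ‖R (b i)‖ := by positivity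
    change _ ≤ ‖R ((s * s) (b i))‖ ^ 2 + ‖R (b i)‖ ^ 2
    linarith
  have e2 (i : ι) : (inner ℂ ((s * s) (R (b i))) (R (b i)) : ℂ).re = ‖(s * R) (b i)‖ ^ 2 := by
    rw [mul_apply_eq_comp, inner_apply_of_isSelfAdjoint hs]
    exact inner_self_eq_norm_sq (𝕜 := ℂ) _
  have e3 : (∑' i, inner ℂ (b i) ((s * s * A) (b i))).re = ∑' i, ‖(R * s) (b i)‖ ^ 2 := by
    rw [Complex.re_tsum hsum]
    simp_rw [e1]
    rw [c2]
    simp_rw [e2]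
    rw [← tsum_norm_sq_adjoint (summable_mul_right s h), star_mul, hR.star_eq, hs.star_eq]
  have hle (i : ι) : ‖(Q * s) (b i)‖ ^ 2 ≤ ‖(R * s) (b i)‖ ^ 2 := by
    have h1 := (ContinuousLinearMap.le_def _ _).mp hQA
    have h2 := h1.re_inner_nonneg_right (s (b i))
    rw [sub_apply, inner_sub_right, map_sub, sub_nonneg] at h2
    have h3 : (inner ℂ (s (b i)) ((Q * Q) (s (b i))) : ℂ).re = ‖(Q * s) (b i)‖ ^ 2 := by
      rw [mul_apply_eq_comp, ← inner_apply_of_isSelfAdjoint hQ]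
      exact inner_self_eq_norm_sq (𝕜 := ℂ) _
    calc _ = _ := h3.symm
      _ ≤ _ := h2
      _ = _ := hRn _
  have hs1 := summable_mul_right s h
  have hs2 : Summable fun i => ‖(Q * s) (b i)‖ ^ 2 :=
    Summable.of_nonneg_of_le (fun _ => sq_nonneg _) hle hs1
  exact ⟨hs2, e3 ▸ hs2.tsum_le_tsum hle hs1⟩

end HilbertSchmidt

/-! ### Multiplication operators -/

lemma norm_toEuclideanLin_le (A : Mat4) (x : Spinor) :
    ‖Matrix.toEuclideanLin A x‖ ≤ ‖matVec A‖ * ‖x‖ := by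
  refine le_of_sq_le_sq ?_ (by positivity)
  rw [mul_pow, norm_matVec_sq, EuclideanSpace.norm_sq_eq, Finset.sum_mul]
  refine Finset.sum_le_sum fun a _ => ?_
  have e : Matrix.toEuclideanLin A x a =
      inner ℂ (WithLp.toLp 2 (fun c => conj (A a c)) : Spinor) x := by
    rw [PiLp.inner_apply]
    simp [Matrix.toLpLin_apply, Matrix.mulVec, dotProduct, mul_comm]
  rw [e]
  have h := norm_inner_le_norm (𝕜 := ℂ) (WithLp.toLp 2 (fun c => conj (A a c)) : Spinor) x
  have h2 := pow_le_pow_left₀ (norm_nonneg _) h 2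
  rw [mul_pow, EuclideanSpace.norm_sq_eq] at h2
  simpa using h2

lemma toEuclideanLin_apply_entry (A : Mat4) (x : Spinor) (a : Fin 4) :
    Matrix.toEuclideanLin A x a = ∑ c, A a c * x c := by
  simp [Matrix.toLpLin_apply, Matrix.mulVec, dotProduct]

lemma aestronglyMeasurable_toEuclideanLin {X : Type*} [MeasurableSpace X] {μ : Measure X}
    {m : X → Mat4} {ψ : X → Spinor} (hm : ∀ i j, AEStronglyMeasurable (fun p => m p i j) μ)
    (hψ : AEStronglyMeasurable ψ μ) :
    AEStronglyMeasurable (fun p => Matrix.toEuclideanLin (m p) (ψ p)) μ := by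
  have hc (c : Fin 4) : AEStronglyMeasurable (fun p => ψ p c) μ :=
    (EuclideanSpace.proj c : Spinor →L[ℂ] ℂ).continuous.comp_aestronglyMeasurable hψ
  have h (a : Fin 4) : AEMeasurable (fun p => ∑ c, m p a c * ψ p c) μ :=
    (Finset.aestronglyMeasurable_fun_sum _ fun c _ => (hm a c).mul (hc c)).aemeasurable
  have h2 : AEStronglyMeasurable (fun p (a : Fin 4) => ∑ c, m p a c * ψ p c) μ :=
    (aemeasurable_pi_lambda _ h).aestronglyMeasurable
  refine ((PiLp.continuous_toLp 2 _).comp_aestronglyMeasurable h2).congr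
    (ae_of_all _ fun p => ?_)
  ext a
  simp [toEuclideanLin_apply_entry]

section Multiplier

variable {Λ : ℝ} {m m' : E3 → Mat4} {T T' : Space Λ →L[ℂ] Space Λ}

theorem exists_isMultiplier {C : ℝ}
    (hm : ∀ i j, AEStronglyMeasurable (fun p => m p i j) (ballMeasure Λ))
    (hC : ∀ᵐ p ∂ballMeasure Λ, ‖matVec (m p)‖ ≤ C) :
    ∃ T : Space Λ →L[ℂ] Space Λ, IsMultiplier m T := by
  have hb (ψ : Space Λ) : ∀ᵐ p ∂ballMeasure Λ,
      ‖Matrix.toEuclideanLin (m p) (ψ p)‖ ≤ C * ‖ψ p‖ := by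
    filter_upwards [hC] with p hp
    exact (norm_toEuclideanLin_le _ _).trans (by gcongr)
  have hmem (ψ : Space Λ) : MemLp (fun p => Matrix.toEuclideanLin (m p) (ψ p)) 2
      (ballMeasure Λ) :=
    (Lp.memLp ψ).of_le_mul (aestronglyMeasurable_toEuclideanLin hm (Lp.aestronglyMeasurable ψ))
      (hb ψ)
  let L : Space Λ →ₗ[ℂ] Space Λ :=
    { toFun := fun ψ => (hmem ψ).toLp _
      map_add' := fun ψ φ => by
        rw [← MemLp.toLp_add]
        refine MemLp.toLp_congr _ _ ?_
        filter_upwards [Lp.coeFn_add ψ φ] with p hp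
        rw [hp, Pi.add_apply, map_add]
        rfl
      map_smul' := fun c ψ => by
        rw [RingHom.id_apply, ← MemLp.toLp_const_smul]
        refine MemLp.toLp_congr _ _ ?_
        filter_upwards [Lp.coeFn_smul c ψ] with p hp
        simp [hp] }
  refine ⟨L.mkContinuous C fun ψ => ?_, fun ψ => (hmem ψ).coeFn_toLp⟩
  refine Lp.norm_le_mul_norm_of_ae_le_mul ?_
  filter_upwards [(hmem ψ).coeFn_toLp, hb ψ] with p h1 h2
  change ‖((hmem ψ).toLp _ : E3 → Spinor) p‖ ≤ _
  rw [h1]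
  exact h2

lemma IsMultiplier.congr (h : IsMultiplier m T) (hm : m =ᵐ[ballMeasure Λ] m') :
    IsMultiplier m' T := fun ψ => by
  filter_upwards [h ψ, hm] with p h1 h2
  rw [h1, h2]

lemma IsMultiplier.unique (h : IsMultiplier m T) (h' : IsMultiplier m T') : T = T' := by
  ext1 ψ
  exact Lp.ext ((h ψ).trans (h' ψ).symm)

lemma IsMultiplier.multiplier_eq (h : IsMultiplier m T) : multiplier Λ m = T := by
  have hex : ∃ T : Space Λ →L[ℂ] Space Λ, IsMultiplier m T := ⟨T, h⟩
  rw [multiplier, dif_pos hex]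
  exact hex.choose_spec.unique h

lemma IsMultiplier.mul (h : IsMultiplier m T) (h' : IsMultiplier m' T') :
    IsMultiplier (fun p => m p * m' p) (T * T') := fun ψ => by
  filter_upwards [h (T' ψ), h' ψ] with p h1 h2
  rw [mul_apply_eq_comp, h1, h2, Matrix.toLpLin_mul_same]
  rfl

lemma IsMultiplier.smul (c : ℂ) (h : IsMultiplier m T) :
    IsMultiplier (fun p => c • m p) (c • T) := fun ψ => by
  filter_upwards [h ψ, Lp.coeFn_smul c (T ψ)] with p h1 h2
  rw [smul_apply, h2, Pi.smul_apply, h1, map_smul]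
  rfl

lemma isMultiplier_one : IsMultiplier (fun _ => 1) (1 : Space Λ →L[ℂ] Space Λ) := fun ψ => by
  refine ae_of_all _ fun p => ?_
  simp

lemma IsMultiplier.isSelfAdjoint (h : IsMultiplier m T)
    (hm : ∀ᵐ p ∂ballMeasure Λ, (m p).IsHermitian) : IsSelfAdjoint T := by
  rw [ContinuousLinearMap.isSelfAdjoint_iff_isSymmetric]
  intro ψ φ
  change inner ℂ (T ψ) φ = inner ℂ ψ (T φ)
  rw [L2.inner_def, L2.inner_def]
  refine integral_congr_ae ?_
  filter_upwards [h ψ, h φ, hm] with p h1 h2 h3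
  rw [h1, h2]
  exact Matrix.isSymmetric_toEuclideanLin_iff.mpr h3 _ _

end Multiplier

/-! ### The kinetic energy and the kernel of an operator -/

section Vacuum

variable {α m₀ Λ : ℝ} {v : E3 → CliffordVector} {f : E3 → Mat4}

lemma meanFieldSymbol_congr {g : E3 → Mat4} (h : f =ᵐ[ballMeasure Λ] g) (p : E3) :
    meanFieldSymbol α m₀ Λ f p = meanFieldSymbol α m₀ Λ g p := by
  have e (i j : Fin 4) : ∫ q, f q i j / ((‖p - q‖ ^ 2 : ℝ) : ℂ) ∂ballMeasure Λ =
      ∫ q, g q i j / ((‖p - q‖ ^ 2 : ℝ) : ℂ) ∂ballMeasure Λ := by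
    refine integral_congr_ae ?_
    filter_upwards [h] with q hq
    rw [hq]
  simp only [meanFieldSymbol, e]

/-- The operators `P₋`, `|𝒟⁰|^{1/2}` and `𝒟⁰` attached to a self-consistent vacuum, and the
identity `(𝒟⁰Q)⁺⁺ + (𝒟⁰Q)⁻⁻ = |𝒟⁰| (Q⁺⁺ - Q⁻⁻)`. -/
lemma IsSelfConsistent.exists_sqrt (h : IsSelfConsistent α m₀ Λ v) (hm : 0 < m₀) (hΛ : 0 < Λ)
    (hf : f =ᵐ[ballMeasure Λ] vacuumSymbol v) :
    IsSelfAdjoint (projMinus Λ f) ∧ projMinus Λ f * projMinus Λ f = projMinus Λ f ∧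
    ∃ s : Space Λ →L[ℂ] Space Λ, IsSelfAdjoint s ∧
      IsMultiplier (fun p => ((√‖meanFieldVector α m₀ Λ v p‖ : ℝ) : ℂ) • 1) s ∧
      ∀ Q, projPlus Λ f * (meanField α m₀ Λ f * Q) * projPlus Λ f +
          projMinus Λ f * (meanField α m₀ Λ f * Q) * projMinus Λ f =
        s * s * ((1 - projMinus Λ f) * Q * (1 - projMinus Λ f) -
          projMinus Λ f * Q * projMinus Λ f) := by
  set G := meanFieldVector α m₀ Λ v with hG
  have hGm : StronglyMeasurable G := stronglyMeasurable_meanFieldVector h.measurable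
  obtain ⟨CG, hCG⟩ := h.norm_meanFieldVector_le hm hΛ
  have hball : ∀ᵐ p ∂ballMeasure Λ, p ∈ Metric.ball (0 : E3) Λ :=
    ae_restrict_mem Metric.isOpen_ball.measurableSet
  have hU2 := h.slash_mul_self hm
  obtain ⟨U, hU⟩ : ∃ U : Space Λ →L[ℂ] Space Λ, IsMultiplier (fun p => slash (v p)) U := by
    refine exists_isMultiplier (C := 2) (fun i j =>
      ((slashEntry i j).continuous.comp_stronglyMeasurable h.measurable).aestronglyMeasurable)
      (ae_of_all _ fun p => ?_)
    refine le_of_sq_le_sq ?_ (by norm_num)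
    rw [← trace_mul_self_re _ (slash_isHermitian _), hU2, Matrix.trace_one]
    norm_num
  obtain ⟨s, hs⟩ : ∃ s : Space Λ →L[ℂ] Space Λ,
      IsMultiplier (fun p => ((√‖G p‖ : ℝ) : ℂ) • (1 : Mat4)) s := by
    refine exists_isMultiplier (C := 2 * √CG) (fun i j => ?_) ?_
    · have : Measurable fun p => ((√‖G p‖ : ℝ) : ℂ) := by
        have := hGm.measurable
        fun_prop
      exact (this.mul_const _).aestronglyMeasurable
    · filter_upwards [hball] with p hp
      have e : ‖matVec (((√‖G p‖ : ℝ) : ℂ) • (1 : Mat4))‖ = √‖G p‖ * ‖matVec (1 : Mat4)‖ := by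
        have : matVec (((√‖G p‖ : ℝ) : ℂ) • (1 : Mat4)) = ((√‖G p‖ : ℝ) : ℂ) • matVec 1 := rfl
        rw [this, norm_smul, norm_real, Real.norm_of_nonneg (Real.sqrt_nonneg _)]
      have e2 : ‖matVec (1 : Mat4)‖ = 2 := by
        refine (pow_left_inj₀ (norm_nonneg _) (by norm_num) two_ne_zero).mp ?_
        rw [← trace_mul_self_re _ Matrix.isHermitian_one, one_mul, Matrix.trace_one]
        norm_num
      rw [e, e2, mul_comm]
      gcongr
      exact hCG p hp
  have hUs : IsSelfAdjoint U := hU.isSelfAdjoint (ae_of_all _ fun p => slash_isHermitian _)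
  have hss : IsSelfAdjoint s := hs.isSelfAdjoint (ae_of_all _ fun p => by
    rw [Matrix.IsHermitian, Matrix.conjTranspose_smul, Matrix.conjTranspose_one]
    simp)
  have hUU : U * U = 1 := by
    refine (hU.mul hU).unique (isMultiplier_one.congr (ae_of_all _ fun p => ?_))
    exact (hU2 p).symm
  have hcomm : s * U = U * s := by
    refine (hs.mul hU).unique ((hU.mul hs).congr (ae_of_all _ fun p => ?_))
    simp
  have hM : meanField α m₀ Λ f = s * s * U := by
    refine IsMultiplier.multiplier_eq (((hs.mul hs).mul hU).congr (ae_of_all _ fun p => ?_))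
    change ((√‖G p‖ : ℝ) : ℂ) • (1 : Mat4) * ((√‖G p‖ : ℝ) : ℂ) • (1 : Mat4) * slash (v p) = _
    rw [meanFieldSymbol_congr hf, meanFieldSymbol_vacuumSymbol hΛ h.measurable (h.norm_eq_one hm),
      h.meanFieldVector_eq hm, slash_smul, smul_mul_smul_comm, one_mul, smul_mul_assoc, one_mul,
      ← ofReal_mul, Real.mul_self_sqrt (norm_nonneg _)]
  have hP : projMinus Λ f = (1 / 2 : ℂ) • (1 - U) := by
    have : multiplier Λ f = (-(1 / 2) : ℂ) • U := by
      refine IsMultiplier.multiplier_eq ((hU.smul (-(1 / 2))).congr ?_)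
      filter_upwards [hf] with p hp
      rw [hp, vacuumSymbol]
    rw [projMinus, this, smul_sub, neg_smul]
    abel
  have hPs : IsSelfAdjoint (projMinus Λ f) := by
    rw [hP]
    refine IsSelfAdjoint.smul ?_ ((IsSelfAdjoint.one _).sub hUs)
    rw [IsSelfAdjoint]
    simp
  have hPP : projMinus Λ f * projMinus Λ f = projMinus Λ f := by
    rw [hP, smul_mul_smul_comm]
    have : (1 - U) * (1 - U) = (2 : ℂ) • (1 - U) := by
      simp only [sub_mul, mul_sub, one_mul, mul_one, hUU, two_smul]
      abel
    rw [this, smul_smul]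
    norm_num
  have hUP : U * projMinus Λ f = -projMinus Λ f := by
    rw [hP, mul_smul_comm, mul_sub, mul_one, hUU, ← smul_neg, neg_sub]
  have hPU : projMinus Λ f * U = -projMinus Λ f := by
    rw [hP, smul_mul_assoc, sub_mul, one_mul, hUU, ← smul_neg, neg_sub]
  have hsP : s * projMinus Λ f = projMinus Λ f * s := by
    rw [hP, mul_smul_comm, smul_mul_assoc, mul_sub, sub_mul, hcomm, mul_one, one_mul]
  refine ⟨hPs, hPP, s, hss, hs, fun Q => ?_⟩
  rw [projPlus, hM]
  set P := projMinus Λ f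
  have e1 : P * (s * s * U) = -(s * s * P) := by
    rw [← mul_assoc, ← mul_assoc, ← hsP, mul_assoc s P s, ← hsP, ← mul_assoc, mul_assoc, hPU,
      mul_neg]
  have e2 : (1 - P) * (s * s * U) = s * s * (1 - P) := by
    have : U = 1 - (2 : ℂ) • P := by
      rw [hP, smul_smul]; norm_num
    rw [sub_mul, e1, one_mul, this, two_smul]
    noncomm_ring
  rw [← mul_assoc (1 - P), e2, ← mul_assoc P, e1]
  noncomm_ring

/-- The kinetic energy is bounded below by the square of the Hilbert-Schmidt norm of
`Q |𝒟⁰|^{1/2}`. -/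
lemma tsum_norm_sq_le_vacuumTrace {M s Q : Space Λ →L[ℂ] Space Λ}
    (hPs : IsSelfAdjoint (projMinus Λ f)) (hPP : projMinus Λ f * projMinus Λ f = projMinus Λ f)
    (hs : IsSelfAdjoint s)
    (hM : projPlus Λ f * (M * Q) * projPlus Λ f + projMinus Λ f * (M * Q) * projMinus Λ f =
        s * s * ((1 - projMinus Λ f) * Q * (1 - projMinus Λ f) -
          projMinus Λ f * Q * projMinus Λ f))
    (hQ : IsVacuumTraceClass Λ f Q) (h1 : -projMinus Λ f ≤ Q) (h2 : Q ≤ projPlus Λ f) :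
    ∃ (w : Set (Space Λ)) (b : HilbertBasis w ℂ (Space Λ)),
      Summable (fun i => ‖(Q * s) (b i)‖ ^ 2) ∧
      ∑' i, ‖(Q * s) (b i)‖ ^ 2 ≤ (vacuumTrace Λ f (M * Q)).re := by
  refine ⟨_, (exists_hilbertBasis ℂ (Space Λ)).choose_spec.choose, ?_⟩
  set b := (exists_hilbertBasis ℂ (Space Λ)).choose_spec.choose
  set P := projMinus Λ f with hP
  rw [projPlus, ← hP] at h2
  obtain ⟨hpp, hmm⟩ := compression_nonneg hPs hPP h1 h2
  have hA : 0 ≤ (1 - P) * Q * (1 - P) - P * Q * P := by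
    rw [sub_eq_add_neg]
    exact add_nonneg hpp hmm
  have hQs : IsSelfAdjoint Q := by
    have h3 : IsSelfAdjoint (Q - -P) := IsSelfAdjoint.of_nonneg (sub_nonneg.mpr h1)
    have h4 := h3.add hPs.neg
    simpa using h4
  have hsum : Summable fun i =>
      (inner ℂ (b i) (((1 - P) * Q * (1 - P) - P * Q * P) (b i)) : ℂ).re := by
    have t1 := hQ.2.1 _ b
    have t2 := hQ.2.2 _ b
    rw [projPlus, ← hP, abs_eq_of_nonneg hpp] at t1
    rw [← hP, abs_eq_neg_of_nonneg_neg hmm] at t2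
    refine (t1.add t2).congr fun i => ?_
    rw [← add_re, ← inner_add_right, ← add_apply, ← sub_eq_add_neg]
  have := tsum_norm_sq_le_trace b hA hs hQs (mul_self_le_compression hPP h1 h2) hsum
  rwa [vacuumTrace, opTrace, hM]

end Vacuum

section Kernel

variable {Λ : ℝ}

lemma enorm_sq_Lp {X E : Type*} [MeasurableSpace X] {μ : Measure X} [NormedAddCommGroup E]
    (ψ : Lp E 2 μ) : ‖ψ‖ₑ ^ 2 = ∫⁻ p, ‖ψ p‖ₑ ^ 2 ∂μ := by
  rw [Lp.enorm_def, eLpNorm_eq_lintegral_rpow_enorm_toReal two_ne_zero ENNReal.ofNat_ne_top,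
    ← ENNReal.rpow_natCast, ← ENNReal.rpow_mul]
  simp

lemma enorm_sq_spinor (x : Spinor) : ‖x‖ₑ ^ 2 = ∑ a, ‖x a‖ₑ ^ 2 := by
  have e {F : Type} [NormedAddCommGroup F] (y : F) : ‖y‖ₑ ^ 2 = ENNReal.ofReal (‖y‖ ^ 2) := by
    rw [ENNReal.ofReal_pow (norm_nonneg _), ofReal_norm]
  simp_rw [e]
  rw [← ENNReal.ofReal_sum_of_nonneg fun _ _ => sq_nonneg _, EuclideanSpace.norm_sq_eq]

lemma enorm_sq_matVec (A : Mat4) : ‖matVec A‖ₑ ^ 2 = ∑ i, ∑ j, ‖A i j‖ₑ ^ 2 := by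
  have e {F : Type} [NormedAddCommGroup F] (y : F) : ‖y‖ₑ ^ 2 = ENNReal.ofReal (‖y‖ ^ 2) := by
    rw [ENNReal.ofReal_pow (norm_nonneg _), ofReal_norm]
  simp_rw [e]
  rw [norm_matVec_sq, ENNReal.ofReal_sum_of_nonneg fun _ _ => by positivity]
  refine Finset.sum_congr rfl fun i _ => ?_
  rw [ENNReal.ofReal_sum_of_nonneg fun _ _ => by positivity]

lemma lintegral_enorm_sq_lt_top {X E : Type*} [MeasurableSpace X] {μ : Measure X}
    [NormedAddCommGroup E] {u : X → E} (hu : MemLp u 2 μ) : ∫⁻ x, ‖u x‖ₑ ^ 2 ∂μ < ⊤ := by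
  have := hu.eLpNorm_lt_top
  rw [eLpNorm_eq_lintegral_rpow_enorm_toReal two_ne_zero ENNReal.ofNat_ne_top] at this
  simpa [ENNReal.rpow_lt_top_iff_of_pos] using this

lemma memLp_two_of_lintegral {X E : Type*} [MeasurableSpace X] {μ : Measure X}
    [NormedAddCommGroup E] {u : X → E} (hu : AEStronglyMeasurable u μ)
    (h : ∫⁻ x, ‖u x‖ₑ ^ 2 ∂μ < ⊤) : MemLp u 2 μ := by
  refine ⟨hu, ?_⟩
  rw [eLpNorm_eq_lintegral_rpow_enorm_toReal two_ne_zero ENNReal.ofNat_ne_top]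
  simpa [ENNReal.rpow_lt_top_iff_of_pos] using h

/-- A square-integrable family of matrices has square-integrable rows: `K(p, ·) ∈ L²` for almost
every `p`. -/
lemma ae_memLp_matVec {K : E3 → E3 → Mat4} (hK : ∀ i j, MemLp
      (fun z : E3 × E3 => K z.1 z.2 i j) 2 ((ballMeasure Λ).prod (ballMeasure Λ))) :
    ∀ᵐ p ∂ballMeasure Λ, MemLp (fun q => matVec (K p q)) 2 (ballMeasure Λ) := by
  have hm : AEStronglyMeasurable (fun z : E3 × E3 => matVec (K z.1 z.2))
      ((ballMeasure Λ).prod (ballMeasure Λ)) := aestronglyMeasurable_matVec fun i j => (hK i j).1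
  have hfin : ∫⁻ p, ∫⁻ q, ‖matVec (K p q)‖ₑ ^ 2 ∂ballMeasure Λ ∂ballMeasure Λ ≠ ⊤ := by
    rw [lintegral_lintegral (hm.enorm.pow_const 2)]
    simp_rw [enorm_sq_matVec]
    rw [lintegral_finsetSum' _ fun i _ => Finset.aemeasurable_fun_sum _ fun j _ =>
      (hK i j).1.enorm.pow_const 2]
    refine ENNReal.sum_ne_top.mpr fun i _ => ?_
    rw [lintegral_finsetSum' _ fun j _ => (hK i j).1.enorm.pow_const 2]
    exact ENNReal.sum_ne_top.mpr fun j _ => (lintegral_enorm_sq_lt_top (hK i j)).ne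
  have hm2 : AEMeasurable (fun p => ∫⁻ q, ‖matVec (K p q)‖ₑ ^ 2 ∂ballMeasure Λ) (ballMeasure Λ) :=
    (hm.enorm.pow_const 2).lintegral_prod_right'
  filter_upwards [ae_lt_top' hm2 hfin, hm.prodMk_left] with p h1 h2
  exact memLp_two_of_lintegral h2 h1

lemma aestronglyMeasurable_entry {X : Type*} [MeasurableSpace X] {μ : Measure X} {m : X → Mat4}
    (hm : AEStronglyMeasurable (fun q => matVec (m q)) μ) (a c : Fin 4) :
    AEStronglyMeasurable (fun q => m q a c) μ :=
  (EuclideanSpace.proj (a, c) :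
    EuclideanSpace ℂ (Fin 4 × Fin 4) →L[ℂ] ℂ).continuous.comp_aestronglyMeasurable hm

lemma integrable_toEuclideanLin {m : E3 → Mat4}
    (hm : MemLp (fun q => matVec (m q)) 2 (ballMeasure Λ)) (ψ : Space Λ) :
    Integrable (fun q => Matrix.toEuclideanLin (m q) (ψ q)) (ballMeasure Λ) := by
  have h1 : Integrable (fun q => ‖matVec (m q)‖ * ‖ψ q‖) (ballMeasure Λ) :=
    hm.norm.integrable_mul (Lp.memLp ψ).norm
  exact h1.mono' (aestronglyMeasurable_toEuclideanLin (aestronglyMeasurable_entry hm.1)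
    (Lp.aestronglyMeasurable ψ)) (ae_of_all _ fun q => norm_toEuclideanLin_le _ _)

/-- Parseval's identity for the rows of the kernel: the Hilbert-Schmidt norm of an operator is the
`L²` norm of its kernel. -/
theorem tsum_enorm_sq_eq_lintegral {w : Set (Space Λ)} (b : HilbertBasis w ℂ (Space Λ))
    {Q : Space Λ →L[ℂ] Space Λ} {K : E3 → E3 → Mat4} (hQ : IsKernel Q K) :
    ∑' i, ‖Q (b i)‖ₑ ^ 2 =
      ∫⁻ p, ∫⁻ q, ‖matVec (K p q)‖ₑ ^ 2 ∂ballMeasure Λ ∂ballMeasure Λ := by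
  have : Fact ((2 : ENNReal) ≠ ⊤) := ⟨ENNReal.ofNat_ne_top⟩
  have : IsSeparable (ballMeasure Λ) := inferInstance
  have : SecondCountableTopology (Space Λ) := Lp.SecondCountableTopology
  have hw : Countable w := countable_of_hilbertBasis b
  simp_rw [enorm_sq_Lp]
  rw [← lintegral_tsum fun i => (Lp.aestronglyMeasurable (Q (b i))).enorm.pow_const 2]
  refine lintegral_congr_ae ?_
  filter_upwards [ae_memLp_matVec hQ.1, ae_all_iff.mpr fun i => hQ.2 (b i)] with p hp hrep
  have hent := aestronglyMeasurable_entry hp.1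
  set r : Fin 4 → E3 → Spinor := fun a q => WithLp.toLp 2 fun c => conj (K p q a c) with hr
  have hrm (a : Fin 4) : MemLp (r a) 2 (ballMeasure Λ) := by
    refine hp.mono ?_ (ae_of_all _ fun q => ?_)
    · have h2 : AEStronglyMeasurable (fun q (c : Fin 4) => conj (K p q a c)) (ballMeasure Λ) :=
        (aemeasurable_pi_lambda _ fun c =>
          (continuous_conj.comp_aestronglyMeasurable (hent a c)).aemeasurable).aestronglyMeasurable
      exact (PiLp.continuous_toLp 2 _).comp_aestronglyMeasurable h2
    · refine le_of_sq_le_sq ?_ (norm_nonneg _)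
      rw [norm_matVec_sq, EuclideanSpace.norm_sq_eq]
      simp only [hr, RCLike.norm_conj]
      exact Finset.single_le_sum (f := fun a => ∑ c, ‖K p q a c‖ ^ 2)
        (fun a _ => Finset.sum_nonneg fun c _ => sq_nonneg _) (Finset.mem_univ a)
  have hcomp (i : w) (a : Fin 4) : (Q (b i) : E3 → Spinor) p a =
      inner ℂ ((hrm a).toLp (r a)) (b i) := by
    have hint := integrable_toEuclideanLin hp (b i)
    have h2 := (EuclideanSpace.proj a : Spinor →L[ℂ] ℂ).integral_comp_comm hint
    rw [hrep i, L2.inner_def]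
    refine Eq.trans h2.symm (integral_congr_ae ?_)
    filter_upwards [(hrm a).coeFn_toLp] with q hq
    rw [hq, PiLp.inner_apply]
    simp [hr, toEuclideanLin_apply_entry, mul_comm]
  have hsq : ∫⁻ q, ‖matVec (K p q)‖ₑ ^ 2 ∂ballMeasure Λ =
      ∫⁻ q, ∑ a, ∑ c, ‖K p q a c‖ₑ ^ 2 ∂ballMeasure Λ := lintegral_congr fun q => enorm_sq_matVec _
  rw [hsq]
  have e1 (i : w) : ‖(Q (b i) : E3 → Spinor) p‖ₑ ^ 2 =
      ∑ a, ‖(inner ℂ ((hrm a).toLp (r a)) (b i) : ℂ)‖ₑ ^ 2 := by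
    rw [enorm_sq_spinor]
    exact Finset.sum_congr rfl fun a _ => by rw [hcomp]
  have e2 (a : Fin 4) : ∑' i, ‖(inner ℂ ((hrm a).toLp (r a)) (b i) : ℂ)‖ₑ ^ 2 =
      ∫⁻ q, ∑ c, ‖K p q a c‖ₑ ^ 2 ∂ballMeasure Λ := by
    have e3 (i : w) : ‖(inner ℂ ((hrm a).toLp (r a)) (b i) : ℂ)‖ₑ ^ 2 =
        ‖(inner ℂ (b i) ((hrm a).toLp (r a)) : ℂ)‖ₑ ^ 2 := by
      rw [← inner_conj_symm, ← ofReal_norm, RCLike.norm_conj, ofReal_norm]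
    rw [tsum_congr e3, ← enorm_sq_eq_tsum b, enorm_sq_Lp]
    refine lintegral_congr_ae ?_
    filter_upwards [(hrm a).coeFn_toLp] with q hq
    rw [hq, enorm_sq_spinor]
    refine Finset.sum_congr rfl fun c _ => ?_
    change ‖conj (K p q a c)‖ₑ ^ 2 = _
    rw [← ofReal_norm, RCLike.norm_conj, ofReal_norm]
  rw [tsum_congr e1, Summable.tsum_finsetSum fun _ _ => ENNReal.summable,
    Finset.sum_congr rfl fun a _ => e2 a, lintegral_finsetSum' _ fun a _ =>
      Finset.aemeasurable_fun_sum _ fun c _ => (hent a c).enorm.pow_const 2]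

end Kernel

/-! ### Existence of kernels -/

section ExistsKernel

variable {Λ : ℝ}

/-- The kernel `φ(p) ⊗ ψ(q)*` of the rank-one operator `|φ⟩⟨ψ|`, as an `L²` function. -/
def rankOneKernel (φ ψ : E3 → Spinor) (z : E3 × E3) : EuclideanSpace ℂ (Fin 4 × Fin 4) :=
  WithLp.toLp 2 fun e => φ z.1 e.1 * conj (ψ z.2 e.2)

lemma inner_rankOneKernel (φ ψ φ' ψ' : E3 → Spinor) (z : E3 × E3) :
    inner ℂ (rankOneKernel φ ψ z) (rankOneKernel φ' ψ' z) =
      (inner ℂ (φ z.1) (φ' z.1) * inner ℂ (ψ' z.2) (ψ z.2) : ℂ) := by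
  rw [PiLp.inner_apply, PiLp.inner_apply, PiLp.inner_apply, Fintype.sum_prod_type,
    Finset.sum_mul_sum]
  refine Finset.sum_congr rfl fun a _ => Finset.sum_congr rfl fun c _ => ?_
  simp only [rankOneKernel, RCLike.inner_apply, map_mul, conj_conj]
  ring

lemma memLp_rankOneKernel (φ ψ : Space Λ) :
    MemLp (rankOneKernel φ ψ) 2 ((ballMeasure Λ).prod (ballMeasure Λ)) := by
  have hc (ψ : Space Λ) (c : Fin 4) : AEStronglyMeasurable (fun p => ψ p c) (ballMeasure Λ) :=
    (EuclideanSpace.proj c : Spinor →L[ℂ] ℂ).continuous.comp_aestronglyMeasurable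
      (Lp.aestronglyMeasurable ψ)
  have hm : AEStronglyMeasurable (rankOneKernel φ ψ) ((ballMeasure Λ).prod (ballMeasure Λ)) := by
    have h1 (e : Fin 4 × Fin 4) : AEStronglyMeasurable (fun z : E3 × E3 => φ z.1 e.1)
        ((ballMeasure Λ).prod (ballMeasure Λ)) := (hc φ e.1).comp_fst
    have h2 (e : Fin 4 × Fin 4) : AEStronglyMeasurable (fun z : E3 × E3 => ψ z.2 e.2)
        ((ballMeasure Λ).prod (ballMeasure Λ)) := (hc ψ e.2).comp_snd
    have h3 (e : Fin 4 × Fin 4) : AEMeasurable (fun z : E3 × E3 => φ z.1 e.1 * conj (ψ z.2 e.2))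
        ((ballMeasure Λ).prod (ballMeasure Λ)) :=
      (h1 e).aemeasurable.mul (continuous_conj.measurable.comp_aemeasurable (h2 e).aemeasurable)
    exact (PiLp.continuous_toLp 2 _).comp_aestronglyMeasurable
      (aemeasurable_pi_lambda _ h3).aestronglyMeasurable
  refine memLp_two_of_lintegral hm ?_
  have e (z : E3 × E3) : ‖rankOneKernel φ ψ z‖ₑ ^ 2 = ‖φ z.1‖ₑ ^ 2 * ‖ψ z.2‖ₑ ^ 2 := by
    have h : ‖rankOneKernel φ ψ z‖ ^ 2 = ‖φ z.1‖ ^ 2 * ‖ψ z.2‖ ^ 2 := by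
      have h1 := inner_rankOneKernel φ ψ φ ψ z
      simp only [inner_self_eq_norm_sq_to_K] at h1
      exact_mod_cast h1
    rw [← ofReal_norm, ← ofReal_norm, ← ofReal_norm, ← ENNReal.ofReal_pow (norm_nonneg _), h,
      ENNReal.ofReal_mul (by positivity), ENNReal.ofReal_pow (norm_nonneg _),
      ENNReal.ofReal_pow (norm_nonneg _)]
  simp_rw [e]
  rw [lintegral_prod_mul ((Lp.aestronglyMeasurable φ).enorm.pow_const 2)
    ((Lp.aestronglyMeasurable ψ).enorm.pow_const 2)]
  exact ENNReal.mul_lt_top (lintegral_enorm_sq_lt_top (Lp.memLp φ))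
    (lintegral_enorm_sq_lt_top (Lp.memLp ψ))

lemma inner_toLp_rankOneKernel (φ ψ φ' ψ' : Space Λ) :
    inner ℂ ((memLp_rankOneKernel φ ψ).toLp _) ((memLp_rankOneKernel φ' ψ').toLp _) =
      (inner ℂ φ φ' * inner ℂ ψ' ψ : ℂ) := by
  rw [L2.inner_def, L2.inner_def, L2.inner_def, ← integral_prod_mul]
  refine integral_congr_ae ?_
  filter_upwards [(memLp_rankOneKernel φ ψ).coeFn_toLp, (memLp_rankOneKernel φ' ψ').coeFn_toLp]
    with z h1 h2
  rw [h1, h2, inner_rankOneKernel]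

/-- For a Hilbert-Schmidt operator the sum `∑ Q eᵢ ⊗ eᵢ*` converges in `L²`, its terms being
orthogonal. -/
lemma summable_rankOneKernel {w : Set (Space Λ)} (b : HilbertBasis w ℂ (Space Λ))
    {Q : Space Λ →L[ℂ] Space Λ} (hQ : Summable fun i => ‖Q (b i)‖ ^ 2) :
    Summable fun i => (memLp_rankOneKernel (Q (b i)) (b i)).toLp _ := by
  set F : w → Lp (EuclideanSpace ℂ (Fin 4 × Fin 4)) 2 ((ballMeasure Λ).prod (ballMeasure Λ)) :=
    fun i => (memLp_rankOneKernel (Q (b i)) (b i)).toLp _ with hF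
  have horth : OrthogonalFamily ℂ (fun i => Submodule.span ℂ {F i})
      fun i => (Submodule.span ℂ {F i}).subtypeₗᵢ := by
    refine OrthogonalFamily.of_pairwise fun i j hij => ?_
    rw [Function.onFun, Submodule.isOrtho_span]
    intro x hx y hy
    rw [Set.mem_singleton_iff.mp hx, Set.mem_singleton_iff.mp hy, hF,
      inner_toLp_rankOneKernel, b.orthonormal.2 hij.symm, mul_zero]
  have h := horth.summable_iff_norm_sq_summable
    fun i => ⟨F i, Submodule.mem_span_singleton_self _⟩
  refine h.mpr (hQ.congr fun i => ?_)
  have h1 := inner_toLp_rankOneKernel (Q (b i)) (b i) (Q (b i)) (b i)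
  simp only [inner_self_eq_norm_sq_to_K, b.orthonormal.1 i] at h1
  change _ = ‖F i‖ ^ 2
  have h2 : ((‖F i‖ : ℂ)) ^ 2 = (‖Q (b i)‖ : ℂ) ^ 2 := by
    rw [hF]
    simpa using h1
  exact_mod_cast h2.symm

lemma inner_rankOneKernel_left (φ ψ : E3 → Spinor) (A : Mat4) (p q : E3) :
    inner ℂ (rankOneKernel φ ψ (p, q)) (matVec A) =
      (inner ℂ (φ p) (Matrix.toEuclideanLin A (ψ q)) : ℂ) := by
  rw [PiLp.inner_apply, PiLp.inner_apply, Fintype.sum_prod_type]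
  refine Finset.sum_congr rfl fun a _ => ?_
  rw [toEuclideanLin_apply_entry, RCLike.inner_apply, Finset.sum_mul]
  refine Finset.sum_congr rfl fun c _ => ?_
  simp only [rankOneKernel, matVec, RCLike.inner_apply, map_mul, conj_conj]
  ring

lemma memLp_entry {X : Type*} [MeasurableSpace X] {μ : Measure X} {m : X → Mat4}
    (hm : MemLp (fun q => matVec (m q)) 2 μ) (a c : Fin 4) : MemLp (fun q => m q a c) 2 μ :=
  hm.mono (aestronglyMeasurable_entry hm.1 a c) (ae_of_all _ fun _ => norm_entry_le _ a c)

lemma memLp_integral_kernel {K : E3 → E3 → Mat4}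
    (hK : MemLp (fun z : E3 × E3 => matVec (K z.1 z.2)) 2
      ((ballMeasure Λ).prod (ballMeasure Λ))) (ψ : Space Λ) :
    MemLp (fun p => ∫ q, Matrix.toEuclideanLin (K p q) (ψ q) ∂ballMeasure Λ) 2
      (ballMeasure Λ) := by
  have hm : AEStronglyMeasurable (fun z : E3 × E3 =>
      Matrix.toEuclideanLin (K z.1 z.2) (ψ z.2)) ((ballMeasure Λ).prod (ballMeasure Λ)) :=
    aestronglyMeasurable_toEuclideanLin (aestronglyMeasurable_entry hK.1)
      (Lp.aestronglyMeasurable ψ).comp_snd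
  refine memLp_two_of_lintegral hm.integral_prod_right' ?_
  have hle : ∀ᵐ p ∂ballMeasure Λ,
      ‖∫ q, Matrix.toEuclideanLin (K p q) (ψ q) ∂ballMeasure Λ‖ₑ ^ 2 ≤
        (∫⁻ q, ‖matVec (K p q)‖ₑ ^ 2 ∂ballMeasure Λ) * ‖ψ‖ₑ ^ 2 := by
    filter_upwards [ae_memLp_matVec (memLp_entry hK)] with p hp
    rw [enorm_sq_Lp]
    refine le_trans ?_ (lintegral_mul_sq_le _ hp.1.enorm (Lp.aestronglyMeasurable ψ).enorm)
    gcongr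
    refine (enorm_integral_le_lintegral_enorm _).trans (lintegral_mono fun q => ?_)
    rw [← ofReal_norm, ← ofReal_norm, ← ofReal_norm, ← ENNReal.ofReal_mul (norm_nonneg _)]
    exact ENNReal.ofReal_le_ofReal (norm_toEuclideanLin_le _ _)
  refine (lintegral_mono_ae hle).trans_lt ?_
  have hm2 : AEMeasurable (fun p => ∫⁻ q, ‖matVec (K p q)‖ₑ ^ 2 ∂ballMeasure Λ)
      (ballMeasure Λ) := (hK.1.enorm.pow_const 2).lintegral_prod_right'
  rw [lintegral_mul_const'' _ hm2, lintegral_lintegral (hK.1.enorm.pow_const 2)]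
  exact ENNReal.mul_lt_top (lintegral_enorm_sq_lt_top hK) (by simp)

/-- Every Hilbert-Schmidt operator on `L²(B(0, Λ), ℂ⁴)` has a square-integrable kernel. -/
theorem exists_isKernel {Q : Space Λ →L[ℂ] Space Λ} (hQ : IsHilbertSchmidt Q) :
    ∃ K, IsKernel Q K := by
  obtain ⟨w, b, -⟩ := exists_hilbertBasis ℂ (Space Λ)
  obtain ⟨k, hk⟩ := summable_rankOneKernel b (hQ w b)
  set K : E3 → E3 → Mat4 := fun p q => Matrix.of fun a c => k (p, q) (a, c) with hKdef
  have hmat (z : E3 × E3) : matVec (K z.1 z.2) = k z := rfl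
  have hK : MemLp (fun z : E3 × E3 => matVec (K z.1 z.2)) 2
      ((ballMeasure Λ).prod (ballMeasure Λ)) := Lp.memLp k
  refine ⟨K, memLp_entry hK, fun ψ => ?_⟩
  have hT := memLp_integral_kernel hK ψ
  suffices h : Q ψ = hT.toLp _ by
    rw [h]
    exact hT.coeFn_toLp
  refine ext_inner_left ℂ fun φ => ?_
  have h1 : HasSum (fun i => (inner ℂ φ (Q (b i)) * inner ℂ (b i) ψ : ℂ)) (inner ℂ φ (Q ψ)) := by
    have h2 := b.hasSum_inner_mul_inner (ContinuousLinearMap.adjoint Q φ) ψ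
    simpa only [ContinuousLinearMap.adjoint_inner_left] using h2
  have h2 : HasSum (fun i => (inner ℂ φ (Q (b i)) * inner ℂ (b i) ψ : ℂ))
      (inner ℂ ((memLp_rankOneKernel φ ψ).toLp _) k) := by
    have h3 := hk.mapL (innerSL ℂ ((memLp_rankOneKernel φ ψ).toLp _))
    simpa only [innerSL_apply_apply, inner_toLp_rankOneKernel] using h3
  rw [h1.unique h2, L2.inner_def, L2.inner_def]
  have hi : Integrable (fun z => (inner ℂ ((memLp_rankOneKernel φ ψ).toLp _ z) (k z) : ℂ))
      ((ballMeasure Λ).prod (ballMeasure Λ)) := L2.integrable_inner _ _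
  have h4 : (fun z => (inner ℂ ((memLp_rankOneKernel φ ψ).toLp _ z) (k z) : ℂ))
      =ᵐ[(ballMeasure Λ).prod (ballMeasure Λ)]
      fun z => inner ℂ (φ z.1) (Matrix.toEuclideanLin (K z.1 z.2) (ψ z.2)) := by
    filter_upwards [(memLp_rankOneKernel φ ψ).coeFn_toLp] with z hz
    rw [hz, ← hmat]
    exact inner_rankOneKernel_left _ _ _ z.1 z.2
  rw [integral_congr_ae h4, integral_prod _ (hi.congr h4)]
  refine integral_congr_ae ?_
  filter_upwards [hT.coeFn_toLp, ae_memLp_matVec (memLp_entry hK)] with p h5 h6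
  rw [h5]
  exact integral_inner (integrable_toEuclideanLin h6 ψ) (φ p)

lemma isKernel_momentumKernel {Q : Space Λ →L[ℂ] Space Λ} (hQ : IsHilbertSchmidt Q) :
    IsKernel Q (momentumKernel Q) := by
  have hex := exists_isKernel hQ
  have h := hex.choose_spec
  have heq : ∀ᵐ p ∂ballMeasure Λ, ∀ᵐ q ∂ballMeasure Λ, hex.choose p q = momentumKernel Q p q := by
    filter_upwards [ae_ballMeasure_mem Λ] with p hp
    filter_upwards [ae_ballMeasure_mem Λ] with q hq
    rw [momentumKernel, dif_pos ⟨hex, by simpa using hp, by simpa using hq⟩]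
  have heq2 : ∀ᵐ z ∂(ballMeasure Λ).prod (ballMeasure Λ),
      hex.choose z.1 z.2 = momentumKernel Q z.1 z.2 := by
    filter_upwards [Measure.quasiMeasurePreserving_fst.ae (ae_ballMeasure_mem Λ),
      Measure.quasiMeasurePreserving_snd.ae (ae_ballMeasure_mem Λ)] with z hp hq
    rw [momentumKernel, dif_pos ⟨hex, by simpa using hp, by simpa using hq⟩]
  refine ⟨fun i j => (h.1 i j).ae_eq ?_, fun ψ => ?_⟩
  · filter_upwards [heq2] with z hz
    rw [hz]
  · filter_upwards [h.2 ψ, heq] with p h1 h2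
    rw [h1]
    refine integral_congr_ae ?_
    filter_upwards [h2] with q hq
    rw [hq]

lemma momentumKernel_of_notMem {Q : Space Λ →L[ℂ] Space Λ} {p q : E3}
    (h : ¬(‖p‖ < Λ ∧ ‖q‖ < Λ)) : momentumKernel Q p q = 0 := by
  rw [momentumKernel, dif_neg]
  rintro ⟨-, h1, h2⟩
  exact h ⟨by simpa using h1, by simpa using h2⟩

/-- Composing with a scalar multiplier on the right multiplies the kernel in its second variable. -/
lemma IsKernel.mul_multiplier {Q s : Space Λ →L[ℂ] Space Λ} {K : E3 → E3 → Mat4}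
    (hQ : IsKernel Q K) {c : E3 → ℂ} (hs : IsMultiplier (fun p => c p • 1) s) {C : ℝ}
    (hc : Measurable c) (hC : ∀ᵐ q ∂ballMeasure Λ, ‖c q‖ ≤ C) :
    IsKernel (Q * s) (fun p q => c q • K p q) := by
  refine ⟨fun i j => ?_, fun ψ => ?_⟩
  · refine (hQ.1 i j).of_le_mul (c := C)
      ((hc.comp measurable_snd).aestronglyMeasurable.mul (hQ.1 i j).1) ?_
    filter_upwards [Measure.quasiMeasurePreserving_snd.ae hC] with z hz
    rw [Matrix.smul_apply, smul_eq_mul, norm_mul]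
    gcongr
  · filter_upwards [hQ.2 (s ψ)] with p hp
    rw [mul_apply_eq_comp, hp]
    refine integral_congr_ae ?_
    filter_upwards [hs ψ] with q hq
    rw [hq]
    simp

end ExistsKernel

/-! ### Fourier integrals and Kato's inequality in position space -/

/-- The plane-wave factor `e^{ir}`. -/
def wave (r : ℝ) : ℂ := Complex.exp (I * (r : ℂ))

lemma norm_wave (r : ℝ) : ‖wave r‖ = 1 := by
  rw [wave, mul_comm, Complex.norm_exp_ofReal_mul_I]

lemma wave_add (r s : ℝ) : wave (r + s) = wave r * wave s := by
  rw [wave, wave, wave, ← Complex.exp_add]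
  push_cast
  ring_nf

lemma conj_wave (r : ℝ) : conj (wave r) = wave (-r) := by
  rw [wave, wave, ← Complex.exp_conj]
  simp

@[fun_prop]
lemma continuous_wave : Continuous wave := by
  unfold wave
  fun_prop

/-- The (unnormalized) Fourier integral `∫ g(p) e^{ip·x} dp`. -/
def waveIntegral (g : E3 → ℂ) (x : E3) : ℂ := ∫ p, g p * wave (inner ℝ p x)

lemma stronglyMeasurable_waveIntegral {g : E3 → ℂ} (hg : StronglyMeasurable g) :
    StronglyMeasurable (waveIntegral g) := by
  have h : StronglyMeasurable fun z : E3 × E3 => g z.2 * wave (inner ℝ z.2 z.1) := by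
    have h1 : Continuous fun z : E3 × E3 => wave (inner ℝ z.2 z.1) := by fun_prop
    exact (hg.comp_measurable measurable_snd).mul h1.stronglyMeasurable
  exact h.integral_prod_right

lemma norm_integral_wave_gaussian (t : ℝ) (ht : 0 < t) (p : E3) :
    ‖∫ x : E3, wave (inner ℝ p x) * (Real.exp (-t * ‖x‖ ^ 2) : ℂ)‖ =
      (Real.pi / t) ^ (3 / 2 : ℝ) * Real.exp (-‖p‖ ^ 2 / (4 * t)) := by
  have h := GaussianFourier.integral_cexp_neg_mul_sq_norm_add (b := (t : ℂ)) (by simpa using ht)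
    I p
  have e (x : E3) : wave (inner ℝ p x) * (Real.exp (-t * ‖x‖ ^ 2) : ℂ) =
      Complex.exp (-(t : ℂ) * (‖x‖ : ℂ) ^ 2 + I * (inner ℝ p x : ℝ)) := by
    rw [wave, ofReal_exp, ← Complex.exp_add]
    push_cast
    ring_nf
  simp_rw [e]
  rw [h, norm_mul, ← ofReal_div, Complex.norm_cpow_eq_rpow_re_of_pos (by positivity)]
  congr 1
  · simp
  · have e2 : I ^ 2 * (‖p‖ : ℂ) ^ 2 / (4 * t) = ((-‖p‖ ^ 2 / (4 * t) : ℝ) : ℂ) := by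
      rw [I_sq]
      push_cast
      ring
    rw [e2, ← ofReal_exp, norm_real, Real.norm_of_nonneg (Real.exp_pos _).le]

/-- Fourier transformation of a Gaussian, applied to `|∫ g(p) e^{ip·x} dp|²`. -/
lemma lintegral_waveIntegral_gaussian_le {g : E3 → ℂ} (hg : Integrable g) {t : ℝ} (ht : 0 < t) :
    ∫⁻ x, ‖waveIntegral g x‖ₑ ^ 2 * ENNReal.ofReal (Real.exp (-t * ‖x‖ ^ 2)) ≤
      ∫⁻ p, ∫⁻ q, ‖g p‖ₑ * ‖g q‖ₑ *
        ENNReal.ofReal ((Real.pi / t) ^ (3 / 2 : ℝ) * Real.exp (-‖p - q‖ ^ 2 / (4 * t))) := by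
  have hgauss : Integrable fun x : E3 => Real.exp (-t * ‖x‖ ^ 2) := by
    refine Integrable.of_integral_ne_zero ?_
    rw [GaussianFourier.integral_rexp_neg_mul_sq_norm ht]
    positivity
  have hgm := hg.1
  -- the square of the Fourier integral as a double integral
  have hsq (x : E3) : ((‖waveIntegral g x‖ ^ 2 : ℝ) : ℂ) =
      ∫ z : E3 × E3, g z.1 * conj (g z.2) * wave (inner ℝ (z.1 - z.2) x) := by
    rw [← Complex.normSq_eq_norm_sq, Complex.normSq_eq_conj_mul_self, mul_comm, waveIntegral,
      ← integral_conj, ← integral_prod_mul]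
    refine integral_congr_ae (ae_of_all _ fun z => ?_)
    simp only [map_mul, conj_wave]
    rw [inner_sub_left, sub_eq_add_neg (inner ℝ z.1 x), wave_add]
    ring
  have hbig : Integrable (fun y : E3 × (E3 × E3) =>
      (Real.exp (-t * ‖y.1‖ ^ 2) : ℂ) * (g y.2.1 * conj (g y.2.2)) *
        wave (inner ℝ (y.2.1 - y.2.2) y.1)) := by
    have h1 : Integrable (fun z : E3 × E3 => g z.1 * conj (g z.2)) :=
      hg.mul_prod (g := fun q => conj (g q)) (by simpa using (conjCLE.integrable_comp_iff).mpr hg)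
    have h2 : Integrable (fun y : E3 × (E3 × E3) =>
      (Real.exp (-t * ‖y.1‖ ^ 2) : ℂ) * (g y.2.1 * conj (g y.2.2))) :=
      hgauss.ofReal.mul_prod (f := fun x : E3 => (Real.exp (-t * ‖x‖ ^ 2) : ℂ)) h1
    refine h2.mul_bdd (c := 1) ?_ (ae_of_all _ fun p => (norm_wave _).le)
    exact Continuous.aestronglyMeasurable (by fun_prop)
  have hF : Integrable fun x => ‖waveIntegral g x‖ ^ 2 * Real.exp (-t * ‖x‖ ^ 2) := by
    have h1 : Integrable fun x => ∫ z : E3 × E3, (Real.exp (-t * ‖x‖ ^ 2) : ℂ) *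
      (g z.1 * conj (g z.2)) * wave (inner ℝ (z.1 - z.2) x) := hbig.integral_prod_left
    have h2 : (fun x => ‖waveIntegral g x‖ ^ 2 * Real.exp (-t * ‖x‖ ^ 2)) =
        fun x => (∫ z : E3 × E3, (Real.exp (-t * ‖x‖ ^ 2) : ℂ) *
          (g z.1 * conj (g z.2)) * wave (inner ℝ (z.1 - z.2) x)).re := by
      ext x
      simp_rw [mul_assoc (Real.exp (-t * ‖x‖ ^ 2) : ℂ)]
      rw [integral_const_mul, ← hsq, ← ofReal_mul, ofReal_re, mul_comm]
    rw [h2]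
    exact h1.re
  have e0 : ∫⁻ x, ‖waveIntegral g x‖ₑ ^ 2 * ENNReal.ofReal (Real.exp (-t * ‖x‖ ^ 2)) =
      ENNReal.ofReal (∫ x, ‖waveIntegral g x‖ ^ 2 * Real.exp (-t * ‖x‖ ^ 2)) := by
    rw [ofReal_integral_eq_lintegral_ofReal hF (ae_of_all _ fun _ => by positivity)]
    refine lintegral_congr fun x => ?_
    rw [ENNReal.ofReal_mul (by positivity), ENNReal.ofReal_pow (norm_nonneg _),
      ofReal_norm (waveIntegral g x)]
  have e1 : ((∫ x, ‖waveIntegral g x‖ ^ 2 * Real.exp (-t * ‖x‖ ^ 2) : ℝ) : ℂ) =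
      ∫ z : E3 × E3, g z.1 * conj (g z.2) *
        ∫ x : E3, wave (inner ℝ (z.1 - z.2) x) * (Real.exp (-t * ‖x‖ ^ 2) : ℂ) := by
    rw [← integral_complex_ofReal]
    have h3 : ∀ x, ((‖waveIntegral g x‖ ^ 2 * Real.exp (-t * ‖x‖ ^ 2) : ℝ) : ℂ) =
        ∫ z : E3 × E3, (Real.exp (-t * ‖x‖ ^ 2) : ℂ) * (g z.1 * conj (g z.2)) *
          wave (inner ℝ (z.1 - z.2) x) := by
      intro x
      simp_rw [mul_assoc (Real.exp (-t * ‖x‖ ^ 2) : ℂ)]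
      rw [integral_const_mul, ← hsq, ← ofReal_mul, mul_comm]
    simp_rw [h3]
    rw [integral_integral_swap hbig]
    refine integral_congr_ae (ae_of_all _ fun z => ?_)
    simp only
    rw [← integral_const_mul]
    refine integral_congr_ae (ae_of_all _ fun x => ?_)
    simp only
    ring
  have e2 : ENNReal.ofReal (∫ x, ‖waveIntegral g x‖ ^ 2 * Real.exp (-t * ‖x‖ ^ 2)) =
      ‖∫ z : E3 × E3, g z.1 * conj (g z.2) *
        ∫ x : E3, wave (inner ℝ (z.1 - z.2) x) * (Real.exp (-t * ‖x‖ ^ 2) : ℂ)‖ₑ := by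
    rw [← e1, ← ofReal_norm, norm_real, Real.norm_of_nonneg]
    exact integral_nonneg fun x => by positivity
  rw [e0, e2]
  have hgm1 : AEMeasurable (fun z : E3 × E3 => ‖g z.1‖ₑ) := hgm.comp_fst.enorm
  have hgm2 : AEMeasurable (fun z : E3 × E3 => ‖g z.2‖ₑ) := hgm.comp_snd.enorm
  rw [lintegral_lintegral ((hgm1.mul hgm2).mul (by fun_prop))]
  refine (enorm_integral_le_lintegral_enorm _).trans (lintegral_mono fun z => ?_)
  rw [enorm_mul, enorm_mul, ← ofReal_norm (∫ x : E3, _), norm_integral_wave_gaussian t ht,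
    ← ofReal_norm (conj (g z.2)), RCLike.norm_conj, ofReal_norm]

/-- Plancherel's inequality. Multiplying by a wide Gaussian in `x` amounts to an approximate
identity in momentum space. -/
lemma lintegral_waveIntegral_sq_le {g : E3 → ℂ} (hg : Integrable g) (hgs : StronglyMeasurable g) :
    ∫⁻ x, ‖waveIntegral g x‖ₑ ^ 2 ≤ ENNReal.ofReal ((2 * Real.pi) ^ 3) * ∫⁻ p, ‖g p‖ₑ ^ 2 := by
  have hm := (stronglyMeasurable_waveIntegral hgs).measurable
  have hgm := hgs.measurable
  have hle (t : ℝ) (ht : 0 < t) :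
      ∫⁻ x, ‖waveIntegral g x‖ₑ ^ 2 * ENNReal.ofReal (Real.exp (-t * ‖x‖ ^ 2)) ≤
        ENNReal.ofReal ((2 * Real.pi) ^ 3) * ∫⁻ p, ‖g p‖ₑ ^ 2 := by
    refine (lintegral_waveIntegral_gaussian_le hg ht).trans ?_
    set κ : E3 → E3 → ENNReal := fun p q =>
      ENNReal.ofReal ((Real.pi / t) ^ (3 / 2 : ℝ) * Real.exp (-‖p - q‖ ^ 2 / (4 * t))) with hκ
    have hκm : Measurable fun z : E3 × E3 => κ z.1 z.2 := by fun_prop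
    have hκ1 (p : E3) : ∫⁻ q, κ q p = ENNReal.ofReal ((2 * Real.pi) ^ 3) := by
      have e (q : E3) : κ q p = ENNReal.ofReal ((Real.pi / t) ^ (3 / 2 : ℝ)) *
          ENNReal.ofReal (Real.exp (-(1 / (4 * t)) * ‖q - p‖ ^ 2)) := by
        rw [← ENNReal.ofReal_mul (by positivity), hκ]
        ring_nf
      simp_rw [e]
      rw [lintegral_const_mul _ (by fun_prop), lintegral_gaussian _ (by positivity),
        ← ENNReal.ofReal_mul (by positivity), ← Real.mul_rpow (by positivity) (by positivity)]
      congr 1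
      have : Real.pi / t * (Real.pi / (1 / (4 * t))) = (2 * Real.pi) ^ (2 : ℝ) := by
        rw [Real.rpow_two]
        field_simp
        ring
      rw [this, ← Real.rpow_mul (by positivity), ← Real.rpow_natCast]
      norm_num
    have hκs (p q : E3) : κ p q = κ q p := by rw [hκ]; simp only [norm_sub_rev]
    have hamgm (a b : ENNReal) : a * b ≤ (1 / 2) * (a ^ 2 + b ^ 2) := by
      have h2 : 2 * (a * b) ≤ a ^ 2 + b ^ 2 := by
        induction a with
        | top => simp
        | coe a =>
          induction b with
          | top => simp
          | coe b =>
            have := two_mul_le_add_sq a b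
            rw [mul_assoc] at this
            exact_mod_cast this
      rw [one_div, ← ENNReal.div_eq_inv_mul,
        ENNReal.le_div_iff_mul_le (Or.inl two_ne_zero) (Or.inl ENNReal.ofNat_ne_top), mul_comm]
      exact h2
    calc _ ≤ ∫⁻ p, ∫⁻ q, ((1 / 2) * (‖g p‖ₑ ^ 2 * κ p q) + (1 / 2) * (‖g q‖ₑ ^ 2 * κ p q)) := by
          refine lintegral_mono fun p => lintegral_mono fun q => ?_
          refine (mul_le_mul_left (hamgm ‖g p‖ₑ ‖g q‖ₑ) (κ p q)).trans (le_of_eq (by ring))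
      _ = (∫⁻ p, ∫⁻ q, (1 / 2) * (‖g p‖ₑ ^ 2 * κ p q)) +
          ∫⁻ p, ∫⁻ q, (1 / 2) * (‖g q‖ₑ ^ 2 * κ p q) := by
          rw [← lintegral_add_left (by fun_prop)]
          refine lintegral_congr fun p => ?_
          rw [lintegral_add_left (by fun_prop)]
      _ = (∫⁻ p, (1 / 2) * (‖g p‖ₑ ^ 2 * ENNReal.ofReal ((2 * Real.pi) ^ 3))) +
          ∫⁻ p, (1 / 2) * (‖g p‖ₑ ^ 2 * ENNReal.ofReal ((2 * Real.pi) ^ 3)) := by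
          congr 1
          · refine lintegral_congr fun p => ?_
            simp_rw [hκs p]
            rw [lintegral_const_mul _ (by fun_prop), lintegral_const_mul _ (by fun_prop), hκ1]
          · rw [lintegral_lintegral_swap (by fun_prop)]
            refine lintegral_congr fun p => ?_
            rw [lintegral_const_mul _ (by fun_prop), lintegral_const_mul _ (by fun_prop), hκ1]
      _ = _ := by
          rw [lintegral_const_mul _ (by fun_prop), lintegral_mul_const _ (by fun_prop), ← add_mul,
            one_div, ENNReal.inv_two_add_inv_two, one_mul, mul_comm]
  have hlim : Tendsto (fun n : ℕ => ∫⁻ x, ‖waveIntegral g x‖ₑ ^ 2 *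
      ENNReal.ofReal (Real.exp (-(1 / ((n : ℝ) + 1)) * ‖x‖ ^ 2))) atTop
      (𝓝 (∫⁻ x, ‖waveIntegral g x‖ₑ ^ 2)) := by
    refine lintegral_tendsto_of_tendsto_of_monotone (fun n => by fun_prop) (ae_of_all _ fun x => ?_)
      (ae_of_all _ fun x => ?_)
    · intro n k hnk
      dsimp only
      gcongr
    · have h1 : Tendsto (fun n : ℕ => Real.exp (-(1 / ((n : ℝ) + 1)) * ‖x‖ ^ 2)) atTop (𝓝 1) := by
        have := ((tendsto_one_div_add_atTop_nhds_zero_nat (𝕜 := ℝ)).neg.mul_const (‖x‖ ^ 2)).rexp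
        simpa using this
      have h2 := ENNReal.Tendsto.const_mul (a := ‖waveIntegral g x‖ₑ ^ 2)
        (ENNReal.tendsto_ofReal h1) (Or.inl (by simp))
      simpa using h2
  exact le_of_tendsto' hlim fun n => hle _ (by positivity)

lemma lintegral_rpow_neg_two_mul_exp {a : ℝ} (ha : 0 < a) :
    ∫⁻ t in Ioi (0 : ℝ), ENNReal.ofReal (t ^ (-2 : ℝ) * Real.exp (-a / t)) =
      ENNReal.ofReal (1 / a) := by
  refine lintegral_ofReal_eq_of_integral_eq ?_ (by positivity) ?_
  · filter_upwards [ae_restrict_mem measurableSet_Ioi] with t ht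
    have : (0 : ℝ) < t := ht
    simp only [Pi.zero_apply]
    positivity
  have h1 := integral_comp_rpow_Ioi (fun t => Real.exp (-(a * t))) (p := -1) (by norm_num)
  have h2 := Real.integral_rpow_mul_exp_neg_mul_Ioi (a := 1) one_pos ha
  simp only [sub_self, Real.rpow_zero, one_mul, Real.rpow_one, Real.Gamma_one, mul_one] at h2
  rw [← h2, ← h1]
  refine setIntegral_congr_fun measurableSet_Ioi fun t ht => ?_
  have ht : (0 : ℝ) < t := ht
  simp only [smul_eq_mul, Real.rpow_neg_one]
  norm_num
  left
  field_simp

/-- Kato's inequality `1 / |x| ≤ (π / 2) |∇|`. Writing `1 / |x| = π^{-1/2} ∫ t^{-1/2} e^{-t|x|²} dt`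
reduces it to `∬ h(p) h(q) / |p - q|² ≤ π³ ∫ |p| h²`. -/
lemma lintegral_waveIntegral_kato {g : E3 → ℂ} (hg : Integrable g) (hgs : StronglyMeasurable g) :
    ∫⁻ x, ‖waveIntegral g x‖ₑ ^ 2 * ENNReal.ofReal (1 / ‖x‖) ≤
      ENNReal.ofReal ((2 * Real.pi) ^ 3 * (Real.pi / 2)) *
        ∫⁻ p, ENNReal.ofReal ‖p‖ * ‖g p‖ₑ ^ 2 := by
  have hm := (stronglyMeasurable_waveIntegral hgs).measurable
  have hgm := hgs.measurable
  have e1 (x : E3) : ENNReal.ofReal (1 / ‖x‖) ≤ ∫⁻ t in Ioi (0 : ℝ),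
      ENNReal.ofReal (1 / √Real.pi * t ^ (-(1 / 2) : ℝ)) *
        ENNReal.ofReal (Real.exp (-t * ‖x‖ ^ 2)) := by
    rcases eq_or_ne x 0 with rfl | hx
    · simp
    have hx' : 0 < ‖x‖ := norm_pos_iff.mpr hx
    have h1 := lintegral_rpow_neg_half_mul_exp (a := ‖x‖ ^ 2) (by positivity)
    rw [Real.sqrt_sq hx'.le] at h1
    have h2 : ∀ t ∈ Ioi (0 : ℝ), ENNReal.ofReal (1 / √Real.pi * t ^ (-(1 / 2) : ℝ)) *
        ENNReal.ofReal (Real.exp (-t * ‖x‖ ^ 2)) = ENNReal.ofReal (1 / √Real.pi) *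
        ENNReal.ofReal (t ^ (-(1 / 2) : ℝ) * Real.exp (-(‖x‖ ^ 2 * t))) := by
      intro t ht
      have ht : (0 : ℝ) < t := ht
      rw [← ENNReal.ofReal_mul (by positivity), ← ENNReal.ofReal_mul (by positivity)]
      ring_nf
    rw [setLIntegral_congr_fun measurableSet_Ioi h2, lintegral_const_mul _ (by fun_prop), h1,
      ← ENNReal.ofReal_mul (by positivity)]
    apply le_of_eq
    congr 1
    have : √Real.pi ≠ 0 := by positivity
    field_simp
  calc _ ≤ ∫⁻ x, ∫⁻ t in Ioi (0 : ℝ), ENNReal.ofReal (1 / √Real.pi * t ^ (-(1 / 2) : ℝ)) *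
        (‖waveIntegral g x‖ₑ ^ 2 * ENNReal.ofReal (Real.exp (-t * ‖x‖ ^ 2))) := by
        refine lintegral_mono fun x => ?_
        refine (mul_le_mul_right (e1 x) _).trans (le_of_eq ?_)
        rw [← lintegral_const_mul _ (by fun_prop)]
        refine lintegral_congr fun t => ?_
        ring
    _ = ∫⁻ t in Ioi (0 : ℝ), ENNReal.ofReal (1 / √Real.pi * t ^ (-(1 / 2) : ℝ)) *
        ∫⁻ x, (‖waveIntegral g x‖ₑ ^ 2 * ENNReal.ofReal (Real.exp (-t * ‖x‖ ^ 2))) := by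
        rw [lintegral_lintegral_swap (by fun_prop)]
        refine lintegral_congr fun t => ?_
        rw [lintegral_const_mul _ (by fun_prop)]
    _ ≤ ∫⁻ t in Ioi (0 : ℝ), ENNReal.ofReal (1 / √Real.pi * t ^ (-(1 / 2) : ℝ)) *
        ∫⁻ p, ∫⁻ q, ‖g p‖ₑ * ‖g q‖ₑ *
          ENNReal.ofReal ((Real.pi / t) ^ (3 / 2 : ℝ) * Real.exp (-‖p - q‖ ^ 2 / (4 * t))) := by
        refine setLIntegral_mono' measurableSet_Ioi fun t ht => ?_
        exact mul_le_mul_right (lintegral_waveIntegral_gaussian_le hg ht) _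
    _ = ∫⁻ t in Ioi (0 : ℝ), ∫⁻ p, ∫⁻ q, ‖g p‖ₑ * ‖g q‖ₑ *
          (ENNReal.ofReal Real.pi *
            ENNReal.ofReal (t ^ (-2 : ℝ) * Real.exp (-(‖p - q‖ ^ 2 / 4) / t))) := by
        refine setLIntegral_congr_fun measurableSet_Ioi fun t ht => ?_
        have ht : (0 : ℝ) < t := ht
        rw [← lintegral_const_mul _ (by fun_prop)]
        refine lintegral_congr fun p => ?_
        rw [← lintegral_const_mul _ (by fun_prop)]
        refine lintegral_congr fun q => ?_
        rw [mul_left_comm, ← ENNReal.ofReal_mul (by positivity),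
          ← ENNReal.ofReal_mul (by positivity)]
        congr 2
        have h3 : -‖p - q‖ ^ 2 / (4 * t) = -(‖p - q‖ ^ 2 / 4) / t := by field_simp
        have h4 : 1 / √Real.pi * t ^ (-(1 / 2) : ℝ) * (Real.pi / t) ^ (3 / 2 : ℝ) =
            Real.pi * t ^ (-2 : ℝ) := by
          rw [Real.div_rpow Real.pi_pos.le ht.le, Real.rpow_neg ht.le, Real.rpow_neg ht.le,
            Real.sqrt_eq_rpow, show (2 : ℝ) = 3 / 2 + 1 / 2 by norm_num, Real.rpow_add ht,
            show (3 / 2 + 1 / 2 : ℝ) = 2 by norm_num, show (3 / 2 : ℝ) = 1 / 2 + 1 by norm_num,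
            Real.rpow_add Real.pi_pos, Real.rpow_one]
          have : Real.pi ^ (1 / 2 : ℝ) ≠ 0 := by positivity
          have : t ^ (1 / 2 : ℝ) ≠ 0 := by positivity
          field_simp
        rw [h3, ← mul_assoc, h4, mul_assoc]
    _ = ∫⁻ p, ∫⁻ q, ∫⁻ t in Ioi (0 : ℝ), ‖g p‖ₑ * ‖g q‖ₑ *
          (ENNReal.ofReal Real.pi *
            ENNReal.ofReal (t ^ (-2 : ℝ) * Real.exp (-(‖p - q‖ ^ 2 / 4) / t))) := by
        rw [lintegral_lintegral_swap (by fun_prop)]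
        refine lintegral_congr fun p => ?_
        rw [lintegral_lintegral_swap (by fun_prop)]
    _ = ∫⁻ p, ∫⁻ q, ENNReal.ofReal (4 * Real.pi) *
          (‖g p‖ₑ * ‖g q‖ₑ * ENNReal.ofReal (1 / ‖p - q‖ ^ 2)) := by
        refine lintegral_congr fun p => lintegral_congr_ae ?_
        filter_upwards [Measure.ae_ne volume p] with q hq
        have hq' : 0 < ‖p - q‖ := norm_pos_iff.mpr (sub_ne_zero.mpr hq.symm)
        rw [lintegral_const_mul _ (by fun_prop), lintegral_const_mul _ (by fun_prop),
          lintegral_rpow_neg_two_mul_exp (by positivity),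
          mul_left_comm (ENNReal.ofReal (4 * Real.pi)),
          ← ENNReal.ofReal_mul (by positivity), ← ENNReal.ofReal_mul (by positivity)]
        congr 2
        field_simp
    _ = ENNReal.ofReal (4 * Real.pi) *
          ∫⁻ p, ∫⁻ q, ‖g p‖ₑ * ‖g q‖ₑ * ENNReal.ofReal (1 / ‖p - q‖ ^ 2) := by
        rw [← lintegral_const_mul _ (by fun_prop)]
        refine lintegral_congr fun p => ?_
        rw [lintegral_const_mul _ (by fun_prop)]
    _ ≤ ENNReal.ofReal (4 * Real.pi) * (ENNReal.ofReal (Real.pi ^ 3) *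
          ∫⁻ q, ENNReal.ofReal ‖q‖ * ‖g q‖ₑ ^ 2) := by
        gcongr
        exact lintegral_lintegral_mul_le le_rfl (by fun_prop)
    _ = _ := by
        rw [← mul_assoc, ← ENNReal.ofReal_mul (by positivity)]
        congr 2
        ring

/-! ### Kato's inequality for two-particle kernels -/

/-- Kato's inequality in the relative coordinate `x - y` of a two-particle kernel. In the momenta
`l = p - q` and `q` the Fourier integral is a function of `x` and `r = x - y`; Plancherel's
inequality is used in `x` and Kato's inequality in `r`. -/
lemma lintegral_lintegral_kato {k : E3 × E3 → ℂ} (hk : Integrable k (volume.prod volume))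
    (hks : StronglyMeasurable k) :
    ∫⁻ x, ∫⁻ y, ‖∫ z, k z * wave (inner ℝ z.1 x - inner ℝ z.2 y) ∂(volume.prod volume)‖ₑ ^ 2 *
        ENNReal.ofReal (1 / ‖x - y‖) ≤
      ENNReal.ofReal ((2 * Real.pi) ^ 6 * (Real.pi / 2)) *
        ∫⁻ q, ∫⁻ p, ENNReal.ofReal ‖q‖ * ‖k (p, q)‖ₑ ^ 2 := by
  set κ : E3 × E3 → ℂ := fun z => k (z.1 + z.2, z.2) with hκ
  have hshear : MeasurePreserving (fun z : E3 × E3 => (z.1 + z.2, z.2)) (volume.prod volume)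
      (volume.prod volume) := measurePreserving_add_prod volume volume
  have hemb : MeasurableEmbedding (fun z : E3 × E3 => (z.1 + z.2, z.2)) := by
    refine (MeasurableEquiv.mk ⟨fun z : E3 × E3 => (z.1 + z.2, z.2),
      fun z => (z.1 - z.2, z.2), fun z => by simp, fun z => by simp⟩ ?_ ?_).measurableEmbedding
    · exact hshear.measurable
    · change Measurable fun z : E3 × E3 => (z.1 - z.2, z.2)
      fun_prop
  have hκs : StronglyMeasurable κ := hks.comp_measurable hshear.measurable
  have hκm : Measurable κ := hκs.measurable
  have hκi : Integrable κ (volume.prod volume) :=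
    hshear.integrable_comp_of_integrable hk
  obtain ⟨Φ, hΦ⟩ : ∃ Φ : E3 → E3 → ℂ, Φ = fun r l => waveIntegral (fun q => κ (l, q)) r :=
    ⟨_, rfl⟩
  have hwi (r : E3) : Integrable (fun z : E3 × E3 => κ z * wave (inner ℝ z.2 r))
      (volume.prod volume) :=
    hκi.mul_bdd (c := 1) (Continuous.aestronglyMeasurable (by fun_prop))
      (ae_of_all _ fun p => (norm_wave _).le)
  have hΦs : StronglyMeasurable fun z : E3 × E3 => Φ z.1 z.2 := by
    have h : StronglyMeasurable fun y : (E3 × E3) × E3 =>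
        κ (y.1.2, y.2) * wave (inner ℝ y.2 y.1.1) := by
      have h1 : Continuous fun y : (E3 × E3) × E3 => wave (inner ℝ y.2 y.1.1) := by fun_prop
      exact (hκs.comp_measurable (by fun_prop)).mul h1.stronglyMeasurable
    rw [hΦ]
    exact h.integral_prod_right
  have hΦs' (r : E3) : StronglyMeasurable (Φ r) := hΦs.comp_measurable measurable_prodMk_left
  have hΦi (r : E3) : Integrable (Φ r) := by
    rw [hΦ]
    exact (hwi r).integral_prod_left
  have hΦm := hΦs.measurable
  have hWm : Measurable fun z : E3 × E3 => waveIntegral (Φ z.2) z.1 := by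
    have h : StronglyMeasurable fun y : (E3 × E3) × E3 =>
        Φ y.1.2 y.2 * wave (inner ℝ y.2 y.1.1) := by
      have h1 : Continuous fun y : (E3 × E3) × E3 => wave (inner ℝ y.2 y.1.1) := by fun_prop
      exact (hΦs.comp_measurable (g := fun y : (E3 × E3) × E3 => (y.1.2, y.2))
        (by fun_prop)).mul h1.stronglyMeasurable
    exact h.integral_prod_right.measurable
  have hWm' (r : E3) : Measurable (waveIntegral (Φ r)) :=
    (stronglyMeasurable_waveIntegral (hΦs' r)).measurable
  -- the Fourier integral in the variables `x` and `r = x - y`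
  have hkey (x r : E3) : ∫ z, k z * wave (inner ℝ z.1 x - inner ℝ z.2 (x - r))
      ∂(volume.prod volume) = waveIntegral (Φ r) x := by
    rw [← hshear.integral_comp hemb, waveIntegral]
    have e (z : E3 × E3) : k (z.1 + z.2, z.2) * wave (inner ℝ (z.1 + z.2) x - inner ℝ z.2 (x - r)) =
        κ z * wave (inner ℝ z.2 r) * wave (inner ℝ z.1 x) := by
      have h1 : inner ℝ (z.1 + z.2) x - inner ℝ z.2 (x - r) = inner ℝ z.2 r + inner ℝ z.1 x := by
        rw [inner_add_left, inner_sub_right]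
        ring
      rw [h1, wave_add, hκ]
      ring
    simp_rw [e]
    rw [integral_prod]
    · refine integral_congr_ae (ae_of_all _ fun l => ?_)
      simp only [hΦ, waveIntegral]
      rw [← integral_mul_const]
    · exact (hwi r).mul_bdd (c := 1) (Continuous.aestronglyMeasurable (by fun_prop))
        (ae_of_all _ fun p => (norm_wave _).le)
  calc _ = ∫⁻ x, ∫⁻ r, ‖waveIntegral (Φ r) x‖ₑ ^ 2 * ENNReal.ofReal (1 / ‖r‖) := by
        refine lintegral_congr fun x => ?_
        rw [← lintegral_sub_left_eq_self _ x]
        refine lintegral_congr fun r => ?_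
        rw [hkey, sub_sub_cancel]
    _ = ∫⁻ r, ∫⁻ x, ENNReal.ofReal (1 / ‖r‖) * ‖waveIntegral (Φ r) x‖ₑ ^ 2 := by
        rw [lintegral_lintegral_swap (by fun_prop)]
        simp_rw [mul_comm]
    _ ≤ ∫⁻ r, ENNReal.ofReal (1 / ‖r‖) *
          (ENNReal.ofReal ((2 * Real.pi) ^ 3) * ∫⁻ l, ‖Φ r l‖ₑ ^ 2) := by
        refine lintegral_mono fun r => ?_
        rw [lintegral_const_mul _ ((hWm' r).enorm.pow_const 2)]
        exact mul_le_mul_right (lintegral_waveIntegral_sq_le (hΦi r) (hΦs' r)) _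
    _ = ∫⁻ r, ∫⁻ l, ENNReal.ofReal ((2 * Real.pi) ^ 3) *
          (‖Φ r l‖ₑ ^ 2 * ENNReal.ofReal (1 / ‖r‖)) := by
        refine lintegral_congr fun r => ?_
        have h1 : Measurable fun l => ‖Φ r l‖ₑ ^ 2 := ((hΦs' r).measurable.enorm).pow_const 2
        rw [lintegral_const_mul _ (h1.mul_const _), lintegral_mul_const _ h1]
        ring
    _ = ∫⁻ l, ∫⁻ r, ENNReal.ofReal ((2 * Real.pi) ^ 3) *
          (‖Φ r l‖ₑ ^ 2 * ENNReal.ofReal (1 / ‖r‖)) := by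
        refine lintegral_lintegral_swap (Measurable.aemeasurable ?_)
        exact ((hΦm.enorm.pow_const 2).mul (by fun_prop)).const_mul _
    _ = ∫⁻ l, ENNReal.ofReal ((2 * Real.pi) ^ 3) *
          ∫⁻ r, ‖Φ r l‖ₑ ^ 2 * ENNReal.ofReal (1 / ‖r‖) := by
        refine lintegral_congr fun l => lintegral_const_mul _ ?_
        exact ((hΦm.comp measurable_prodMk_right).enorm.pow_const 2).mul (by fun_prop)
    _ ≤ ∫⁻ l, ENNReal.ofReal ((2 * Real.pi) ^ 3) *
          (ENNReal.ofReal ((2 * Real.pi) ^ 3 * (Real.pi / 2)) *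
            ∫⁻ q, ENNReal.ofReal ‖q‖ * ‖κ (l, q)‖ₑ ^ 2) := by
        refine lintegral_mono_ae ?_
        filter_upwards [hκi.prod_right_ae] with l hl
        rw [hΦ]
        exact mul_le_mul_right
          (lintegral_waveIntegral_kato hl (hκs.comp_measurable measurable_prodMk_left)) _
    _ = ENNReal.ofReal ((2 * Real.pi) ^ 6 * (Real.pi / 2)) *
          ∫⁻ q, ∫⁻ l, ENNReal.ofReal ‖q‖ * ‖κ (l, q)‖ₑ ^ 2 := by
        simp_rw [← mul_assoc (ENNReal.ofReal ((2 * Real.pi) ^ 3))]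
        rw [← ENNReal.ofReal_mul (by positivity), lintegral_const_mul _ (by fun_prop),
          lintegral_lintegral_swap (by fun_prop)]
        congr 2
        ring
    _ = _ := by
        congr 1
        refine lintegral_congr fun q => ?_
        exact lintegral_add_right_eq_self (fun p => ENNReal.ofReal ‖q‖ * ‖k (p, q)‖ₑ ^ 2) q

/-! ### The exchange term -/

section Exchange

variable {Λ : ℝ} {Q : Space Λ →L[ℂ] Space Λ}

lemma ballMeasure_prod : (ballMeasure Λ).prod (ballMeasure Λ) =
    ((volume : Measure E3).prod volume).restrict (Metric.ball 0 Λ ×ˢ Metric.ball 0 Λ) := by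
  rw [ballMeasure, Measure.prod_restrict]

lemma momentumKernel_eq_zero_of_notMem_prod {z : E3 × E3}
    (hz : z ∉ Metric.ball (0 : E3) Λ ×ˢ Metric.ball (0 : E3) Λ) :
    momentumKernel Q z.1 z.2 = 0 := by
  refine momentumKernel_of_notMem fun h => hz ?_
  rw [Set.mem_prod, mem_ball_zero_iff, mem_ball_zero_iff]
  exact h

lemma integrable_momentumKernel_entry (hQ : IsHilbertSchmidt Q) (i j : Fin 4) :
    Integrable (fun z : E3 × E3 => momentumKernel Q z.1 z.2 i j) (volume.prod volume) := by
  have h : Integrable (fun z : E3 × E3 => momentumKernel Q z.1 z.2 i j)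
      ((ballMeasure Λ).prod (ballMeasure Λ)) :=
    ((isKernel_momentumKernel hQ).1 i j).integrable one_le_two
  rw [ballMeasure_prod] at h
  refine (integrableOn_iff_integrable_of_support_subset fun z hz => ?_).mp h
  by_contra hc
  exact hz (by simp [momentumKernel_eq_zero_of_notMem_prod hc])

/-- A strongly measurable and integrable representative of an entry of the momentum kernel, on all
of `ℝ³ × ℝ³`. -/
def entryRep (Q : Space Λ →L[ℂ] Space Λ) (hQ : IsHilbertSchmidt Q) (i j : Fin 4) : E3 × E3 → ℂ :=
  (integrable_momentumKernel_entry hQ i j).1.mk _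

lemma entryRep_ae (hQ : IsHilbertSchmidt Q) (i j : Fin 4) :
    (fun z : E3 × E3 => momentumKernel Q z.1 z.2 i j) =ᵐ[volume.prod volume]
      entryRep Q hQ i j :=
  (integrable_momentumKernel_entry hQ i j).1.ae_eq_mk

lemma stronglyMeasurable_entryRep (hQ : IsHilbertSchmidt Q) (i j : Fin 4) :
    StronglyMeasurable (entryRep Q hQ i j) :=
  (integrable_momentumKernel_entry hQ i j).1.stronglyMeasurable_mk

lemma positionKernel_eq (hQ : IsHilbertSchmidt Q) (i j : Fin 4) (x y : E3) :
    positionKernel Q x y i j = 1 / ((2 * Real.pi : ℝ) : ℂ) ^ 3 *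
      ∫ z, entryRep Q hQ i j z * wave (inner ℝ z.1 x - inner ℝ z.2 y) ∂(volume.prod volume) := by
  rw [positionKernel, Matrix.of_apply, ballMeasure_prod,
    setIntegral_eq_integral_of_forall_compl_eq_zero]
  · congr 1
    refine integral_congr_ae ?_
    filter_upwards [entryRep_ae hQ i j] with z hz
    rw [← hz, wave]
  · intro z hz
    rw [momentumKernel_eq_zero_of_notMem_prod hz, Matrix.zero_apply, zero_mul]

lemma stronglyMeasurable_positionKernel (hQ : IsHilbertSchmidt Q) (i j : Fin 4) :
    StronglyMeasurable fun z : E3 × E3 => positionKernel Q z.1 z.2 i j := by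
  simp_rw [positionKernel_eq hQ]
  refine StronglyMeasurable.const_mul ?_ _
  have h : StronglyMeasurable fun y : (E3 × E3) × (E3 × E3) =>
      entryRep Q hQ i j y.2 * wave (inner ℝ y.2.1 y.1.1 - inner ℝ y.2.2 y.1.2) := by
    have h1 : Continuous fun y : (E3 × E3) × (E3 × E3) =>
      wave (inner ℝ y.2.1 y.1.1 - inner ℝ y.2.2 y.1.2) := by fun_prop
    exact ((stronglyMeasurable_entryRep hQ i j).comp_measurable measurable_snd).mul
      h1.stronglyMeasurable
  exact h.integral_prod_right

lemma exchangeDensity_nonneg (z : E3 × E3) : 0 ≤ exchangeDensity Q z := by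
  rw [exchangeDensity]
  positivity

lemma lintegral_positionKernel_entry_le (hQ : IsHilbertSchmidt Q) (i j : Fin 4) :
    ∫⁻ z : E3 × E3, ‖positionKernel Q z.1 z.2 i j‖ₑ ^ 2 *
      ENNReal.ofReal (1 / ‖z.1 - z.2‖) ≤ ENNReal.ofReal (Real.pi / 2) *
      ∫⁻ z, ENNReal.ofReal ‖z.2‖ * ‖momentumKernel Q z.1 z.2 i j‖ₑ ^ 2
        ∂((ballMeasure Λ).prod (ballMeasure Λ)) := by
  have hks := stronglyMeasurable_entryRep hQ i j
  have hki : Integrable (entryRep Q hQ i j) (volume.prod volume) :=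
    (integrable_momentumKernel_entry hQ i j).congr (entryRep_ae hQ i j)
  have hpm := (stronglyMeasurable_positionKernel hQ i j).measurable
  have h3 := lintegral_lintegral_kato hki hks
  have hpos := positionKernel_eq hQ i j
  have hae := entryRep_ae hQ i j
  generalize entryRep Q hQ i j = k at hks hki h3 hpos hae
  have hkm : Measurable k := hks.measurable
  have h1 : ∫⁻ z, ENNReal.ofReal ‖z.2‖ * ‖momentumKernel Q z.1 z.2 i j‖ₑ ^ 2
      ∂((ballMeasure Λ).prod (ballMeasure Λ)) =
      ∫⁻ q, ∫⁻ p, ENNReal.ofReal ‖q‖ * ‖k (p, q)‖ₑ ^ 2 := by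
    rw [ballMeasure_prod, setLIntegral_eq_of_support_subset]
    · rw [← lintegral_prod_symm' (fun z : E3 × E3 => ENNReal.ofReal ‖z.2‖ * ‖k z‖ₑ ^ 2)
        (by fun_prop)]
      refine lintegral_congr_ae ?_
      filter_upwards [hae] with z hz
      rw [hz]
    · intro z hz
      by_contra hc
      exact hz (by simp [momentumKernel_eq_zero_of_notMem_prod hc])
  obtain ⟨J, hJ⟩ : ∃ J : E3 → E3 → ℂ, ∀ x y, J x y =
      ∫ z, k z * wave (inner ℝ z.1 x - inner ℝ z.2 y) ∂(volume.prod volume) :=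
    ⟨_, fun _ _ => rfl⟩
  have hJm : Measurable fun z : E3 × E3 => ‖J z.1 z.2‖ₑ ^ 2 * ENNReal.ofReal (1 / ‖z.1 - z.2‖) := by
    have h : StronglyMeasurable fun y : (E3 × E3) × (E3 × E3) =>
        k y.2 * wave (inner ℝ y.2.1 y.1.1 - inner ℝ y.2.2 y.1.2) := by
      have h1 : Continuous fun y : (E3 × E3) × (E3 × E3) =>
        wave (inner ℝ y.2.1 y.1.1 - inner ℝ y.2.2 y.1.2) := by fun_prop
      exact (hks.comp_measurable measurable_snd).mul h1.stronglyMeasurable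
    simp_rw [hJ]
    exact (h.integral_prod_right.measurable.enorm.pow_const 2).mul (by fun_prop)
  simp_rw [← hJ] at h3 hpos
  have h2 (z : E3 × E3) : ‖positionKernel Q z.1 z.2 i j‖ₑ ^ 2 * ENNReal.ofReal (1 / ‖z.1 - z.2‖) =
      ENNReal.ofReal (1 / (2 * Real.pi) ^ 6) *
      (‖J z.1 z.2‖ₑ ^ 2 * ENNReal.ofReal (1 / ‖z.1 - z.2‖)) := by
    rw [hpos, enorm_mul, mul_pow, ← mul_assoc]
    congr 2
    rw [← ofReal_norm, ← ENNReal.ofReal_pow (norm_nonneg _), norm_div, norm_one, norm_pow,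
      norm_real, Real.norm_of_nonneg (by positivity)]
    congr 1
    field_simp
  simp_rw [h2]
  rw [lintegral_const_mul _ hJm, h1, Measure.volume_eq_prod, lintegral_prod _ hJm.aemeasurable]
  refine (mul_le_mul_right h3 _).trans (le_of_eq ?_)
  rw [← mul_assoc, ← ENNReal.ofReal_mul (by positivity)]
  congr 2
  field_simp

/-- Kato's inequality for the exchange term: `∬ |Q(x,y)|² / |x - y| ≤ (π / 2) ∬ |q| |Q̂(p,q)|²`. -/
lemma lintegral_exchangeDensity_le (hQ : IsHilbertSchmidt Q) :
    ∫⁻ z, ENNReal.ofReal (exchangeDensity Q z) ≤ ENNReal.ofReal (Real.pi / 2) *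
      ∫⁻ z, ENNReal.ofReal ‖z.2‖ * ‖matVec (momentumKernel Q z.1 z.2)‖ₑ ^ 2
        ∂((ballMeasure Λ).prod (ballMeasure Λ)) := by
  have e (z : E3 × E3) : ENNReal.ofReal (exchangeDensity Q z) = ∑ i, ∑ j,
      ‖positionKernel Q z.1 z.2 i j‖ₑ ^ 2 * ENNReal.ofReal (1 / ‖z.1 - z.2‖) := by
    rw [exchangeDensity, ← norm_matVec_sq, div_eq_mul_one_div, ENNReal.ofReal_mul (by positivity),
      ENNReal.ofReal_pow (norm_nonneg _), ofReal_norm, enorm_sq_matVec]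
    simp_rw [Finset.sum_mul]
  have hpm (i j : Fin 4) : Measurable fun z : E3 × E3 => ‖positionKernel Q z.1 z.2 i j‖ₑ ^ 2 *
      ENNReal.ofReal (1 / ‖z.1 - z.2‖) :=
    ((stronglyMeasurable_positionKernel hQ i j).measurable.enorm.pow_const 2).mul (by fun_prop)
  have hkm (i j : Fin 4) : AEMeasurable (fun z : E3 × E3 =>
      ENNReal.ofReal ‖z.2‖ * ‖momentumKernel Q z.1 z.2 i j‖ₑ ^ 2)
      ((ballMeasure Λ).prod (ballMeasure Λ)) := by
    have := ((isKernel_momentumKernel hQ).1 i j).1.enorm.pow_const 2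
    exact AEMeasurable.mul (by fun_prop) this
  simp_rw [e, enorm_sq_matVec, Finset.mul_sum]
  rw [lintegral_finsetSum _ fun i _ => Finset.measurable_fun_sum _ fun j _ => hpm i j,
    lintegral_finsetSum' _ fun i _ => Finset.aemeasurable_fun_sum _ fun j _ => hkm i j,
    Finset.mul_sum]
  refine Finset.sum_le_sum fun i _ => ?_
  rw [lintegral_finsetSum _ fun j _ => hpm i j, lintegral_finsetSum' _ fun j _ => hkm i j,
    Finset.mul_sum]
  exact Finset.sum_le_sum fun j _ => lintegral_positionKernel_entry_le hQ i j

end Exchange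

/-! ### The kinetic energy dominates the exchange term -/

section Energy

variable {α m₀ Λ : ℝ} {v : E3 → CliffordVector} {f : E3 → Mat4} {Q : Space Λ →L[ℂ] Space Λ}

lemma aemeasurable_enorm_momentumKernel (hQ : IsHilbertSchmidt Q) :
    AEMeasurable (fun z : E3 × E3 => ‖matVec (momentumKernel Q z.1 z.2)‖ₑ ^ 2)
      ((ballMeasure Λ).prod (ballMeasure Λ)) := by
  simp_rw [enorm_sq_matVec]
  exact Finset.aemeasurable_fun_sum _ fun i _ => Finset.aemeasurable_fun_sum _ fun j _ =>
    ((isKernel_momentumKernel hQ).1 i j).1.enorm.pow_const 2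

lemma eq_zero_of_momentumKernel_ae_eq_zero (hQ : IsHilbertSchmidt Q)
    (h : ∀ᵐ z ∂((ballMeasure Λ).prod (ballMeasure Λ)), momentumKernel Q z.1 z.2 = 0) : Q = 0 := by
  ext1 ψ
  refine Lp.ext ?_
  filter_upwards [(isKernel_momentumKernel hQ).2 ψ, Measure.ae_ae_of_ae_prod h,
    Lp.coeFn_zero Spinor 2 (ballMeasure Λ)] with p h1 h2 h3
  rw [h1, zero_apply, h3]
  refine integral_eq_zero_of_ae ?_
  filter_upwards [h2] with q hq
  rw [hq]
  simp

/-- The kinetic energy of `Q` in terms of its momentum kernel, from `Q² ≤ Q⁺⁺ - Q⁻⁻`. -/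
lemma IsSelfConsistent.lintegral_le_vacuumTrace (h : IsSelfConsistent α m₀ Λ v) (hm : 0 < m₀)
    (hΛ : 0 < Λ) (hf : f =ᵐ[ballMeasure Λ] vacuumSymbol v) (hQ : Q ∈ bdfStates Λ f) :
    0 ≤ (vacuumTrace Λ f (meanField α m₀ Λ f * Q)).re ∧
    ∫⁻ z, ENNReal.ofReal ‖meanFieldVector α m₀ Λ v z.2‖ *
        ‖matVec (momentumKernel Q z.1 z.2)‖ₑ ^ 2 ∂((ballMeasure Λ).prod (ballMeasure Λ)) ≤
      ENNReal.ofReal (vacuumTrace Λ f (meanField α m₀ Λ f * Q)).re := by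
  obtain ⟨hPs, hPP, s, hs, hsm, hM⟩ := h.exists_sqrt hm hΛ hf
  obtain ⟨w, b, hsum, hle⟩ := tsum_norm_sq_le_vacuumTrace hPs hPP hs (hM Q) hQ.1 hQ.2.1 hQ.2.2.1
  have hGm : StronglyMeasurable (meanFieldVector α m₀ Λ v) :=
    stronglyMeasurable_meanFieldVector h.measurable
  obtain ⟨C, hC⟩ := h.norm_meanFieldVector_le hm hΛ
  have hK := (isKernel_momentumKernel hQ.1.1).mul_multiplier hsm (C := √C)
    (by have := hGm.measurable; fun_prop) (by
      filter_upwards [ae_ballMeasure_mem Λ] with q hq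
      rw [norm_real, Real.norm_of_nonneg (Real.sqrt_nonneg _)]
      exact Real.sqrt_le_sqrt (hC q (by simpa using hq)))
  refine ⟨(tsum_nonneg fun i => sq_nonneg _).trans hle,
    le_trans (le_of_eq ?_) (ENNReal.ofReal_le_ofReal hle)⟩
  rw [ofReal_tsum_norm_sq hsum, tsum_enorm_sq_eq_lintegral b hK, lintegral_prod]
  · refine lintegral_congr fun p => lintegral_congr fun q => ?_
    rw [enorm_sq_matVec, enorm_sq_matVec, Finset.mul_sum]
    refine Finset.sum_congr rfl fun i _ => ?_
    rw [Finset.mul_sum]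
    refine Finset.sum_congr rfl fun j _ => ?_
    rw [Matrix.smul_apply, smul_eq_mul, enorm_mul, mul_pow]
    congr 1
    rw [← ofReal_norm ((√‖meanFieldVector α m₀ Λ v q‖ : ℝ) : ℂ), norm_real,
      Real.norm_of_nonneg (Real.sqrt_nonneg _), ← ENNReal.ofReal_pow (Real.sqrt_nonneg _),
      Real.sq_sqrt (norm_nonneg _)]
  · refine AEMeasurable.mul ?_ (aemeasurable_enorm_momentumKernel hQ.1.1)
    exact (hGm.measurable.norm.ennreal_ofReal.comp measurable_snd).aemeasurable

/-- The kinetic energy controls the exchange term, by Kato's inequality, `α π / 4 ≤ 1` and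
`|𝒟⁰(q)| > |q|`. -/
lemma IsSelfConsistent.exchange_le_vacuumTrace (h : IsSelfConsistent α m₀ Λ v) (hα₀ : 0 ≤ α)
    (hα : α ≤ 4 / Real.pi) (hm : 0 < m₀) (hΛ : 0 < Λ)
    (hf : f =ᵐ[ballMeasure Λ] vacuumSymbol v) (hQ : Q ∈ bdfStates Λ f) :
    Integrable (exchangeDensity Q) ∧
    α / 2 * ∫ z, exchangeDensity Q z ≤ (vacuumTrace Λ f (meanField α m₀ Λ f * Q)).re ∧
    ((vacuumTrace Λ f (meanField α m₀ Λ f * Q)).re ≤ α / 2 * ∫ z, exchangeDensity Q z → Q = 0) := by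
  set t := (vacuumTrace Λ f (meanField α m₀ Λ f * Q)).re with ht
  have hHS := hQ.1.1
  have hGm : StronglyMeasurable (meanFieldVector α m₀ Λ v) :=
    stronglyMeasurable_meanFieldVector h.measurable
  have hGm' := hGm.measurable
  obtain ⟨ht0, hW⟩ := h.lintegral_le_vacuumTrace hm hΛ hf hQ
  have hX := lintegral_exchangeDensity_le hHS
  have hKm := aemeasurable_enorm_momentumKernel hHS
  set μ := (ballMeasure Λ).prod (ballMeasure Λ) with hμ
  set X := ∫⁻ z, ENNReal.ofReal ‖z.2‖ * ‖matVec (momentumKernel Q z.1 z.2)‖ₑ ^ 2 ∂μ with hXdef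
  set Y := ∫⁻ z, ENNReal.ofReal (‖meanFieldVector α m₀ Λ v z.2‖ - ‖z.2‖) *
    ‖matVec (momentumKernel Q z.1 z.2)‖ₑ ^ 2 ∂μ with hYdef
  have hgapm : AEMeasurable (fun z : E3 × E3 =>
      ENNReal.ofReal (‖meanFieldVector α m₀ Λ v z.2‖ - ‖z.2‖)) μ :=
    ((hGm'.norm.sub measurable_norm).ennreal_ofReal.comp measurable_snd).aemeasurable
  have hXY : X + Y ≤ ENNReal.ofReal t := by
    refine le_trans (le_of_eq ?_) hW
    have hm1 : AEMeasurable (fun z : E3 × E3 =>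
        ENNReal.ofReal ‖z.2‖ * ‖matVec (momentumKernel Q z.1 z.2)‖ₑ ^ 2) μ :=
      AEMeasurable.mul (by fun_prop) hKm
    rw [hXdef, hYdef, ← lintegral_add_left' hm1]
    refine lintegral_congr fun z => ?_
    rw [← add_mul, ← ENNReal.ofReal_add (norm_nonneg _) (sub_nonneg.mpr (h.norm_lt hm z.2).le),
      add_sub_cancel]
  have hXtop : X ≠ ⊤ := ne_top_of_le_ne_top ENNReal.ofReal_ne_top (le_self_add.trans hXY)
  have hYtop : Y ≠ ⊤ := ne_top_of_le_ne_top ENNReal.ofReal_ne_top (le_add_self.trans hXY)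
  have hEm : AEStronglyMeasurable (exchangeDensity Q) volume := by
    refine Measurable.aestronglyMeasurable ?_
    have h1 (i j : Fin 4) : Measurable fun z : E3 × E3 => positionKernel Q z.1 z.2 i j :=
      (stronglyMeasurable_positionKernel hHS i j).measurable
    change Measurable fun z => exchangeDensity Q z
    unfold exchangeDensity
    exact (Finset.measurable_fun_sum _ fun i _ => Finset.measurable_fun_sum _ fun j _ =>
      (h1 i j).norm.pow_const 2).div (by fun_prop)
  have hE0 : 0 ≤ᵐ[volume] exchangeDensity Q := ae_of_all _ fun z => exchangeDensity_nonneg z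
  have hint : Integrable (exchangeDensity Q) := by
    refine ⟨hEm, ?_⟩
    rw [hasFiniteIntegral_iff_ofReal hE0]
    exact hX.trans_lt (ENNReal.mul_lt_top ENNReal.ofReal_lt_top hXtop.lt_top)
  have hEX : ∫ z, exchangeDensity Q z ≤ Real.pi / 2 * X.toReal := by
    rw [integral_eq_lintegral_of_nonneg_ae hE0 hEm]
    refine (ENNReal.toReal_mono (ENNReal.mul_ne_top ENNReal.ofReal_ne_top hXtop) hX).trans ?_
    rw [ENNReal.toReal_mul, ENNReal.toReal_ofReal (by positivity)]
  have hαX : α / 2 * ∫ z, exchangeDensity Q z ≤ X.toReal := by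
    have h1 : α * Real.pi ≤ 4 := by rwa [le_div_iff₀ Real.pi_pos] at hα
    calc _ ≤ α / 2 * (Real.pi / 2 * X.toReal) := by gcongr
      _ = α * Real.pi / 4 * X.toReal := by ring
      _ ≤ 1 * X.toReal := by gcongr; linarith
      _ = _ := one_mul _
  replace ht0 : 0 ≤ t := ht0
  have hXYt : X.toReal + Y.toReal ≤ t := by
    rw [← ENNReal.toReal_add hXtop hYtop, ← ENNReal.toReal_ofReal ht0]
    exact ENNReal.toReal_mono ENNReal.ofReal_ne_top hXY
  have hY0 : 0 ≤ Y.toReal := ENNReal.toReal_nonneg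
  refine ⟨hint, by linarith, fun hle => ?_⟩
  have hY : Y = 0 := by
    have : Y.toReal = 0 := by linarith
    exact (ENNReal.toReal_eq_zero_iff Y).mp this |>.resolve_right hYtop
  replace hY := (lintegral_eq_zero_iff' (hgapm.mul hKm)).mp hY
  refine eq_zero_of_momentumKernel_ae_eq_zero hHS ?_
  filter_upwards [hY] with z hz
  have h1 : ENNReal.ofReal (‖meanFieldVector α m₀ Λ v z.2‖ - ‖z.2‖) ≠ 0 := by
    rw [Ne, ENNReal.ofReal_eq_zero, not_le]
    exact sub_pos.mpr (h.norm_lt hm z.2)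
  have h2 : matVec (momentumKernel Q z.1 z.2) = 0 := by
    simpa [h1] using hz
  ext i j
  have h3 := norm_entry_le (momentumKernel Q z.1 z.2) i j
  rw [h2, norm_zero] at h3
  exact norm_le_zero_iff.mp h3

end Energy

/-! ### The Coulomb form and the zero state -/

section Coulomb

variable {f g : E3 → ℂ}

lemma FiniteCoulomb.integrable_mul (hf : FiniteCoulomb f) (hg : FiniteCoulomb g) :
    Integrable fun k : E3 => conj (f k) * g k / ((‖k‖ ^ 2 : ℝ) : ℂ) := by
  refine (hf.2.add hg.2).mono' ?_ (ae_of_all _ fun k => ?_)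
  · have h1 : AEStronglyMeasurable (fun k => conj (f k)) volume :=
      continuous_conj.comp_aestronglyMeasurable hf.1
    have h2 : AEMeasurable (fun k : E3 => ((‖k‖ ^ 2 : ℝ) : ℂ)) volume := by fun_prop
    exact ((h1.mul hg.1).aemeasurable.div h2).aestronglyMeasurable
  · rw [norm_div, norm_mul, RCLike.norm_conj, norm_real, Real.norm_of_nonneg (by positivity),
      Pi.add_apply, ← add_div]
    gcongr
    nlinarith [sq_nonneg (‖f k‖ - ‖g k‖), sq_nonneg ‖f k‖, sq_nonneg ‖g k‖]

lemma re_coulombForm (hf : FiniteCoulomb f) (hg : FiniteCoulomb g) :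
    (coulombForm f g).re = 4 * Real.pi * ∫ k : E3, (conj (f k) * g k).re / ‖k‖ ^ 2 := by
  have e : (4 * Real.pi : ℂ) = ((4 * Real.pi : ℝ) : ℂ) := by push_cast; rfl
  have h := integral_re (hf.integrable_mul hg)
  simp only [RCLike.re_to_complex] at h
  rw [coulombForm, e, re_ofReal_mul, ← h]
  simp only [div_ofReal_re]

/-- The Coulomb form is positive: `D(f - g, f - g) ≥ 0`, expanded. -/
lemma coulombForm_sub_nonneg (hf : FiniteCoulomb f) (hg : FiniteCoulomb g) :
    0 ≤ (coulombForm f f).re - 2 * (coulombForm f g).re + (coulombForm g g).re := by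
  have hi {f g : E3 → ℂ} (hf : FiniteCoulomb f) (hg : FiniteCoulomb g) :
      Integrable fun k : E3 => (conj (f k) * g k).re / ‖k‖ ^ 2 := by
    have := (hf.integrable_mul hg).re
    simpa only [RCLike.re_to_complex, div_ofReal_re] using this
  rw [re_coulombForm hf hf, re_coulombForm hf hg, re_coulombForm hg hg]
  have e : 4 * Real.pi * (∫ k : E3, (conj (f k) * f k).re / ‖k‖ ^ 2) -
      2 * (4 * Real.pi * ∫ k : E3, (conj (f k) * g k).re / ‖k‖ ^ 2) +
      4 * Real.pi * (∫ k : E3, (conj (g k) * g k).re / ‖k‖ ^ 2) =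
      4 * Real.pi * ∫ k : E3, ((conj (f k) * f k).re / ‖k‖ ^ 2 -
        2 * ((conj (f k) * g k).re / ‖k‖ ^ 2) + (conj (g k) * g k).re / ‖k‖ ^ 2) := by
    have hs : Integrable fun k : E3 => (conj (f k) * f k).re / ‖k‖ ^ 2 -
        2 * ((conj (f k) * g k).re / ‖k‖ ^ 2) := (hi hf hf).sub ((hi hf hg).const_mul 2)
    rw [integral_add hs (hi hg hg),
      integral_sub (hi hf hf) ((hi hf hg).const_mul 2), integral_const_mul]
    ring
  rw [e]
  refine mul_nonneg (by positivity) (integral_nonneg fun k => ?_)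
  have e2 : (conj (f k) * f k).re / ‖k‖ ^ 2 - 2 * ((conj (f k) * g k).re / ‖k‖ ^ 2) +
      (conj (g k) * g k).re / ‖k‖ ^ 2 =
      (((f k).re - (g k).re) ^ 2 + ((f k).im - (g k).im) ^ 2) / ‖k‖ ^ 2 := by
    simp only [mul_re, conj_re, conj_im]
    ring
  simp only [Pi.zero_apply]
  rw [e2]
  positivity

lemma coulombForm_self_nonneg (f : E3 → ℂ) : 0 ≤ (coulombForm f f).re := by
  have e : coulombForm f f = ((4 * Real.pi * ∫ k : E3, ‖f k‖ ^ 2 / ‖k‖ ^ 2 : ℝ) : ℂ) := by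
    rw [coulombForm]
    push_cast
    rw [← integral_complex_ofReal]
    congr 1
    refine integral_congr_ae (ae_of_all _ fun k => ?_)
    simp only
    rw [← Complex.normSq_eq_conj_mul_self, Complex.normSq_eq_norm_sq]
    push_cast
    rfl
  rw [e, ofReal_re]
  exact mul_nonneg (by positivity) (integral_nonneg fun k => by positivity)

/-- From `2 |g| ≤ |g|² / |k|² + |k|²`. -/
lemma FiniteCoulomb.locallyIntegrable (hg : FiniteCoulomb g) : LocallyIntegrable g volume := by
  have h : LocallyIntegrable (fun k : E3 => ‖g k‖ ^ 2 / ‖k‖ ^ 2 + ‖k‖ ^ 2) volume :=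
    hg.2.locallyIntegrable.add (by fun_prop : Continuous fun k : E3 => ‖k‖ ^ 2).locallyIntegrable
  refine h.mono hg.1 ?_
  filter_upwards [Measure.ae_ne volume (0 : E3)] with k hk
  have hk : 0 < ‖k‖ := norm_pos_iff.mpr hk
  rw [Real.norm_of_nonneg (by positivity)]
  have e : ‖g k‖ = ‖g k‖ / ‖k‖ * ‖k‖ := by field_simp
  rw [← div_pow]
  nlinarith [sq_nonneg (‖g k‖ / ‖k‖ - ‖k‖), sq_nonneg (‖g k‖ / ‖k‖), sq_nonneg ‖k‖]

/-- The Fourier transform of the zero distribution is unique as a locally integrable function. -/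
lemma HasFourier.ae_eq_zero (hg : FiniteCoulomb g) (h : HasFourier 0 g) : g =ᵐ[volume] 0 := by
  refine ae_eq_zero_of_integral_contDiff_smul_eq_zero hg.locallyIntegrable fun φ hφ hφc => ?_
  have hc : (2 * Real.pi) ≠ 0 := by positivity
  -- the test function `ξ ↦ φ(2πξ)` removes the scaling in `HasFourier`
  set ψ : E3 → ℂ := fun ξ => (φ ((2 * Real.pi) • ξ) : ℂ) with hψ
  have hψs : ContDiff ℝ (⊤ : ℕ∞) ψ :=
    (Complex.ofRealCLM.contDiff.comp hφ).comp (contDiff_const_smul _)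
  have hψc : HasCompactSupport ψ :=
    (hφc.comp_homeomorph (Homeomorph.smulOfNeZero (2 * Real.pi) hc)).comp_left
      (g := fun x : ℝ => (x : ℂ)) ofReal_zero
  set F : E3 → ℂ := fun k => (((2 * Real.pi) ^ (3 / 2 : ℝ) : ℝ) : ℂ) * (φ k • g k) with hF
  have e (ξ : E3) : (((2 * Real.pi) ^ (3 / 2 : ℝ) : ℝ) : ℂ) * g ((2 * Real.pi) • ξ) *
      (hψc.toSchwartzMap hψs) ξ = F ((2 * Real.pi) • ξ) := by
    simp [hψ, hF]
    ring
  have h1 := (h (hψc.toSchwartzMap hψs)).trans ((integral_congr_ae (ae_of_all _ e)).trans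
    (Measure.integral_comp_smul volume F (2 * Real.pi)))
  rw [hF, integral_const_mul] at h1
  have h0 : (𝓕 (0 : 𝓢'(E3, ℂ)) : 𝓢'(E3, ℂ)) = 0 := FourierTransform.fourier_zero
  rw [h0] at h1
  have h2 : (((2 * Real.pi) ^ (3 / 2 : ℝ) : ℝ) : ℂ) ≠ 0 := by
    rw [Ne, ofReal_eq_zero]
    positivity
  have h3 : |((2 * Real.pi) ^ Module.finrank ℝ E3)⁻¹| ≠ 0 := by positivity
  have h4 := h1.symm
  simpa [h2, h3, hc] using h4

lemma chargeFourier_zero : chargeFourier 0 =ᵐ[volume] 0 := by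
  rw [chargeFourier]
  split_ifs with h
  · exact h.choose_spec.2.ae_eq_zero h.choose_spec.1
  · rfl

lemma finiteCoulomb_chargeFourier {n : 𝓢'(E3, ℂ)} (hn : n ∈ coulombSpace) :
    FiniteCoulomb (chargeFourier n) := by
  have h : ∃ g : E3 → ℂ, FiniteCoulomb g ∧ HasFourier n g := hn
  rw [chargeFourier, dif_pos h]
  exact h.choose_spec.1

lemma coulombForm_chargeFourier_zero (f : E3 → ℂ) : coulombForm f (chargeFourier 0) = 0 := by
  rw [coulombForm, integral_eq_zero_of_ae, mul_zero]
  filter_upwards [chargeFourier_zero] with k hk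
  simp [hk]

end Coulomb

section ZeroState

variable {α m₀ Λ : ℝ} {v : E3 → CliffordVector} {f : E3 → Mat4}

lemma momentumKernel_zero :
    ∀ᵐ z ∂(volume : Measure E3).prod volume,
      momentumKernel (0 : Space Λ →L[ℂ] Space Λ) z.1 z.2 = 0 := by
  have hHS : IsHilbertSchmidt (0 : Space Λ →L[ℂ] Space Λ) := fun w b => by simp
  obtain ⟨w, b, -⟩ := exists_hilbertBasis ℂ (Space Λ)
  have h := tsum_enorm_sq_eq_lintegral b (isKernel_momentumKernel hHS)
  have hm := aemeasurable_enorm_momentumKernel hHS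
  rw [lintegral_lintegral hm] at h
  simp only [zero_apply, enorm_zero, ne_eq, OfNat.ofNat_ne_zero, not_false_eq_true, zero_pow,
    tsum_zero] at h
  replace h := (lintegral_eq_zero_iff' hm).mp h.symm
  rw [ballMeasure_prod, Filter.EventuallyEq, ae_restrict_iff'
    (Metric.isOpen_ball.measurableSet.prod Metric.isOpen_ball.measurableSet)] at h
  filter_upwards [h] with z hz
  by_cases hc : z ∈ Metric.ball (0 : E3) Λ ×ˢ Metric.ball (0 : E3) Λ
  · have h2 : matVec (momentumKernel (0 : Space Λ →L[ℂ] Space Λ) z.1 z.2) = 0 := by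
      simpa using hz hc
    ext i j
    have h3 := norm_entry_le (momentumKernel (0 : Space Λ →L[ℂ] Space Λ) z.1 z.2) i j
    rw [h2, norm_zero] at h3
    exact norm_le_zero_iff.mp h3
  · exact momentumKernel_eq_zero_of_notMem_prod hc

/-- The map `(k, b) ↦ (k + b, b)` preserves Lebesgue measure, so a kernel that vanishes almost
everywhere has almost everywhere vanishing fibre integrals. -/
lemma densityFourier_zero : densityFourier (0 : Space Λ →L[ℂ] Space Λ) =ᵐ[volume] 0 := by
  have h1 := (measurePreserving_add_prod (volume : Measure E3)
    (volume : Measure E3)).quasiMeasurePreserving.ae (momentumKernel_zero (Λ := Λ))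
  filter_upwards [Measure.ae_ae_of_ae_prod h1] with k hk
  have h2 := (measurePreserving_sub_right (volume : Measure E3)
    ((1 / 2 : ℝ) • k)).quasiMeasurePreserving.ae hk
  rw [densityFourier, integral_eq_zero_of_ae, mul_zero]
  · rfl
  · refine ae_restrict_of_ae ?_
    filter_upwards [h2] with p hp
    have e : k + (p - (1 / 2 : ℝ) • k) = p + (1 / 2 : ℝ) • k := by
      module
    simp only [e] at hp
    rw [hp, Matrix.trace_zero, Pi.zero_apply]

lemma zero_mem_bdfStates (hPs : IsSelfAdjoint (projMinus Λ f))
    (hPP : projMinus Λ f * projMinus Λ f = projMinus Λ f) : 0 ∈ bdfStates Λ f := by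
  have htc : IsTraceClass (0 : Space Λ →L[ℂ] Space Λ) := fun w b => by
    simp [CFC.abs_zero]
  refine ⟨⟨fun w b => by simp, by simpa using htc, by simpa using htc⟩, ?_, ?_, ?_, ?_⟩
  · have h := star_mul_self_nonneg (projMinus Λ f)
    rw [hPs.star_eq, hPP] at h
    simpa using h
  · have h := star_mul_self_nonneg (projPlus Λ f)
    have hs : star (projPlus Λ f) = projPlus Λ f := by
      rw [projPlus, star_sub, star_one, hPs.star_eq]
    have hpp : projPlus Λ f * projPlus Λ f = projPlus Λ f := by
      rw [projPlus, sub_mul, mul_sub, mul_sub, hPP]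
      simp
    rwa [hs, hpp] at h
  · exact aestronglyMeasurable_zero.congr densityFourier_zero.symm
  · refine (integrable_zero E3 ℝ volume).congr ?_
    filter_upwards [densityFourier_zero (Λ := Λ)] with k hk
    simp [hk]

lemma coulombForm_densityFourier_zero :
    coulombForm (densityFourier (0 : Space Λ →L[ℂ] Space Λ))
      (densityFourier (0 : Space Λ →L[ℂ] Space Λ)) = 0 := by
  rw [coulombForm, integral_eq_zero_of_ae, mul_zero]
  filter_upwards [densityFourier_zero (Λ := Λ)] with k hk
  simp [hk]

end ZeroState

end BDF

end

theorem mainTheorem2 (α m₀ Λ : ℝ) (hα₀ : 0 ≤ α) (hα : α ≤ 4 / Real.pi) (hΛ : 0 < Λ)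
    (hm₀ : 0 < m₀) :
    (∃ f, BDF.IsFreeVacuum α m₀ Λ f) ∧
    ∀ f, BDF.IsFreeVacuum α m₀ Λ f →
      (∀ Q ∈ BDF.bdfStates Λ f, Integrable (BDF.exchangeDensity Q)) ∧
      (∀ n ∈ BDF.coulombSpace,
        (∀ Q ∈ BDF.bdfStates Λ f,
          0 ≤ BDF.bdfEnergy α m₀ Λ f n Q
            + α / 2 * (BDF.coulombForm (BDF.chargeFourier n) (BDF.chargeFourier n)).re) ∧
        BddBelow (BDF.bdfEnergy α m₀ Λ f n '' BDF.bdfStates Λ f)) ∧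
      (∀ Q ∈ BDF.bdfStates Λ f, 0 ≤ BDF.bdfEnergy α m₀ Λ f 0 Q) ∧
      0 ∈ BDF.bdfStates Λ f ∧
      IsMinOn (BDF.bdfEnergy α m₀ Λ f 0) (BDF.bdfStates Λ f) 0 ∧
      (∀ Q ∈ BDF.bdfStates Λ f,
        IsMinOn (BDF.bdfEnergy α m₀ Λ f 0) (BDF.bdfStates Λ f) Q → Q = 0) := by
  obtain ⟨v, hvm, hv, hvle⟩ := BDF.exists_signField_eq hα₀ hα hΛ hm₀
  have h : BDF.IsSelfConsistent α m₀ Λ v := ⟨hvm, hv, hvle⟩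
  refine ⟨⟨_, h.isFreeVacuum hα₀ hα hm₀ hΛ⟩, fun f hf => ?_⟩
  have hfv := h.ae_eq_of_isFreeVacuum hα₀ hα hm₀ hΛ hf
  have hE {Q} (hQ : Q ∈ BDF.bdfStates Λ f) := h.exchange_le_vacuumTrace hα₀ hα hm₀ hΛ hfv hQ
  have hlow : ∀ n ∈ BDF.coulombSpace, ∀ Q ∈ BDF.bdfStates Λ f,
      0 ≤ BDF.bdfEnergy α m₀ Λ f n Q
        + α / 2 * (BDF.coulombForm (BDF.chargeFourier n) (BDF.chargeFourier n)).re := by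
    intro n hn Q hQ
    have h1 := (hE hQ).2.1
    have h2 := mul_nonneg (half_pos two_pos).le (mul_nonneg (div_nonneg hα₀ two_pos.le)
      (BDF.coulombForm_sub_nonneg hQ.2.2.2 (BDF.finiteCoulomb_chargeFourier hn)))
    rw [BDF.bdfEnergy]
    linarith
  have hnonneg : ∀ Q ∈ BDF.bdfStates Λ f, 0 ≤ BDF.bdfEnergy α m₀ Λ f 0 Q := by
    intro Q hQ
    have h1 := (hE hQ).2.1
    have h2 := mul_nonneg (div_nonneg hα₀ two_pos.le)
      (BDF.coulombForm_self_nonneg (BDF.densityFourier Q))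
    rw [BDF.bdfEnergy, BDF.coulombForm_chargeFourier_zero, Complex.zero_re]
    linarith
  obtain ⟨hPs, hPP, -⟩ := h.exists_sqrt hm₀ hΛ hfv
  have h0 := BDF.zero_mem_bdfStates hPs hPP
  have hzero : BDF.bdfEnergy α m₀ Λ f 0 0 = 0 := by
    refine le_antisymm ?_ (hnonneg 0 h0)
    have h1 : 0 ≤ α / 2 * ∫ z, BDF.exchangeDensity (0 : BDF.Space Λ →L[ℂ] BDF.Space Λ) z :=
      mul_nonneg (div_nonneg hα₀ two_pos.le) (integral_nonneg BDF.exchangeDensity_nonneg)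
    have h2 : BDF.vacuumTrace Λ f (BDF.meanField α m₀ Λ f * 0) = 0 := by
      simp [BDF.vacuumTrace, BDF.opTrace]
    rw [BDF.bdfEnergy, BDF.coulombForm_chargeFourier_zero, BDF.coulombForm_densityFourier_zero, h2,
      Complex.zero_re]
    linarith
  refine ⟨fun Q hQ => (hE hQ).1, fun n hn => ⟨hlow n hn, ?_⟩, hnonneg, h0, ?_, ?_⟩
  · refine ⟨-(α / 2 * (BDF.coulombForm (BDF.chargeFourier n) (BDF.chargeFourier n)).re), ?_⟩
    rintro _ ⟨Q, hQ, rfl⟩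
    linarith [hlow n hn Q hQ]
  · refine isMinOn_iff.mpr fun Q hQ => ?_
    rw [hzero]
    exact hnonneg Q hQ
  · intro Q hQ hmin
    refine (hE hQ).2.2 ?_
    have h1 := isMinOn_iff.mp hmin 0 h0
    have h2 := mul_nonneg (div_nonneg hα₀ two_pos.le)
      (BDF.coulombForm_self_nonneg (BDF.densityFourier Q))
    rw [hzero, BDF.bdfEnergy, BDF.coulombForm_chargeFourier_zero, Complex.zero_re] at h1
    linarith
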